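/- Let $\Sigma^2$ be a smooth $2$-manifold, $(M^3,g)$ a smooth Riemannian $3$-manifold, $f:\Sigma^2\to M^3$ a front (a $C^\infty$ map having near every point a smooth unit normal field $\nu$ which is an immersion into $TM^3$), and $p$ a swallowtail of $f$, i.e. the germ of $f$ at $p$ is right-left equivalent to $(u,v)\mapsto(u,4v^3+2uv,3v^4+uv^2)$ at the origin. (Orientations enter only through the signs of $\det_g$ and of local frames; those are taken with respect to the local coordinates in use.) Let $\nabla$ be the Levi-Civita connection, let $\gamma$ be a regular parametrization of the singular set near $p$ with $\gamma(0)=p$, put $\hat\gamma=f\circ\gamma$, and let $s$ be the arclength of $\hat\gamma$ measured from $p$. For a unit normal field $\nu$ near $p$ define: * the limiting normal curvature $\kappa_\nu(p)=\langle f_{uu},\nu\rangle/|f_u|^2$ at $p$, where $(u,v)$ are local coordinates with $f_v(p)=0$ and $f_{uu}=\nabla_{\partial_u}f_u$; * along $\gamma$ off $p$, with $\lambda=\det_g(f_u,f_v,\nu)$ and $\eta$ a smooth vector field that is null ($df(\eta)=0$) along $\gamma$ and such that $(\gamma',\eta)$ is positive, the singular curvature $\kappa_s=\operatorname{sgn}(d\lambda(\eta))\det_g(\hat\gamma',\hat\gamma'',\nu)/|\hat\gamma'|^3$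 and the cuspidal curvature $\kappa_c=|\hat\gamma'|^{3/2}\det_g(\hat\gamma',f_{\eta\eta},f_{\eta\eta\eta})/|\hat\gamma'\times_g f_{\eta\eta}|^{5/2}$, where $f_\eta=df(\eta)$, $f_{\eta\eta}=\nabla_\eta f_\eta$, $f_{\eta\eta\eta}=\nabla_\eta f_{\eta\eta}$; * $\tau_s=2\sqrt2\,\lim_{s\to0}\sqrt{|s|}\,|\kappa_s|$ and $\tau_c=\frac{\sqrt{2\sqrt2}}2\lim_{s\to0}\bigl||s|^{1/4}\kappa_c\bigr|$. Call local coordinates $(u,v)$ centered at $p$ adapted if $f_u(p)=0$, the $u$-axis is the singular set near $p$, and $|f_v(p)|=1$. For adapted coordinates let $\kappa_H(p)$ and $\hat K(p)$ be the values at $p$ of the continuous extensions of $2vH$ and $vK$, where $H$ is the mean curvature of $f$ with respect to $\nu$ and $K$ is the Gaussian curvature of the induced metric (another choice of adapted coordinates can change both only by a common sign). Then adapted coordinates exist; for every $\nu$ the numbers $\kappa_\nu(p)$, $\tau_s$, $\tau_c$ exist and do not depend on the choices made; and for every choice of adapted coordinates $\kappa_H(p)$ and $\hat K(p)$ exist and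 $$\tau_c=\sqrt{|\tau_s|}\,|\kappa_H(p)|,\qquad \sqrt{|\tau_s|}\,\hat K(p)=\sqrt{|\tau_s|}\,\kappa_\nu(p)\kappa_H(p)=\operatorname{sgn}(\kappa_H(p))\,\kappa_\nu(p)\,\tau_c .$$ Moreover $|\operatorname{sgn}(\kappa_H(p))\,\kappa_\nu(p)\,\tau_c|$ is intrinsic: if $f'$ is a front from a $2$-manifold to a Riemannian $3$-manifold with a swallowtail $p'$, and a local diffeomorphism of the source surfaces taking $p$ to $p'$ pulls the first fundamental form of $f'$ back to that of $f$ near $p$, then the two values coincide. -/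

import Mathlib

open Set Filter Topology MeasureTheory
open scoped Manifold ContDiff

noncomputable section

/-! ### Riemannian geometry in coordinates -/

/-- The coordinate space `ℝⁿ`. -/
abbrev Euc (n : ℕ) := EuclideanSpace ℝ (Fin n)

/-- The `i`-th coordinate vector of `ℝⁿ`. -/
def basisVec {n : ℕ} (i : Fin n) : Euc n := EuclideanSpace.single i 1

/-- The partial derivative `∂ᵢ h (x)`. -/
def pderiv {n : ℕ} {W : Type*} [NormedAddCommGroup W] [NormedSpace ℝ W]
    (i : Fin n) (h : Euc n → W) (x : Euc n) : W := fderiv ℝ h x (basisVec i)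

/-- The Christoffel symbol `Γᵏᵢⱼ` of the metric with matrix `G`. -/
def christoffel {n : ℕ} (G : Euc n → Matrix (Fin n) (Fin n) ℝ) (k i j : Fin n) (x : Euc n) : ℝ :=
  (1 / 2) * ∑ l, (G x)⁻¹ k l *
    (pderiv i (fun y => G y j l) x + pderiv j (fun y => G y i l) x - pderiv l (fun y => G y i j) x)

/-- The inner product of `a` and `b` at the point `y`. -/
def gInner {n : ℕ} (G : Euc n → Matrix (Fin n) (Fin n) ℝ) (y a b : Euc n) : ℝ :=
  ∑ i, ∑ j, G y i j * a i * b j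

/-- The length of `a` at the point `y`. -/
def gNorm {n : ℕ} (G : Euc n → Matrix (Fin n) (Fin n) ℝ) (y a : Euc n) : ℝ :=
  √(gInner G y a a)

/-- The Riemannian volume form `det_g(a, b, c)` at `y` (the coordinates being positively
oriented). -/
def gDet (G : Euc 3 → Matrix (Fin 3) (Fin 3) ℝ) (y a b c : Euc 3) : ℝ :=
  √((G y).det) * Matrix.det !![a 0, a 1, a 2; b 0, b 1, b 2; c 0, c 1, c 2]

/-- The vector product at `y`: the vector `a ×_g b` with `⟨a ×_g b, c⟩ = det_g(a, b, c)`. -/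
def gCross (G : Euc 3 → Matrix (Fin 3) (Fin 3) ℝ) (y a b : Euc 3) : Euc 3 :=
  WithLp.toLp 2 (√((G y).det) •
    ((G y)⁻¹).mulVec (crossProduct (fun i => a i) (fun i => b i)))

/-- The covariant derivative `∇_w V` at `x` (for the Levi-Civita connection of `G`) of a vector
field `V` along a map `F`. The domain of `F` is `ℝ²` for surfaces and `ℝ` for curves. -/
def covDeriv {D : Type*} [NormedAddCommGroup D] [NormedSpace ℝ D] {n : ℕ}
    (G : Euc n → Matrix (Fin n) (Fin n) ℝ) (F V : D → Euc n) (x w : D) : Euc n :=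
  fderiv ℝ V x w + WithLp.toLp 2 (fun k => ∑ i, ∑ j,
    christoffel G k i j (F x) * (fderiv ℝ F x w) i * V x j)

/-- The component `Rˡₖᵢⱼ` of the curvature tensor, `R(∂ᵢ, ∂ⱼ)∂ₖ = ∑ₗ Rˡₖᵢⱼ ∂ₗ`. -/
def riemann {n : ℕ} (G : Euc n → Matrix (Fin n) (Fin n) ℝ) (l k i j : Fin n) (x : Euc n) : ℝ :=
  pderiv i (christoffel G l j k) x - pderiv j (christoffel G l i k) x +
    ∑ m, (christoffel G l i m x * christoffel G m j k x
      - christoffel G l j m x * christoffel G m i k x)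

/-- The Gaussian curvature `⟨R(∂₀, ∂₁)∂₁, ∂₀⟩ / det` of a metric on a surface. -/
def gaussCurvature (G : Euc 2 → Matrix (Fin 2) (Fin 2) ℝ) (x : Euc 2) : ℝ :=
  (∑ l, riemann G l 1 0 1 x * G x l 0) / (G x).det

/-! ### Surfaces in coordinates

`F` is the surface, `N` its unit normal field and `G` the ambient metric, all in coordinates. The
source has coordinates `u = x 0`, `v = x 1`. -/

/-- The first fundamental form `⟨F_{uᵢ}, F_{uⱼ}⟩`. -/
def firstForm (G : Euc 3 → Matrix (Fin 3) (Fin 3) ℝ) (F : Euc 2 → Euc 3) (x : Euc 2) :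
    Matrix (Fin 2) (Fin 2) ℝ :=
  Matrix.of fun i j => gInner G (F x) (pderiv i F x) (pderiv j F x)

/-- The second fundamental form `hᵢⱼ = -⟨F_{uᵢ}, ∇_{uⱼ} N⟩`. -/
def secondForm (G : Euc 3 → Matrix (Fin 3) (Fin 3) ℝ) (F N : Euc 2 → Euc 3) (x : Euc 2) :
    Matrix (Fin 2) (Fin 2) ℝ :=
  Matrix.of fun i j => -gInner G (F x) (pderiv i F x) (covDeriv G F N x (basisVec j))

/-- The mean curvature. -/
def meanCurvature (G : Euc 3 → Matrix (Fin 3) (Fin 3) ℝ) (F N : Euc 2 → Euc 3) (x : Euc 2) : ℝ :=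
  let g := firstForm G F x
  let h := secondForm G F N x
  (g 0 0 * h 1 1 - 2 * g 0 1 * h 0 1 + g 1 1 * h 0 0) / (2 * g.det)

/-- The signed area density `λ = det_g(F_u, F_v, N)`. -/
def areaDensity (G : Euc 3 → Matrix (Fin 3) (Fin 3) ℝ) (F N : Euc 2 → Euc 3) (x : Euc 2) : ℝ :=
  gDet G (F x) (pderiv 0 F x) (pderiv 1 F x) (N x)

/-- `(a, b)` is a positive frame of the source. -/
def IsPositiveFrame (a b : Euc 2) : Prop := 0 < a 0 * b 1 - a 1 * b 0

/-- `k` is the singular curvature of `F` at the singular point `c t` of the first kind, where `c`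
is the singular curve:
`k = sgn(dλ(η)) det_g(ĉ', ĉ'', N) / |ĉ'|³` with `ĉ = F ∘ c`, `ĉ'' = ∇_{ĉ'} ĉ'` and a null vector
`η` such that `(c', η)` is positive. -/
def IsSingularCurvatureAt (G : Euc 3 → Matrix (Fin 3) (Fin 3) ℝ) (F N : Euc 2 → Euc 3)
    (c : ℝ → Euc 2) (t k : ℝ) : Prop :=
  ∃ η : Euc 2, fderiv ℝ F (c t) η = 0 ∧ IsPositiveFrame (deriv c t) η ∧
    k = Real.sign (fderiv ℝ (areaDensity G F N) (c t) η) *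
      gDet G (F (c t)) (deriv (F ∘ c) t) (covDeriv G (F ∘ c) (deriv (F ∘ c)) t 1) (N (c t)) /
        gNorm G (F (c t)) (deriv (F ∘ c) t) ^ 3

/-- The derivative `∇_η V` of a vector field `V` along `F` in the direction of the vector field
`η` of the source. -/
def covAlong (G : Euc 3 → Matrix (Fin 3) (Fin 3) ℝ) (F : Euc 2 → Euc 3) (η : Euc 2 → Euc 2)
    (V : Euc 2 → Euc 3) (x : Euc 2) : Euc 3 := covDeriv G F V x (η x)

/-- `k` is the cuspidal curvature of `F` at the singular point `c t` of the first kind, where `c`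
is the singular curve:
`k = |ĉ'|^(3/2) det_g(ĉ', F_ηη, F_ηηη) / |ĉ' ×_g F_ηη|^(5/2)`
with an extended null vector field `η` such that `(c', η)` is positive. -/
def IsCuspidalCurvatureAt (G : Euc 3 → Matrix (Fin 3) (Fin 3) ℝ) (F : Euc 2 → Euc 3)
    (c : ℝ → Euc 2) (t k : ℝ) : Prop :=
  ∃ η : Euc 2 → Euc 2, (∀ᶠ x in 𝓝 (c t), ContDiffAt ℝ ∞ η x) ∧
    (∀ᶠ s in 𝓝 t, fderiv ℝ F (c s) (η (c s)) = 0) ∧ IsPositiveFrame (deriv c t) (η (c t)) ∧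
    let fη : Euc 2 → Euc 3 := fun x => fderiv ℝ F x (η x)
    let fηη := covAlong G F η fη
    let fηηη := covAlong G F η fηη
    k = gNorm G (F (c t)) (deriv (F ∘ c) t) ^ (3 / 2 : ℝ) *
      gDet G (F (c t)) (deriv (F ∘ c) t) (fηη (c t)) (fηηη (c t)) /
        gNorm G (F (c t)) (gCross G (F (c t)) (deriv (F ∘ c) t) (fηη (c t))) ^ (5 / 2 : ℝ)

/-! ### Coordinates on manifolds -/

section Manifolds

variable {S : Type*} [TopologicalSpace S] [ChartedSpace (Euc 2) S]
  {M : Type*} [TopologicalSpace M] [ChartedSpace (Euc 3) M]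

/-- `e` is a smooth coordinate system around `p`. -/
def IsCoordAt {n : ℕ} {X : Type*} [TopologicalSpace X] [ChartedSpace (Euc n) X]
    (e : OpenPartialHomeomorph X (Euc n)) (p : X) : Prop :=
  e ∈ IsManifold.maximalAtlas (𝓡 n) ∞ X ∧ p ∈ e.source

/-- The coordinate vector `∂ᵢ` at `p` of the coordinate system `e`. -/
def coordVec {n : ℕ} {X : Type*} [TopologicalSpace X] [ChartedSpace (Euc n) X]
    (e : OpenPartialHomeomorph X (Euc n)) (p : X) (i : Fin n) : TangentSpace (𝓡 n) p :=
  mfderiv (𝓡 n) (𝓡 n) e.symm (e p) (basisVec i)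

/-- A smooth map `f` in the coordinates `e` of the source and `φ` of the target. -/
def localMap (f : S → M) (e : OpenPartialHomeomorph S (Euc 2))
    (φ : OpenPartialHomeomorph M (Euc 3)) : Euc 2 → Euc 3 := fun x => φ (f (e.symm x))

/-- A vector field along `f` in coordinates. -/
def localField (f : S → M) (ν : ∀ x, TangentSpace (𝓡 3) (f x))
    (e : OpenPartialHomeomorph S (Euc 2)) (φ : OpenPartialHomeomorph M (Euc 3)) :
    Euc 2 → Euc 3 :=
  fun x => mfderiv (𝓡 3) (𝓡 3) φ (f (e.symm x)) (ν (e.symm x))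

variable [IsManifold (𝓡 2) ∞ S] [IsManifold (𝓡 3) ∞ M]

/-- Smooth Riemannian metrics on a `3`-manifold. -/
abbrev RMetric (M : Type*) [TopologicalSpace M] [ChartedSpace (Euc 3) M]
    [IsManifold (𝓡 3) ∞ M] :=
  Bundle.ContMDiffRiemannianMetric (𝓡 3) ∞ (Euc 3) (fun x : M => TangentSpace (𝓡 3) x)

/-- The matrix of the Riemannian metric `g` in the coordinates `φ`. -/
def localMetric (g : RMetric M) (φ : OpenPartialHomeomorph M (Euc 3)) (y : Euc 3) :
    Matrix (Fin 3) (Fin 3) ℝ :=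
  Matrix.of fun i j => g.inner (φ.symm y) (mfderiv (𝓡 3) (𝓡 3) φ.symm y (basisVec i))
    (mfderiv (𝓡 3) (𝓡 3) φ.symm y (basisVec j))

/-- The length of a tangent vector. -/
def tangentNorm (g : RMetric M) (q : M) (a : TangentSpace (𝓡 3) q) : ℝ := √(g.inner q a a)

/-! ### Fronts and swallowtails -/

/-- `ν` is a smooth unit normal vector field of `f` on `U`. -/
structure IsUnitNormalOn (g : RMetric M) (f : S → M) (ν : ∀ x, TangentSpace (𝓡 3) (f x))
    (U : Set S) : Prop where
  smooth : ContMDiffOn (𝓡 2) (𝓡 3).tangent ∞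
    (fun x => (⟨f x, ν x⟩ : TangentBundle (𝓡 3) M)) U
  unit : ∀ x ∈ U, g.inner (f x) (ν x) (ν x) = 1
  normal : ∀ x ∈ U, ∀ a : TangentSpace (𝓡 2) x,
    g.inner (f x) (mfderiv (𝓡 2) (𝓡 3) f x a) (ν x) = 0

/-- `f` is a front: smooth, with a unit normal vector field near every point that is an immersion
into the tangent bundle. -/
def IsFront (g : RMetric M) (f : S → M) : Prop :=
  ContMDiff (𝓡 2) (𝓡 3) ∞ f ∧
  ∀ p : S, ∃ U : Set S, IsOpen U ∧ p ∈ U ∧ ∃ ν : ∀ x, TangentSpace (𝓡 3) (f x),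
    IsUnitNormalOn g f ν U ∧
    ∀ x ∈ U, Function.Injective (mfderiv (𝓡 2) (𝓡 3).tangent
      (fun x => (⟨f x, ν x⟩ : TangentBundle (𝓡 3) M)) x)

/-- `p` is a singular point: `f` is not an immersion at `p`. -/
def IsSingularPt (f : S → M) (p : S) : Prop :=
  ¬ Function.Injective (mfderiv (𝓡 2) (𝓡 3) f p)

/-- The standard swallowtail `(u, v) ↦ (u, 4v³ + 2uv, 3v⁴ + uv²)`. -/
def stdSwallowtail (x : Euc 2) : Euc 3 :=
  !₂[x 0, 4 * x 1 ^ 3 + 2 * x 0 * x 1, 3 * x 1 ^ 4 + x 0 * x 1 ^ 2]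

/-- `p` is a swallowtail: the germ of `f` at `p` is right-left equivalent to the standard
swallowtail at the origin, i.e. equal to it in suitable coordinate systems. -/
def IsSwallowtail (f : S → M) (p : S) : Prop :=
  ∃ (e : OpenPartialHomeomorph S (Euc 2)) (φ : OpenPartialHomeomorph M (Euc 3)),
    IsCoordAt e p ∧ IsCoordAt φ (f p) ∧ e p = 0 ∧ φ (f p) = 0 ∧
    ∀ᶠ x in 𝓝 (0 : Euc 2), localMap f e φ x = stdSwallowtail x

/-- `γ` is a singular curve through `p`: a regular smooth parametrization, near `γ 0 = p`, of the
singular set of `f`. -/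
structure IsSingularCurve (f : S → M) (p : S) (γ : ℝ → S) : Prop where
  smooth : ∀ᶠ t in 𝓝 (0 : ℝ), ContMDiffAt 𝓘(ℝ, ℝ) (𝓡 2) ∞ γ t
  base : γ 0 = p
  regular : mfderiv 𝓘(ℝ, ℝ) (𝓡 2) γ 0 ≠ 0
  singular : ∀ᶠ t in 𝓝 (0 : ℝ), IsSingularPt f (γ t)
  covers : ∀ T ∈ 𝓝 (0 : ℝ), ∀ᶠ x in 𝓝 p, IsSingularPt f x → x ∈ γ '' T

/-- Coordinates `(u, v)` centered at `p` are admissible at `p`: `f_v(p) = 0`. -/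
def IsAdmissible (f : S → M) (p : S) (e : OpenPartialHomeomorph S (Euc 2)) : Prop :=
  IsCoordAt e p ∧ e p = 0 ∧ mfderiv (𝓡 2) (𝓡 3) f p (coordVec e p 1) = 0

/-- Coordinates `(u, v)` centered at `p` are adapted at `p` (a singular point of the second kind):
`f_u(p) = 0`, the `u`-axis is the singular set, and `|f_v(p)| = 1`. -/
def IsAdapted (g : RMetric M) (f : S → M) (p : S) (e : OpenPartialHomeomorph S (Euc 2)) : Prop :=
  IsCoordAt e p ∧ e p = 0 ∧ mfderiv (𝓡 2) (𝓡 3) f p (coordVec e p 0) = 0 ∧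
  (∀ᶠ x in 𝓝 p, IsSingularPt f x ↔ e x 1 = 0) ∧
  tangentNorm g (f p) (mfderiv (𝓡 2) (𝓡 3) f p (coordVec e p 1)) = 1

/-! ### The invariants -/

/-- `k` is the limiting normal curvature `κ_ν(p) = ⟨f_uu, ν⟩ / |f_u|²` at `p`, computed in
admissible coordinates `(u, v)`. -/
def IsLimitingNormalCurvature (g : RMetric M) (f : S → M) (ν : ∀ x, TangentSpace (𝓡 3) (f x))
    (p : S) (k : ℝ) : Prop :=
  (∃ e, IsAdmissible f p e) ∧
  ∀ e φ, IsAdmissible f p e → IsCoordAt φ (f p) →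
    let G := localMetric g φ
    let F := localMap f e φ
    k = gInner G (F 0) (covDeriv G F (pderiv 0 F) 0 (basisVec 0)) (localField f ν e φ 0) /
      gNorm G (F 0) (pderiv 0 F 0) ^ 2

/-- `k` is `κ_H(p)` with respect to the adapted coordinates `e = (u, v)` and `ν`: the value at the
origin of the continuous extension of `2vH`, with `H` the mean curvature. -/
def IsKappaH (g : RMetric M) (f : S → M) (ν : ∀ x, TangentSpace (𝓡 3) (f x))
    (p : S) (e : OpenPartialHomeomorph S (Euc 2)) (k : ℝ) : Prop :=
  ∀ φ, IsCoordAt φ (f p) →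
    Tendsto (fun x : Euc 2 => 2 * (x 1 *
        meanCurvature (localMetric g φ) (localMap f e φ) (localField f ν e φ) x))
      (𝓝[{x | x 1 ≠ 0}] 0) (𝓝 k)

/-- `k` is `K̂(p)` with respect to the adapted coordinates `e = (u, v)`: the value at the origin of
the continuous extension of `vK`, with `K` the Gaussian curvature of the induced metric. -/
def IsKHat (g : RMetric M) (f : S → M) (p : S) (e : OpenPartialHomeomorph S (Euc 2))
    (k : ℝ) : Prop :=
  ∀ φ, IsCoordAt φ (f p) →
    Tendsto (fun x : Euc 2 => x 1 *
        gaussCurvature (firstForm (localMetric g φ) (localMap f e φ)) x)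
      (𝓝[{x | x 1 ≠ 0}] 0) (𝓝 k)

/-- The signed arclength, measured from `p`, of the image `f ∘ γ` of the singular curve. -/
def arclength (g : RMetric M) (f : S → M) (γ : ℝ → S) (t : ℝ) : ℝ :=
  ∫ s in (0 : ℝ)..t,
    tangentNorm g (f (γ s)) (mfderiv 𝓘(ℝ, ℝ) (𝓡 3) (f ∘ γ) s (1 : ℝ))

/-- `κ t` is the singular curvature at `γ t` for small `t ≠ 0`. -/
def IsSingularCurvatureAlong (g : RMetric M) (f : S → M) (ν : ∀ x, TangentSpace (𝓡 3) (f x))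
    (p : S) (γ : ℝ → S) (κ : ℝ → ℝ) : Prop :=
  ∃ e φ, IsCoordAt e p ∧ IsCoordAt φ (f p) ∧ ∀ᶠ t in 𝓝[≠] (0 : ℝ),
    IsSingularCurvatureAt (localMetric g φ) (localMap f e φ) (localField f ν e φ)
      (fun s => e (γ s)) t (κ t)

/-- `κ t` is the cuspidal curvature at `γ t` for small `t ≠ 0`. -/
def IsCuspidalCurvatureAlong (g : RMetric M) (f : S → M) (p : S) (γ : ℝ → S) (κ : ℝ → ℝ) : Prop :=
  ∃ e φ, IsCoordAt e p ∧ IsCoordAt φ (f p) ∧ ∀ᶠ t in 𝓝[≠] (0 : ℝ),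
    IsCuspidalCurvatureAt (localMetric g φ) (localMap f e φ) (fun s => e (γ s)) t (κ t)

/-- `τ` is the limiting singular curvature `τ_s = 2√2 lim √|s| |κ_s|` at `p`, where `s` is the
arclength of the image of the singular curve (`s → 0` as the parameter of `γ` tends to `0`). -/
def IsLimitingSingularCurvature (g : RMetric M) (f : S → M)
    (ν : ∀ x, TangentSpace (𝓡 3) (f x)) (p : S) (τ : ℝ) : Prop :=
  (∃ γ κ, IsSingularCurve f p γ ∧ IsSingularCurvatureAlong g f ν p γ κ) ∧
  ∀ γ κ, IsSingularCurve f p γ → IsSingularCurvatureAlong g f ν p γ κ →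
    Tendsto (fun t => 2 * √2 * (√|arclength g f γ t| * |κ t|)) (𝓝[≠] 0) (𝓝 τ)

/-- `τ` is the limiting cuspidal curvature `τ_c = (√(2√2) / 2) lim | |s|^(1/4) κ_c |` at `p`, where
`s` is the arclength of the image of the singular curve. -/
def IsLimitingCuspidalCurvature (g : RMetric M) (f : S → M) (p : S) (τ : ℝ) : Prop :=
  (∃ γ κ, IsSingularCurve f p γ ∧ IsCuspidalCurvatureAlong g f p γ κ) ∧
  ∀ γ κ, IsSingularCurve f p γ → IsCuspidalCurvatureAlong g f p γ κ →
    Tendsto (fun t => √(2 * √2) / 2 * |(|arclength g f γ t| ^ (1 / 4 : ℝ) * κ t)|)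
      (𝓝[≠] 0) (𝓝 τ)

/-- `w` is the number `sgn(κ_H(p)) κ_ν(p) τ_c`, for some unit normal vector field near `p` and some
adapted coordinates. -/
def IsSignedProduct (g : RMetric M) (f : S → M) (p : S) (w : ℝ) : Prop :=
  ∃ (U : Set S) (ν : ∀ x, TangentSpace (𝓡 3) (f x)) (e : OpenPartialHomeomorph S (Euc 2))
    (κH κν τc : ℝ), IsOpen U ∧ p ∈ U ∧ IsUnitNormalOn g f ν U ∧ IsAdapted g f p e ∧
    IsKappaH g f ν p e κH ∧ IsLimitingNormalCurvature g f ν p κν ∧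
    IsLimitingCuspidalCurvature g f p τc ∧ w = Real.sign κH * κν * τc

/-- The first fundamental form `⟨df(a), df(b)⟩` at `x`. -/
def firstFundamentalForm (g : RMetric M) (f : S → M) (x : S) (a b : TangentSpace (𝓡 2) x) : ℝ :=
  g.inner (f x) (mfderiv (𝓡 2) (𝓡 3) f x a) (mfderiv (𝓡 2) (𝓡 3) f x b)

end Manifolds

end

/-! The proof is a computation in one normal form. Flattening the singular parabola of the standard
swallowtail gives source coordinates (u, v) in which the surface satisfies F_u = v h - m u F_v, with
h and F_v independent, |F_v| = 1 at the origin and m a nonzero constant (`FrameAt`,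
`SwallowtailFrame`). The u-axis is then the singular set, X = ∂_u + m u ∂_v is null along it, and
df(X) = v h. At the swallowtail let d be the Gram determinant of (h, F_v), b = -⟨h, ∇_u N⟩ = ⟨∇_u h,
N⟩ and k = -⟨F_v, ∇_v N⟩. For adapted coordinates let σ = ±1 be the v-derivative of the second
component of the transition to the normal form. Then κ_ν = k, κ_H = σ b/d, K̂ = σ b k/d, τ_s =
2√(d/|m|), τ_c = √τ_s |b/d|, and the identities are algebra with |σ| = 1 and sgn(x)|x| = x.

For κ_H and K̂: in the basis (X, ∂_v) the first form has entries v²⟨h, h⟩, v⟨h, F_v⟩, ⟨F_v, F_v⟩,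
and symmetry of the second form gives ⟨F_v, ∇_X N⟩ = v⟨h, ∇_v N⟩. So det I is divisible by v², while
det II and the numerator of H have a single factor v, and both curvatures have a simple pole along
the axis (`FrameAt.meanCurvature_comp`, `FrameAt.gaussCurvature_comp`). The Gauss equation
`gaussCurvature_firstForm` also has an ambient curvature term, which keeps a slot filled by f_u and
vanishes in the limit of vK.

For τ_s and τ_c: the image of the singular curve has velocity -m u u' F_v, so |s| is asymptotic to
|m| u²/2. The absolute curvatures |κ_s| and |κ_c| have closed formulas free of the parametrization
and of the null field (`IsAxisChange.abs_singularCurvature`, `IsAxisChange.abs_cuspidalCurvature`).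
They contain |u|⁻¹ and |u|^(-1/2), which √|s| and |s|^(1/4) compensate. At the swallowtail ∇_u F_v =
h, which brings in d.

For intrinsicness: the absolute value in question is √(2√(d/|m|)) |b k/d|. Its second factor is
|K̂|, determined by the first fundamental form. So is d/|m|: in any adapted coordinates det I / v²
tends to J² d and |I₀₁(u, 0)/u| tends to |m| J², with the same Jacobian J. An isometric local
diffeomorphism carries adapted coordinates to adapted coordinates (`IsAdapted.of_isometric`), so
these limits agree for both fronts.

Independence of the target chart rests on the transformation law `covDeriv_change_coord` of the
Levi-Civita connection. -/

noncomputable section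

/-! ### The metric and its Levi-Civita connection in coordinates -/

/-- The bilinear form `Γ(a, b)` at `y` given by the Christoffel symbols. -/
def christoffelForm {n : ℕ} (G : Euc n → Matrix (Fin n) (Fin n) ℝ) (y a b : Euc n) : Euc n :=
  WithLp.toLp 2 fun k => ∑ i, ∑ j, christoffel G k i j y * a i * b j

/-- `G` is a smooth field of symmetric nondegenerate matrices near `y`. -/
structure IsMetricAt {n : ℕ} (G : Euc n → Matrix (Fin n) (Fin n) ℝ) (y : Euc n) : Prop where
  contDiffAt : ∀ i j, ContDiffAt ℝ ∞ (fun z => G z i j) y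
  symm : ∀ᶠ z in 𝓝 y, ∀ i j, G z i j = G z j i
  det_ne : (G y).det ≠ 0

section Metric

variable {n : ℕ} {G : Euc n → Matrix (Fin n) (Fin n) ℝ} {y : Euc n}
  {D : Type*} [NormedAddCommGroup D] [NormedSpace ℝ D]

theorem covDeriv_eq (F V : D → Euc n) (x w : D) :
    covDeriv G F V x w = fderiv ℝ V x w + christoffelForm G (F x) (fderiv ℝ F x w) (V x) := rfl

theorem gInner_add_left (y a b c : Euc n) : gInner G y (a + b) c = gInner G y a c + gInner G y b c := by
  simp only [gInner, PiLp.add_apply, ← Finset.sum_add_distrib]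
  congr! 2; ring

theorem gInner_add_right (y a b c : Euc n) : gInner G y a (b + c) = gInner G y a b + gInner G y a c := by
  simp only [gInner, PiLp.add_apply, ← Finset.sum_add_distrib]
  congr! 2; ring

theorem gInner_smul_left (y : Euc n) (r : ℝ) (a b : Euc n) : gInner G y (r • a) b = r * gInner G y a b := by
  simp only [gInner, PiLp.smul_apply, smul_eq_mul, Finset.mul_sum]
  congr! 2; ring

theorem gInner_smul_right (y : Euc n) (r : ℝ) (a b : Euc n) : gInner G y a (r • b) = r * gInner G y a b := by
  simp only [gInner, PiLp.smul_apply, smul_eq_mul, Finset.mul_sum]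
  congr! 2; ring

theorem gInner_zero_left (y a : Euc n) : gInner G y 0 a = 0 := by simp [gInner]

theorem gInner_zero_right (y a : Euc n) : gInner G y a 0 = 0 := by simp [gInner]

theorem gInner_neg_left (y a b : Euc n) : gInner G y (-a) b = -gInner G y a b := by
  simp [gInner]

theorem gInner_sub_left (y a b c : Euc n) : gInner G y (a - b) c = gInner G y a c - gInner G y b c := by
  rw [sub_eq_add_neg, gInner_add_left, gInner_neg_left]; rfl

theorem gInner_comm (hs : ∀ i j, G y i j = G y j i) (a b : Euc n) : gInner G y a b = gInner G y b a := by
  simp only [gInner]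
  rw [Finset.sum_comm]
  congr! 2 with i _ j
  rw [hs]; ring

theorem christoffelForm_add_left (y a b c : Euc n) :
    christoffelForm G y (a + b) c = christoffelForm G y a c + christoffelForm G y b c := by
  ext k
  simp only [christoffelForm, PiLp.add_apply, ← Finset.sum_add_distrib]
  congr! 2; ring

theorem christoffelForm_add_right (y a b c : Euc n) :
    christoffelForm G y a (b + c) = christoffelForm G y a b + christoffelForm G y a c := by
  ext k
  simp only [christoffelForm, PiLp.add_apply, ← Finset.sum_add_distrib]
  congr! 2; ring

theorem christoffelForm_smul_left (y : Euc n) (r : ℝ) (a b : Euc n) :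
    christoffelForm G y (r • a) b = r • christoffelForm G y a b := by
  ext k
  simp only [christoffelForm, PiLp.smul_apply, smul_eq_mul, Finset.mul_sum]
  congr! 2; ring

theorem christoffelForm_smul_right (y : Euc n) (r : ℝ) (a b : Euc n) :
    christoffelForm G y a (r • b) = r • christoffelForm G y a b := by
  ext k
  simp only [christoffelForm, PiLp.smul_apply, smul_eq_mul, Finset.mul_sum]
  congr! 2; ring

theorem IsMetricAt.symm_self (hG : IsMetricAt G y) (i j : Fin n) : G y i j = G y j i :=
  hG.symm.self_of_nhds i j

theorem IsMetricAt.pderiv_comm (hG : IsMetricAt G y) (k i j : Fin n) :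
    pderiv k (fun z => G z i j) y = pderiv k (fun z => G z j i) y := by
  have : (fun z => G z i j) =ᶠ[𝓝 y] fun z => G z j i := hG.symm.mono fun z h => h i j
  simp only [pderiv, this.fderiv_eq]

/-- The Christoffel symbol of the first kind. -/
def lowerChristoffel (G : Euc n → Matrix (Fin n) (Fin n) ℝ) (i j l : Fin n) (x : Euc n) : ℝ :=
  (1 / 2) * (pderiv i (fun y => G y j l) x + pderiv j (fun y => G y i l) x
    - pderiv l (fun y => G y i j) x)

/-- Lowering the index cancels the inverse matrix in the symbol. Only nondegeneracy enters, so the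
rule serves both the ambient metric and the induced metric off the singular set. -/
theorem sum_mul_christoffel (hd : (G y).det ≠ 0) (m i j : Fin n) :
    ∑ k, G y m k * christoffel G k i j y = lowerChristoffel G i j m y := by
  have h1 : (fun k => christoffel G k i j y) = (G y)⁻¹.mulVec (fun l => lowerChristoffel G i j l y) := by
    ext k
    simp only [christoffel, lowerChristoffel, Matrix.mulVec, dotProduct, Finset.mul_sum]
    congr! 1; ring
  have h2 : (G y).mulVec (fun k => christoffel G k i j y) = fun l => lowerChristoffel G i j l y := by
    rw [h1, Matrix.mulVec_mulVec, Matrix.mul_nonsing_inv _ (isUnit_iff_ne_zero.2 hd),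
      Matrix.one_mulVec]
  exact congrFun h2 m

theorem IsMetricAt.christoffel_comm (hG : IsMetricAt G y) (k i j : Fin n) :
    christoffel G k i j y = christoffel G k j i y := by
  simp only [christoffel]
  congr! 3 with l
  rw [hG.pderiv_comm l i j]; ring

theorem IsMetricAt.christoffelForm_comm (hG : IsMetricAt G y) (a b : Euc n) :
    christoffelForm G y a b = christoffelForm G y b a := by
  ext k
  simp only [christoffelForm]
  rw [Finset.sum_comm]
  congr! 2 with i _ j
  rw [hG.christoffel_comm]; ring

theorem IsMetricAt.gInner_christoffelForm (hG : IsMetricAt G y) (a b c : Euc n) :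
    gInner G y (christoffelForm G y a b) c =
      ∑ i, ∑ j, ∑ l, lowerChristoffel G i j l y * a i * b j * c l := by
  rw [gInner_comm hG.symm_self]
  simp only [gInner, christoffelForm]
  have : ∀ m k, G y m k * c m * (∑ i, ∑ j, christoffel G k i j y * a i * b j) =
      ∑ i, ∑ j, (G y m k * christoffel G k i j y) * (a i * b j * c m) := by
    intro m k
    simp only [Finset.mul_sum]
    congr! 2; ring
  simp only [this]
  simp only [← sum_mul_christoffel hG.det_ne, Finset.sum_mul]
  calc _ = ∑ m, ∑ i, ∑ j, ∑ k, G y m k * christoffel G k i j y * (a i * b j * c m) := by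
        congr! 1 with m
        rw [Finset.sum_comm]
        congr! 1 with i
        rw [Finset.sum_comm]
    _ = _ := by
        rw [Finset.sum_comm]
        congr! 1 with i
        rw [Finset.sum_comm]
        congr! 3; ring

theorem fderiv_eq_sum_pderiv (h : Euc n → ℝ) (x w : Euc n) :
    fderiv ℝ h x w = ∑ k, w k * pderiv k h x := by
  have hw : w = ∑ k, w k • (basisVec k : Euc n) := by
    have := (EuclideanSpace.basisFun (Fin n) ℝ).sum_repr w
    simpa [basisVec] using this.symm
  conv_lhs => rw [hw]
  simp [map_sum, pderiv]

/-- Compatibility of the connection with the metric: ∂ₖgᵢⱼ is the sum of the first-kind symbols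
Γₖᵢ,ⱼ and Γₖⱼ,ᵢ, the other derivatives cancelling in pairs. -/
theorem IsMetricAt.sum_fderiv (hG : IsMetricAt G y) (a b c : Euc n) :
    ∑ i, ∑ j, fderiv ℝ (fun z => G z i j) y a * b i * c j =
      gInner G y (christoffelForm G y a b) c + gInner G y b (christoffelForm G y a c) := by
  rw [gInner_comm hG.symm_self b, hG.gInner_christoffelForm, hG.gInner_christoffelForm]
  have h1 : ∑ i, ∑ j, ∑ l, lowerChristoffel G i j l y * a i * c j * b l =
      ∑ i, ∑ j, ∑ l, lowerChristoffel G i l j y * a i * c l * b j := by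
    congr! 1 with i
    rw [Finset.sum_comm]
  rw [h1]
  simp only [← Finset.sum_add_distrib, fderiv_eq_sum_pderiv, Finset.sum_mul]
  calc _ = ∑ i, ∑ j, ∑ k, a k * pderiv k (fun z => G z i j) y * b i * c j := rfl
    _ = ∑ k, ∑ i, ∑ j, a k * pderiv k (fun z => G z i j) y * b i * c j := by
        conv_lhs => enter [2, i]; rw [Finset.sum_comm]
        rw [Finset.sum_comm]
    _ = _ := by
        congr! 3 with k _ i _ j
        simp only [lowerChristoffel]
        rw [hG.pderiv_comm k j i]
        ring

theorem hasFDerivAt_coord {V : D → Euc n} {x : D} (hV : DifferentiableAt ℝ V x) (i : Fin n) :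
    HasFDerivAt (fun z => V z i) ((EuclideanSpace.proj i).comp (fderiv ℝ V x) : D →L[ℝ] ℝ) x :=
  (EuclideanSpace.proj (𝕜 := ℝ) i).hasFDerivAt.comp x hV.hasFDerivAt

theorem IsMetricAt.differentiableAt (hG : IsMetricAt G y) (i j : Fin n) :
    DifferentiableAt ℝ (fun z => G z i j) y := (hG.contDiffAt i j).differentiableAt (by simp)

/-- Ordinary product rule: the derivatives of the coefficients of `G` along `F` are exactly the
Christoffel terms of the two covariant derivatives. -/
theorem IsMetricAt.hasFDerivAt_gInner {F V W : D → Euc n} {x : D} (hG : IsMetricAt G (F x))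
    (hF : DifferentiableAt ℝ F x) (hV : DifferentiableAt ℝ V x) (hW : DifferentiableAt ℝ W x) :
    ∃ L : D →L[ℝ] ℝ, HasFDerivAt (fun z => gInner G (F z) (V z) (W z)) L x ∧
      ∀ w, L w = gInner G (F x) (covDeriv G F V x w) (W x) +
        gInner G (F x) (V x) (covDeriv G F W x w) := by
  have hGF : ∀ i j, HasFDerivAt (fun z => G (F z) i j)
      ((fderiv ℝ (fun z => G z i j) (F x)).comp (fderiv ℝ F x)) x := fun i j =>
    (hG.differentiableAt i j).hasFDerivAt.comp x hF.hasFDerivAt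
  have key := HasFDerivAt.fun_sum (u := Finset.univ) fun i (_ : i ∈ Finset.univ) =>
    HasFDerivAt.fun_sum (u := Finset.univ) fun j (_ : j ∈ Finset.univ) =>
      ((hGF i j).mul (hasFDerivAt_coord hV i)).mul (hasFDerivAt_coord hW j)
  refine ⟨_, key, fun w => ?_⟩
  have h1 := hG.sum_fderiv (fderiv ℝ F x w) (V x) (W x)
  simp only [covDeriv_eq, gInner_add_left, gInner_add_right]
  have h2 : ∀ a b c d : ℝ, a + b + (c + d) = (b + d) + (a + c) := by intros; ring
  rw [h2, ← h1]
  simp only [gInner, ← Finset.sum_add_distrib, sum_apply]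
  congr! 2 with i _ j
  simp
  ring

theorem IsMetricAt.fderiv_gInner {F V W : D → Euc n} {x : D} (hG : IsMetricAt G (F x))
    (hF : DifferentiableAt ℝ F x) (hV : DifferentiableAt ℝ V x) (hW : DifferentiableAt ℝ W x)
    (w : D) :
    fderiv ℝ (fun z => gInner G (F z) (V z) (W z)) x w =
      gInner G (F x) (covDeriv G F V x w) (W x) + gInner G (F x) (V x) (covDeriv G F W x w) := by
  obtain ⟨L, hL, h⟩ := hG.hasFDerivAt_gInner hF hV hW
  rw [hL.fderiv, h]

theorem IsMetricAt.nondegenerate (hd : (G y).det ≠ 0) {a : Euc n} (h : ∀ b, gInner G y a b = 0) :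
    a = 0 := by
  have h1 : (G y).vecMul (fun i => a i) = 0 := by
    ext j
    have := h (basisVec j)
    simp only [gInner, basisVec] at this
    simp only [Matrix.vecMul, dotProduct, Pi.zero_apply]
    rw [← this]
    congr! 1 with i
    simp [mul_comm]
  have := Matrix.eq_zero_of_vecMul_eq_zero hd h1
  ext i
  exact congrFun this i

end Metric

section Connection

variable {n : ℕ} {G : Euc n → Matrix (Fin n) (Fin n) ℝ} {y : Euc n}
  {D : Type*} [NormedAddCommGroup D] [NormedSpace ℝ D]

/-! ### Smoothness -/

theorem ContDiffAt.matrix_det {k : ℕ} {A : D → Matrix (Fin k) (Fin k) ℝ} {x : D}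
    (hA : ∀ i j, ContDiffAt ℝ ∞ (fun z => A z i j) x) : ContDiffAt ℝ ∞ (fun z => (A z).det) x := by
  simp only [Matrix.det_apply']
  exact ContDiffAt.sum fun σ _ => contDiffAt_const.mul (contDiffAt_prod fun i _ => hA _ _)

theorem ContDiffAt.matrix_inv {k : ℕ} {A : D → Matrix (Fin k) (Fin k) ℝ} {x : D}
    (hA : ∀ i j, ContDiffAt ℝ ∞ (fun z => A z i j) x) (hd : (A x).det ≠ 0) (i j : Fin k) :
    ContDiffAt ℝ ∞ (fun z => (A z)⁻¹ i j) x := by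
  simp only [Matrix.inv_def, Matrix.smul_apply, smul_eq_mul, Ring.inverse_eq_inv',
    Matrix.adjugate_apply]
  refine ((ContDiffAt.matrix_det hA).inv hd).mul (ContDiffAt.matrix_det fun a b => ?_)
  by_cases h : a = j
  · subst h; simpa using contDiffAt_const
  · simpa [Matrix.updateRow_ne h] using hA a b

theorem ContDiffAt.coord {V : D → Euc n} {x : D} (hV : ContDiffAt ℝ ∞ V x) (i : Fin n) :
    ContDiffAt ℝ ∞ (fun z => V z i) x :=
  (EuclideanSpace.proj (𝕜 := ℝ) i).contDiff.contDiffAt.comp x hV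

theorem ContDiffAt.fderiv_apply_const {W : Type*} [NormedAddCommGroup W] [NormedSpace ℝ W]
    {V : D → W} {x : D} (hV : ContDiffAt ℝ ∞ V x) (w : D) :
    ContDiffAt ℝ ∞ (fun z => fderiv ℝ V z w) x :=
  (hV.fderiv_right (m := ∞) (by simp)).clm_apply contDiffAt_const

theorem ContDiffAt.fderiv_apply_field {W : Type*} [NormedAddCommGroup W] [NormedSpace ℝ W]
    {V : D → W} {x : D} {w : D → D} (hV : ContDiffAt ℝ ∞ V x) (hw : ContDiffAt ℝ ∞ w x) :
    ContDiffAt ℝ ∞ (fun z => fderiv ℝ V z (w z)) x :=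
  (hV.fderiv_right (m := ∞) (by simp)).clm_apply hw

theorem ContDiffAt.gInner {F V W : D → Euc n} {x : D}
    (hG : ∀ i j, ContDiffAt ℝ ∞ (fun z => G z i j) (F x))
    (hF : ContDiffAt ℝ ∞ F x) (hV : ContDiffAt ℝ ∞ V x) (hW : ContDiffAt ℝ ∞ W x) :
    ContDiffAt ℝ ∞ (fun z => gInner G (F z) (V z) (W z)) x := by
  simp only [_root_.gInner]
  exact ContDiffAt.sum fun i _ => ContDiffAt.sum fun j _ =>
    (((hG i j).comp x hF).mul (hV.coord i)).mul (hW.coord j)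

theorem IsMetricAt.contDiffAt_christoffel (hG : IsMetricAt G y) (k i j : Fin n) :
    ContDiffAt ℝ ∞ (christoffel G k i j) y := by
  unfold christoffel
  refine contDiffAt_const.mul (ContDiffAt.sum fun l _ =>
    (ContDiffAt.matrix_inv hG.contDiffAt hG.det_ne k l).mul ?_)
  exact (((hG.contDiffAt j l).fderiv_apply_const _).add
    ((hG.contDiffAt i l).fderiv_apply_const _)).sub ((hG.contDiffAt i j).fderiv_apply_const _)

theorem IsMetricAt.contDiffAt_christoffelForm {F V W : D → Euc n} {x : D} (hG : IsMetricAt G (F x))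
    (hF : ContDiffAt ℝ ∞ F x) (hV : ContDiffAt ℝ ∞ V x) (hW : ContDiffAt ℝ ∞ W x) :
    ContDiffAt ℝ ∞ (fun z => christoffelForm G (F z) (V z) (W z)) x := by
  refine contDiffAt_piLp' 2 fun k => ?_
  simp only [christoffelForm]
  exact ContDiffAt.sum fun i _ => ContDiffAt.sum fun j _ =>
    (((hG.contDiffAt_christoffel k i j).comp x hF).mul (hV.coord i)).mul (hW.coord j)

theorem IsMetricAt.contDiffAt_covDeriv {F V : D → Euc n} {w : D → D} {x : D}
    (hG : IsMetricAt G (F x)) (hF : ContDiffAt ℝ ∞ F x) (hV : ContDiffAt ℝ ∞ V x)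
    (hw : ContDiffAt ℝ ∞ w x) :
    ContDiffAt ℝ ∞ (fun z => covDeriv G F V z (w z)) x :=
  (hV.fderiv_apply_field hw).add
    (hG.contDiffAt_christoffelForm hF (hF.fderiv_apply_field hw) hV)

/-! ### Algebraic rules -/

theorem covDeriv_add_dir (F V : D → Euc n) (x a b : D) :
    covDeriv G F V x (a + b) = covDeriv G F V x a + covDeriv G F V x b := by
  simp only [covDeriv_eq, map_add, christoffelForm_add_left]; abel

theorem covDeriv_smul_dir (F V : D → Euc n) (x : D) (r : ℝ) (a : D) :
    covDeriv G F V x (r • a) = r • covDeriv G F V x a := by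
  simp only [covDeriv_eq, map_smul, christoffelForm_smul_left, smul_add]

theorem covDeriv_add {F V W : D → Euc n} {x : D} (hV : DifferentiableAt ℝ V x)
    (hW : DifferentiableAt ℝ W x) (w : D) :
    covDeriv G F (fun z => V z + W z) x w = covDeriv G F V x w + covDeriv G F W x w := by
  simp only [covDeriv_eq, fderiv_fun_add hV hW, add_apply,
    christoffelForm_add_right]
  abel

theorem covDeriv_smul {F V : D → Euc n} {r : D → ℝ} {x : D} (hr : DifferentiableAt ℝ r x)
    (hV : DifferentiableAt ℝ V x) (w : D) :
    covDeriv G F (fun z => r z • V z) x w = fderiv ℝ r x w • V x + r x • covDeriv G F V x w := by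
  simp only [covDeriv_eq, fderiv_fun_smul hr hV, add_apply,
    christoffelForm_smul_right, smul_apply,
    ContinuousLinearMap.smulRight_apply, smul_add]
  abel

theorem covDeriv_congr {F F' V V' : D → Euc n} {x : D} (hF : F =ᶠ[𝓝 x] F') (hV : V =ᶠ[𝓝 x] V')
    (w : D) : covDeriv G F V x w = covDeriv G F' V' x w := by
  simp only [covDeriv_eq, hF.fderiv_eq, hV.fderiv_eq, hF.self_of_nhds, hV.self_of_nhds]

theorem covDeriv_comp {D' : Type*} [NormedAddCommGroup D'] [NormedSpace ℝ D'] {F V : D → Euc n}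
    {θ : D' → D} {x : D'} (hF : DifferentiableAt ℝ F (θ x)) (hV : DifferentiableAt ℝ V (θ x))
    (hθ : DifferentiableAt ℝ θ x) (w : D') :
    covDeriv G (F ∘ θ) (V ∘ θ) x w = covDeriv G F V (θ x) (fderiv ℝ θ x w) := by
  simp only [covDeriv_eq, fderiv_comp x hF hθ, fderiv_comp x hV hθ,
    ContinuousLinearMap.comp_apply, Function.comp_apply]

theorem fderiv_fderiv_apply_comm {W : Type*} [NormedAddCommGroup W] [NormedSpace ℝ W]
    {F : D → W} {x : D} (hF : ContDiffAt ℝ ∞ F x) (a b : D) :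
    fderiv ℝ (fun z => fderiv ℝ F z a) x b = fderiv ℝ (fun z => fderiv ℝ F z b) x a := by
  have hd : DifferentiableAt ℝ (fderiv ℝ F) x :=
    (hF.fderiv_right (m := ∞) (by simp)).differentiableAt (by simp)
  rw [fderiv_clm_apply hd (differentiableAt_const _), fderiv_clm_apply hd (differentiableAt_const _)]
  have := (hF.isSymmSndFDerivAt (by simpa using (mod_cast le_top : ((2 : ℕ∞) : WithTop ℕ∞) ≤ ∞))) a b
  simpa using this.symm

/-- Torsion-freeness: second derivatives commute and the Christoffel form is symmetric. -/
theorem IsMetricAt.covDeriv_fderiv_comm {F : D → Euc n} {x : D} (hG : IsMetricAt G (F x))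
    (hF : ContDiffAt ℝ ∞ F x) (a b : D) :
    covDeriv G F (fun z => fderiv ℝ F z a) x b = covDeriv G F (fun z => fderiv ℝ F z b) x a := by
  simp only [covDeriv_eq, fderiv_fderiv_apply_comm hF a b, hG.christoffelForm_comm (fderiv ℝ F x b)]

/-! ### Change of coordinates in the ambient space -/

/-- The permutation argument behind uniqueness of the Levi-Civita connection: alternating three
swaps of the first pair with three of the last pair returns to the start with the opposite sign. -/
theorem eq_zero_of_symm_of_antisymm {A : Type*} (q : A → A → A → ℝ)
    (hs : ∀ a b c, q a b c = q b a c) (ha : ∀ a b c, q a b c + q a c b = 0) (a b c : A) :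
    q a b c = 0 := by
  have h1 := ha a b c; have h2 := ha b c a; have h3 := ha c a b
  rw [hs b c a] at h2; rw [hs c a b] at h3; rw [hs b a c] at h2
  linarith

/-- The transformation law of the Levi-Civita connection. -/
theorem covDeriv_change_coord {G' : Euc n → Matrix (Fin n) (Fin n) ℝ} {χ : Euc n → Euc n}
    {F V : D → Euc n} {x : D} (hG : IsMetricAt G (F x)) (hG' : IsMetricAt G' (χ (F x)))
    (hχ : ContDiffAt ℝ ∞ χ (F x)) (hsurj : Function.Surjective (fderiv ℝ χ (F x)))
    (hiso : ∀ᶠ z in 𝓝 (F x), ∀ a b,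
      gInner G z a b = gInner G' (χ z) (fderiv ℝ χ z a) (fderiv ℝ χ z b))
    (hF : DifferentiableAt ℝ F x) (hV : DifferentiableAt ℝ V x) (w : D) :
    covDeriv G' (χ ∘ F) (fun z => fderiv ℝ χ (F z) (V z)) x w =
      fderiv ℝ χ (F x) (covDeriv G F V x w) := by
  set y := F x with hy
  have hχd : DifferentiableAt ℝ χ y := hχ.differentiableAt (by simp)
  have hDχ : DifferentiableAt ℝ (fderiv ℝ χ) y :=
    (hχ.fderiv_right (m := ∞) (by simp)).differentiableAt (by simp)
  have hDχc : ∀ b, DifferentiableAt ℝ (fun z => fderiv ℝ χ z b) y := fun b =>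
    hDχ.clm_apply (differentiableAt_const _)
  -- S(a, b) is the derivative of dχ(b) in the direction a for the target connection, T is dχ
  -- applied to the source Christoffel form. The transformation law amounts to S = T; both are
  -- symmetric and, by `hcompat`, they satisfy the same compatibility identity.
  let S : Euc n → Euc n → Euc n := fun a b => covDeriv G' χ (fun z => fderiv ℝ χ z b) y a
  let T : Euc n → Euc n → Euc n := fun a b => fderiv ℝ χ y (christoffelForm G y a b)
  have hS : ∀ a b, S a b = S b a := fun a b => hG'.covDeriv_fderiv_comm hχ b a
  have hT : ∀ a b, T a b = T b a := fun a b => by simp only [T, hG.christoffelForm_comm a b]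
  have hcompat : ∀ a b c, gInner G' (χ y) (S a b) (fderiv ℝ χ y c) +
      gInner G' (χ y) (fderiv ℝ χ y b) (S a c) = gInner G' (χ y) (T a b) (fderiv ℝ χ y c) +
      gInner G' (χ y) (fderiv ℝ χ y b) (T a c) := by
    intro a b c
    have h1 := hG'.fderiv_gInner hχd (hDχc b) (hDχc c) a
    have h2 := IsMetricAt.fderiv_gInner (F := fun z : Euc n => z) (V := fun _ => b) (W := fun _ => c)
      (x := y) hG differentiableAt_id (differentiableAt_const _) (differentiableAt_const _) a
    have h3 : (fun z => gInner G' (χ z) (fderiv ℝ χ z b) (fderiv ℝ χ z c)) =ᶠ[𝓝 y]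
        fun z => gInner G z b c := hiso.mono fun z hz => (hz b c).symm
    rw [h3.fderiv_eq, h2] at h1
    have h4 : ∀ b : Euc n, covDeriv G (fun z : Euc n => z) (fun _ => b) y a
        = christoffelForm G y a b := by
      intro b
      simp [covDeriv_eq]
    rw [h4, h4, hiso.self_of_nhds, hiso.self_of_nhds] at h1
    exact h1.symm
  -- ⟨(S - T)(a, b), dχ(c)⟩ is symmetric in a, b and skew in b, c, hence zero; surjectivity of dχ
  -- lets dχ(c) run through all vectors.
  have hST : ∀ a b, S a b = T a b := by
    intro a b
    have hz : ∀ c, gInner G' (χ y) (S a b - T a b) (fderiv ℝ χ y c) = 0 := by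
      refine fun c => eq_zero_of_symm_of_antisymm
        (fun a b c => gInner G' (χ y) (S a b - T a b) (fderiv ℝ χ y c)) ?_ ?_ a b c
      · intro a b c; simp only [hS a b, hT a b]
      · intro a b c
        have := hcompat a b c
        simp only [gInner_sub_left]
        rw [gInner_comm hG'.symm_self (S a c), gInner_comm hG'.symm_self (T a c)]
        linarith
    refine sub_eq_zero.1 (IsMetricAt.nondegenerate hG'.det_ne fun b => ?_)
    obtain ⟨c, rfl⟩ := hsurj b
    exact hz c
  have h5 : fderiv ℝ (fun z => fderiv ℝ χ (F z) (V z)) x w =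
      fderiv ℝ (fderiv ℝ χ) y (fderiv ℝ F x w) (V x) + fderiv ℝ χ y (fderiv ℝ V x w) := by
    have h6 : HasFDerivAt (fun z => fderiv ℝ χ (F z)) ((fderiv ℝ (fderiv ℝ χ) y).comp (fderiv ℝ F x)) x :=
      hDχ.hasFDerivAt.comp x hF.hasFDerivAt
    rw [(h6.clm_apply hV.hasFDerivAt).fderiv]
    simp [hy, add_comm]
  have h7 := hST (fderiv ℝ F x w) (V x)
  simp only [S, T, covDeriv_eq] at h7
  rw [fderiv_clm_apply hDχ (differentiableAt_const _)] at h7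
  rw [covDeriv_eq, covDeriv_eq, h5, map_add, ← h7, fderiv_comp x hχd hF]
  simp
  abel

/-! ### Curvature -/

/-- The derivative of the Christoffel symbols at `y` in the direction `w`, as a bilinear form. -/
def christoffelFormDeriv (G : Euc n → Matrix (Fin n) (Fin n) ℝ) (y w a b : Euc n) : Euc n :=
  WithLp.toLp 2 fun k => ∑ i, ∑ j, fderiv ℝ (christoffel G k i j) y w * a i * b j

theorem christoffelFormDeriv_add_dir (y w w' a b : Euc n) : christoffelFormDeriv G y (w + w') a b =
    christoffelFormDeriv G y w a b + christoffelFormDeriv G y w' a b := by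
  ext k
  simp only [christoffelFormDeriv, PiLp.add_apply, map_add, ← Finset.sum_add_distrib]
  congr! 2; ring

theorem christoffelFormDeriv_smul_dir (y w a b : Euc n) (r : ℝ) :
    christoffelFormDeriv G y (r • w) a b = r • christoffelFormDeriv G y w a b := by
  ext k
  simp only [christoffelFormDeriv, PiLp.smul_apply, map_smul, smul_eq_mul, Finset.mul_sum]
  congr! 2; ring

theorem christoffelFormDeriv_add_left (y w a a' b : Euc n) : christoffelFormDeriv G y w (a + a') b =
    christoffelFormDeriv G y w a b + christoffelFormDeriv G y w a' b := by
  ext k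
  simp only [christoffelFormDeriv, PiLp.add_apply, ← Finset.sum_add_distrib]
  congr! 2; ring

theorem christoffelFormDeriv_smul_left (y w a b : Euc n) (r : ℝ) :
    christoffelFormDeriv G y w (r • a) b = r • christoffelFormDeriv G y w a b := by
  ext k
  simp only [christoffelFormDeriv, PiLp.smul_apply, smul_eq_mul, Finset.mul_sum]
  congr! 2; ring

/-- The curvature `R(a, b)c` at `y`. -/
def curvatureForm (G : Euc n → Matrix (Fin n) (Fin n) ℝ) (y a b c : Euc n) : Euc n :=
  christoffelFormDeriv G y a b c - christoffelFormDeriv G y b a c +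
    christoffelForm G y a (christoffelForm G y b c) -
    christoffelForm G y b (christoffelForm G y a c)

theorem curvatureForm_self (y a c : Euc n) : curvatureForm G y a a c = 0 := by
  simp [curvatureForm]

theorem curvatureForm_add_left (y a a' b c : Euc n) :
    curvatureForm G y (a + a') b c = curvatureForm G y a b c + curvatureForm G y a' b c := by
  simp only [curvatureForm, christoffelFormDeriv_add_dir, christoffelFormDeriv_add_left,
    christoffelForm_add_left, christoffelForm_add_right]
  abel

theorem curvatureForm_smul_left (y a b c : Euc n) (r : ℝ) :
    curvatureForm G y (r • a) b c = r • curvatureForm G y a b c := by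
  simp only [curvatureForm, christoffelFormDeriv_smul_dir, christoffelFormDeriv_smul_left,
    christoffelForm_smul_left, christoffelForm_smul_right, smul_add, smul_sub]

theorem curvatureForm_swap (y a b c : Euc n) :
    curvatureForm G y b a c = - curvatureForm G y a b c := by
  simp only [curvatureForm]; abel

theorem IsMetricAt.fderiv_christoffelForm {F V W : D → Euc n} {x : D} (hG : IsMetricAt G (F x))
    (hF : ContDiffAt ℝ ∞ F x) (hV : ContDiffAt ℝ ∞ V x) (hW : ContDiffAt ℝ ∞ W x) (w : D) :
    fderiv ℝ (fun z => christoffelForm G (F z) (V z) (W z)) x w =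
      christoffelFormDeriv G (F x) (fderiv ℝ F x w) (V x) (W x) +
      christoffelForm G (F x) (fderiv ℝ V x w) (W x) +
      christoffelForm G (F x) (V x) (fderiv ℝ W x w) := by
  have hd := (hG.contDiffAt_christoffelForm hF hV hW).differentiableAt (by simp)
  ext k
  have h1 := (hasFDerivAt_coord hd k).fderiv
  have h2 : ∀ i j, HasFDerivAt (fun z => christoffel G k i j (F z))
      ((fderiv ℝ (christoffel G k i j) (F x)).comp (fderiv ℝ F x)) x := fun i j =>
    ((hG.contDiffAt_christoffel k i j).differentiableAt (by simp)).hasFDerivAt.comp x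
      (hF.differentiableAt (by simp)).hasFDerivAt
  have key := HasFDerivAt.fun_sum (u := Finset.univ) fun i (_ : i ∈ Finset.univ) =>
    HasFDerivAt.fun_sum (u := Finset.univ) fun j (_ : j ∈ Finset.univ) =>
      ((h2 i j).mul (hasFDerivAt_coord (hV.differentiableAt (by simp)) i)).mul
        (hasFDerivAt_coord (hW.differentiableAt (by simp)) j)
  have h3 : (fun z => (christoffelForm G (F z) (V z) (W z)) k) = fun z =>
      ∑ i, ∑ j, christoffel G k i j (F z) * V z i * W z j := rfl
  have h4 : fderiv ℝ (fun z => christoffelForm G (F z) (V z) (W z)) x w k =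
      fderiv ℝ (fun z => (christoffelForm G (F z) (V z) (W z)) k) x w := by rw [h1]; simp
  have h5 : HasFDerivAt (fun z => ∑ i, ∑ j, christoffel G k i j (F z) * V z i * W z j) _ x := key
  rw [h4, h3, h5.fderiv]
  simp only [christoffelForm, christoffelFormDeriv, PiLp.add_apply, ← Finset.sum_add_distrib,
    sum_apply]
  congr! 2 with i _ j
  simp
  ring

/-- The directions are constant, so no bracket term occurs. The second derivatives of `V` and `F`
cancel by symmetry and the curvature expression is what remains, whether or not `F` is an immersion.
-/
theorem IsMetricAt.covDeriv_covDeriv_sub {F V : D → Euc n} {x : D} (hG : IsMetricAt G (F x))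
    (hF : ContDiffAt ℝ ∞ F x) (hV : ContDiffAt ℝ ∞ V x) (a b : D) :
    covDeriv G F (fun z => covDeriv G F V z b) x a - covDeriv G F (fun z => covDeriv G F V z a) x b =
      curvatureForm G (F x) (fderiv ℝ F x a) (fderiv ℝ F x b) (V x) := by
  have key : ∀ a b : D, covDeriv G F (fun z => covDeriv G F V z b) x a =
      fderiv ℝ (fun z => fderiv ℝ V z b) x a +
      (christoffelFormDeriv G (F x) (fderiv ℝ F x a) (fderiv ℝ F x b) (V x) +
      christoffelForm G (F x) (fderiv ℝ (fun z => fderiv ℝ F z b) x a) (V x) +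
      christoffelForm G (F x) (fderiv ℝ F x b) (fderiv ℝ V x a)) +
      (christoffelForm G (F x) (fderiv ℝ F x a) (fderiv ℝ V x b) +
      christoffelForm G (F x) (fderiv ℝ F x a) (christoffelForm G (F x) (fderiv ℝ F x b) (V x))) := by
    intro a b
    have hc := hG.contDiffAt_christoffelForm hF (hF.fderiv_apply_const b) hV
    rw [covDeriv_eq]
    simp only [covDeriv_eq]
    rw [fderiv_fun_add ((hV.fderiv_apply_const b).differentiableAt (by simp))
      (hc.differentiableAt (by simp)), add_apply,
      hG.fderiv_christoffelForm hF (hF.fderiv_apply_const b) hV, christoffelForm_add_right]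
  rw [key, key, fderiv_fderiv_apply_comm hV a b, fderiv_fderiv_apply_comm hF a b]
  simp only [curvatureForm]
  abel

theorem IsMetricAt.contDiffAt_curvatureForm {F A B C : D → Euc n} {x : D}
    (hG : IsMetricAt G (F x)) (hF : ContDiffAt ℝ ∞ F x) (hA : ContDiffAt ℝ ∞ A x)
    (hB : ContDiffAt ℝ ∞ B x) (hC : ContDiffAt ℝ ∞ C x) :
    ContDiffAt ℝ ∞ (fun z => curvatureForm G (F z) (A z) (B z) (C z)) x := by
  have h : ∀ {A B C : D → Euc n}, ContDiffAt ℝ ∞ A x → ContDiffAt ℝ ∞ B x → ContDiffAt ℝ ∞ C x →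
      ContDiffAt ℝ ∞ (fun z => christoffelFormDeriv G (F z) (A z) (B z) (C z)) x := by
    intro A B C hA hB hC
    refine contDiffAt_piLp' 2 fun k => ?_
    simp only [christoffelFormDeriv]
    refine ContDiffAt.sum fun i _ => ContDiffAt.sum fun j _ => ContDiffAt.mul (ContDiffAt.mul ?_
      (hB.coord i)) (hC.coord j)
    exact (ContDiffAt.comp x ((hG.contDiffAt_christoffel k i j).fderiv_right (m := ∞) (by simp))
      hF).clm_apply hA
  exact (((h hA hB hC).sub (h hB hA hC)).add
    (hG.contDiffAt_christoffelForm hF hA (hG.contDiffAt_christoffelForm hF hB hC))).sub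
    (hG.contDiffAt_christoffelForm hF hB (hG.contDiffAt_christoffelForm hF hA hC))

end Connection

/-! ### Volume form and vector product -/

section Volume

variable {G : Euc 3 → Matrix (Fin 3) (Fin 3) ℝ} {y : Euc 3}

theorem gInner_self_pos {n : ℕ} {G : Euc n → Matrix (Fin n) (Fin n) ℝ} {y : Euc n}
    (hG : (G y).PosDef) {a : Euc n} (ha : a ≠ 0) : 0 < gInner G y a a := by
  have h : (fun i => a i) ≠ 0 := fun h => ha (by ext i; exact congrFun h i)
  have := hG.dotProduct_mulVec_pos h
  refine this.trans_eq ?_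
  simp only [gInner, dotProduct, Matrix.mulVec, Finset.mul_sum]
  congr! 2
  simp; ring

theorem gInner_self_nonneg {n : ℕ} {G : Euc n → Matrix (Fin n) (Fin n) ℝ} {y : Euc n}
    (hG : (G y).PosDef) (a : Euc n) : 0 ≤ gInner G y a a := by
  by_cases ha : a = 0
  · simp [ha, gInner_zero_left]
  · exact (gInner_self_pos hG ha).le

theorem posDef_symm {n : ℕ} {A : Matrix (Fin n) (Fin n) ℝ} (hA : A.PosDef) (i j : Fin n) :
    A i j = A j i := by
  simpa using hA.isHermitian.apply j i

theorem gNorm_sq {n : ℕ} {G : Euc n → Matrix (Fin n) (Fin n) ℝ} {y : Euc n}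
    (hG : (G y).PosDef) (a : Euc n) : gNorm G y a ^ 2 = gInner G y a a :=
  Real.sq_sqrt (gInner_self_nonneg hG a)

theorem gNorm_smul {n : ℕ} {G : Euc n → Matrix (Fin n) (Fin n) ℝ} {y : Euc n} (r : ℝ) (a : Euc n) :
    gNorm G y (r • a) = |r| * gNorm G y a := by
  rw [gNorm, gNorm, gInner_smul_left, gInner_smul_right, ← mul_assoc, ← sq,
    Real.sqrt_mul (sq_nonneg r), Real.sqrt_sq_eq_abs]

theorem gNorm_nonneg {n : ℕ} {G : Euc n → Matrix (Fin n) (Fin n) ℝ} {y : Euc n} (a : Euc n) :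
    0 ≤ gNorm G y a := Real.sqrt_nonneg _

theorem gNorm_pos {n : ℕ} {G : Euc n → Matrix (Fin n) (Fin n) ℝ} {y : Euc n}
    (hG : (G y).PosDef) {a : Euc n} (ha : a ≠ 0) : 0 < gNorm G y a :=
  Real.sqrt_pos.2 (gInner_self_pos hG ha)

/-- The Gram determinant of two vectors. -/
def gram {n : ℕ} (G : Euc n → Matrix (Fin n) (Fin n) ℝ) (y a b : Euc n) : ℝ :=
  gInner G y a a * gInner G y b b - gInner G y a b ^ 2

/-- The Gram matrix factors as A G Bᵀ, and the two factors √det G multiply to det G. Since only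
absolute values of triple products are needed later, this identity replaces orientation arguments.
-/
theorem gDet_mul_gDet (hG : 0 ≤ (G y).det) (a b c a' b' c' : Euc 3) :
    gDet G y a b c * gDet G y a' b' c' = Matrix.det
      !![gInner G y a a', gInner G y a b', gInner G y a c';
         gInner G y b a', gInner G y b b', gInner G y b c';
         gInner G y c a', gInner G y c b', gInner G y c c'] := by
  have h : !![gInner G y a a', gInner G y a b', gInner G y a c';
         gInner G y b a', gInner G y b b', gInner G y b c';
         gInner G y c a', gInner G y c b', gInner G y c c'] =
      !![a 0, a 1, a 2; b 0, b 1, b 2; c 0, c 1, c 2] * G y *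
        (!![a' 0, a' 1, a' 2; b' 0, b' 1, b' 2; c' 0, c' 1, c' 2]).transpose := by
    ext i j
    fin_cases i <;> fin_cases j <;>
      simp [Matrix.mul_apply, Matrix.vecMul, dotProduct, Fin.sum_univ_three, gInner] <;> ring
  rw [h, Matrix.det_mul, Matrix.det_mul, Matrix.det_transpose, gDet, gDet]
  have := Real.mul_self_sqrt hG
  linear_combination (Matrix.det !![a 0, a 1, a 2; b 0, b 1, b 2; c 0, c 1, c 2]) *
    (Matrix.det !![a' 0, a' 1, a' 2; b' 0, b' 1, b' 2; c' 0, c' 1, c' 2]) * this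

theorem gDet_smul_left (r : ℝ) (a b c : Euc 3) : gDet G y (r • a) b c = r * gDet G y a b c := by
  simp [gDet, Matrix.det_fin_three]; ring

theorem gDet_smul_mid (r : ℝ) (a b c : Euc 3) : gDet G y a (r • b) c = r * gDet G y a b c := by
  simp [gDet, Matrix.det_fin_three]; ring

theorem gDet_add_left (a a' b c : Euc 3) :
    gDet G y (a + a') b c = gDet G y a b c + gDet G y a' b c := by
  simp [gDet, Matrix.det_fin_three]; ring

theorem gDet_add_mid (a b b' c : Euc 3) :
    gDet G y a (b + b') c = gDet G y a b c + gDet G y a b' c := by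
  simp [gDet, Matrix.det_fin_three]; ring

theorem gDet_self_left (a b : Euc 3) : gDet G y a a b = 0 := by
  simp [gDet, Matrix.det_fin_three]; right; ring

theorem gDet_self_right (a b : Euc 3) : gDet G y a b b = 0 := by
  simp [gDet, Matrix.det_fin_three]; right; ring

theorem gDet_self_outer (a b : Euc 3) : gDet G y a b a = 0 := by
  simp [gDet, Matrix.det_fin_three]; right; ring

theorem gDet_swap_left (a b c : Euc 3) : gDet G y b a c = -gDet G y a b c := by
  simp [gDet, Matrix.det_fin_three]; ring

/-- A vector orthogonal to the independent vectors `a`, `b` is a multiple of the unit normal. -/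
theorem eq_smul_normal (hG : (G y).PosDef) {a b N : Euc 3} (hab : gram G y a b ≠ 0)
    (ha : gInner G y a N = 0) (hb : gInner G y b N = 0) (hN : gInner G y N N = 1) {w : Euc 3}
    (hwa : gInner G y w a = 0) (hwb : gInner G y w b = 0) : w = gInner G y w N • N := by
  have hs := posDef_symm hG
  set z := w - gInner G y w N • N with hz
  have hza : gInner G y z a = 0 := by
    rw [hz, gInner_sub_left, gInner_smul_left, hwa, gInner_comm hs N, ha]; ring
  have hzb : gInner G y z b = 0 := by
    rw [hz, gInner_sub_left, gInner_smul_left, hwb, gInner_comm hs N, hb]; ring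
  have hzN : gInner G y z N = 0 := by
    rw [hz, gInner_sub_left, gInner_smul_left, hN]; ring
  have hpos := hG.det_pos
  have h1 : gDet G y a b N ≠ 0 := by
    intro h
    have := gDet_mul_gDet hpos.le a b N a b N
    rw [h, Matrix.det_fin_three] at this
    simp [ha, hb, hN, gInner_comm hs N a, gInner_comm hs N b, gInner_comm hs b a] at this
    apply hab
    rw [gram]; linarith
  have h2 : Matrix.det !![a 0, a 1, a 2; b 0, b 1, b 2; N 0, N 1, N 2] ≠ 0 := by
    intro h; apply h1; rw [gDet, h, mul_zero]
  have h3 : (!![a 0, a 1, a 2; b 0, b 1, b 2; N 0, N 1, N 2]).mulVec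
      ((G y).mulVec (fun i => z i)) = 0 := by
    rw [gInner_comm hs] at hza hzb hzN
    simp only [gInner, Fin.sum_univ_three] at hza hzb hzN
    ext i
    fin_cases i <;> simp [Matrix.mulVec, dotProduct, Fin.sum_univ_three] <;> linarith
  have h4 := Matrix.eq_zero_of_mulVec_eq_zero hpos.ne' (Matrix.eq_zero_of_mulVec_eq_zero h2 h3)
  have h5 : z = 0 := by ext i; exact congrFun h4 i
  exact sub_eq_zero.1 h5

theorem gInner_gCross (hd : (G y).det ≠ 0) (hs : ∀ i j, G y i j = G y j i) (a b c : Euc 3) :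
    gInner G y (gCross G y a b) c = gDet G y a b c := by
  have h1 : (G y).mulVec (fun i => gCross G y a b i) =
      √((G y).det) • crossProduct (fun i => a i) (fun i => b i) := by
    have : (fun i => gCross G y a b i) = √((G y).det) •
      ((G y)⁻¹).mulVec (crossProduct (fun i => a i) (fun i => b i)) := rfl
    rw [this, Matrix.mulVec_smul, Matrix.mulVec_mulVec,
      Matrix.mul_nonsing_inv _ (isUnit_iff_ne_zero.2 hd), Matrix.one_mulVec]
  rw [gInner_comm hs]
  have h2 : gInner G y c (gCross G y a b) = ∑ i, c i * ((G y).mulVec (fun i => gCross G y a b i)) i := by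
    simp only [gInner, Matrix.mulVec, dotProduct, Finset.mul_sum]
    congr! 2; ring
  rw [h2, h1]
  simp [Fin.sum_univ_three, gDet, Matrix.det_fin_three, cross_apply]
  ring

variable {a b N : Euc 3}

theorem gDet_normal_sq (hG : (G y).PosDef) (ha : gInner G y a N = 0) (hb : gInner G y b N = 0)
    (hN : gInner G y N N = 1) : gDet G y a b N ^ 2 = gram G y a b := by
  have hs := posDef_symm hG
  rw [sq, gDet_mul_gDet hG.det_pos.le, Matrix.det_fin_three]
  simp [ha, hb, hN, gInner_comm hs N a, gInner_comm hs N b, gInner_comm hs b a, gram]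
  ring

/-- Multiply by det(a, b, N): the product is gram(a, b)⟨c, N⟩, while det(a, b, N)² = gram(a, b).
This turns the triple product in the cuspidal curvature into a normal component. -/
theorem gDet_sq_eq (hG : (G y).PosDef) (ha : gInner G y a N = 0) (hb : gInner G y b N = 0)
    (hN : gInner G y N N = 1) (hab : gram G y a b ≠ 0) (c : Euc 3) :
    gDet G y a b c ^ 2 = gram G y a b * gInner G y c N ^ 2 := by
  have hs := posDef_symm hG
  have h1 : gDet G y a b c * gDet G y a b N = gram G y a b * gInner G y c N := by
    rw [gDet_mul_gDet hG.det_pos.le, Matrix.det_fin_three]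
    simp [ha, hb, gInner_comm hs b a, gram]
    ring
  have h2 := gDet_normal_sq hG ha hb hN
  have h3 : gDet G y a b c ^ 2 * gram G y a b = (gram G y a b * gInner G y c N) ^ 2 := by
    rw [← h1, ← h2]; ring
  apply mul_right_cancel₀ hab
  rw [h3]; ring

/-- The cross product is a multiple of the normal, with coefficient det(a, b, N). -/
theorem gNorm_gCross_sq (hG : (G y).PosDef) (ha : gInner G y a N = 0) (hb : gInner G y b N = 0)
    (hN : gInner G y N N = 1) (hab : gram G y a b ≠ 0) :
    gNorm G y (gCross G y a b) ^ 2 = gram G y a b := by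
  have hs := posDef_symm hG
  have hc := gInner_gCross (G := G) (y := y) hG.det_pos.ne' hs a b
  set X := gCross G y a b
  have hXa : gInner G y X a = 0 := by rw [hc, gDet_self_outer]
  have hXb : gInner G y X b = 0 := by rw [hc, gDet_self_right]
  have h1 := eq_smul_normal hG hab ha hb hN hXa hXb
  have h2 : gInner G y X N ^ 2 = gram G y a b := by rw [hc, gDet_normal_sq hG ha hb hN]
  rw [gNorm_sq hG, h1, gInner_smul_left, gInner_smul_right, hN, ← h2]
  ring

end Volume

/-! ### The Gauss equation -/

section Gauss

/-- The contraction of the curvature tensor of a surface in terms of Christoffel symbols of the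
first kind. -/
theorem sum_riemann {I : Euc 2 → Matrix (Fin 2) (Fin 2) ℝ} {x : Euc 2}
    (hI : ∀ᶠ z in 𝓝 x, IsMetricAt I z) :
    ∑ l, riemann I l 1 0 1 x * I x l 0 = pderiv 0 (lowerChristoffel I 1 1 0) x
      - pderiv 1 (lowerChristoffel I 0 1 0) x
      - ∑ l, lowerChristoffel I 0 0 l x * christoffel I l 1 1 x
      + ∑ l, lowerChristoffel I 0 1 l x * christoffel I l 0 1 x := by
  have hx := hI.self_of_nhds
  -- Differentiating Γᵢⱼ,₀ = ∑ I₀ₗ Γˡᵢⱼ produces the derivatives of the upper symbols; `e1` to `e4`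
  -- then express the derivatives of I by lower symbols, leaving a quadratic identity.
  have h1 : ∀ k i j, pderiv k (lowerChristoffel I i j 0) x =
      ∑ l, (pderiv k (fun z => I z 0 l) x * christoffel I l i j x +
        I x 0 l * pderiv k (christoffel I l i j) x) := by
    intro k i j
    have : (fun z => ∑ l, I z 0 l * christoffel I l i j z) =ᶠ[𝓝 x] lowerChristoffel I i j 0 :=
      hI.mono fun z hz => sum_mul_christoffel hz.det_ne 0 i j
    rw [pderiv, ← this.fderiv_eq]
    have hd := HasFDerivAt.fun_sum (u := Finset.univ) fun l (_ : l ∈ Finset.univ) =>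
      ((hx.differentiableAt 0 l).hasFDerivAt.mul
        ((hx.contDiffAt_christoffel l i j).differentiableAt (by simp)).hasFDerivAt)
    have hd' : HasFDerivAt (fun z => ∑ l, I z 0 l * christoffel I l i j z) _ x := hd
    rw [hd'.fderiv, sum_apply]
    congr! 1 with l
    simp [pderiv]; ring
  have h2 := fun i j => sum_mul_christoffel hx.det_ne 0 i j
  simp only [Fin.sum_univ_two] at h1 h2 ⊢
  rw [h1, h1]
  simp only [riemann, Fin.sum_univ_two]
  have hc10 := fun k => hx.christoffel_comm k 1 0
  rw [hx.symm_self 1 0]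
  have e1 : pderiv 0 (fun z => I z 0 0) x = 2 * lowerChristoffel I 0 0 0 x := by
    simp only [lowerChristoffel]; ring
  have e2 : pderiv 0 (fun z => I z 0 1) x = lowerChristoffel I 0 1 0 x +
      lowerChristoffel I 0 0 1 x := by
    simp only [lowerChristoffel]; rw [hx.pderiv_comm 0 1 0]; ring
  have e3 : pderiv 1 (fun z => I z 0 0) x = 2 * lowerChristoffel I 0 1 0 x := by
    simp only [lowerChristoffel]; rw [hx.pderiv_comm 0 1 0]; ring
  have e4 : pderiv 1 (fun z => I z 0 1) x = lowerChristoffel I 1 1 0 x +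
      lowerChristoffel I 0 1 1 x := by
    simp only [lowerChristoffel]; rw [hx.pderiv_comm 1 1 0]; ring
  rw [e1, e2, e3, e4]
  have g00 := h2 0 0; have g01 := h2 0 1; have g11 := h2 1 1
  rw [hc10, hc10]
  linear_combination (christoffel I 0 1 1 x) * g00 + (christoffel I 1 1 1 x) * g01
    - (christoffel I 0 0 1 x) * g01 - (christoffel I 1 0 1 x) * g11

variable {G : Euc 3 → Matrix (Fin 3) (Fin 3) ℝ} {F N : Euc 2 → Euc 3} {x : Euc 2}

theorem firstForm_apply (i j : Fin 2) :
    firstForm G F x i j = gInner G (F x) (pderiv i F x) (pderiv j F x) := rfl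

theorem det_firstForm (hs : ∀ i j, G (F x) i j = G (F x) j i) :
    (firstForm G F x).det = gram G (F x) (pderiv 0 F x) (pderiv 1 F x) := by
  rw [Matrix.det_fin_two, gram]
  simp only [firstForm_apply]
  rw [gInner_comm hs (pderiv 1 F x) (pderiv 0 F x)]; ring

theorem contDiffAt_pderiv {n : ℕ} {F : Euc n → Euc 3} {x : Euc n} (hF : ContDiffAt ℝ ∞ F x)
    (i : Fin n) : ContDiffAt ℝ ∞ (pderiv i F) x := hF.fderiv_apply_const _

theorem isMetricAt_firstForm (hG : ∀ᶠ z in 𝓝 (F x), IsMetricAt G z) (hF : ContDiffAt ℝ ∞ F x)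
    (hd : (firstForm G F x).det ≠ 0) : IsMetricAt (firstForm G F) x where
  contDiffAt i j := ContDiffAt.gInner hG.self_of_nhds.contDiffAt hF (contDiffAt_pderiv hF i)
    (contDiffAt_pderiv hF j)
  symm := by
    filter_upwards [hF.continuousAt.eventually hG] with z hz i j
    exact gInner_comm hz.symm_self _ _
  det_ne := hd

/-- Ambient compatibility and torsion-freeness collapse the Koszul expression, so that the induced
connection is the tangential part of the ambient one. -/
theorem lowerChristoffel_firstForm (hG : IsMetricAt G (F x)) (hF : ContDiffAt ℝ ∞ F x)
    (i j l : Fin 2) : lowerChristoffel (firstForm G F) i j l x =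
      gInner G (F x) (covDeriv G F (pderiv j F) x (basisVec i)) (pderiv l F x) := by
  have hd : ∀ i, DifferentiableAt ℝ (pderiv i F) x := fun i =>
    (contDiffAt_pderiv hF i).differentiableAt (by simp)
  have h1 : ∀ k i j, pderiv k (fun z => firstForm G F z i j) x =
      gInner G (F x) (covDeriv G F (pderiv i F) x (basisVec k)) (pderiv j F x) +
      gInner G (F x) (pderiv i F x) (covDeriv G F (pderiv j F) x (basisVec k)) := fun k i j =>
    hG.fderiv_gInner (hF.differentiableAt (by simp)) (hd i) (hd j) _
  have hc : ∀ i j, covDeriv G F (pderiv j F) x (basisVec i) =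
      covDeriv G F (pderiv i F) x (basisVec j) := fun i j => hG.covDeriv_fderiv_comm hF _ _
  have hs := gInner_comm hG.symm_self
  simp only [lowerChristoffel, h1]
  rw [hc j i, hc l i, hc l j, hs (pderiv j F x), hs (pderiv i F x)]
  ring

/-- Differentiate ⟨F_i, N⟩ = 0. In this form the symmetry of the second fundamental form is visible.
-/
theorem secondForm_apply (hG : IsMetricAt G (F x)) (hF : ContDiffAt ℝ ∞ F x)
    (hN : DifferentiableAt ℝ N x)
    (hn : ∀ᶠ z in 𝓝 x, ∀ a, gInner G (F z) (fderiv ℝ F z a) (N z) = 0) (i j : Fin 2) :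
    secondForm G F N x i j = gInner G (F x) (covDeriv G F (pderiv i F) x (basisVec j)) (N x) := by
  have h1 := hG.fderiv_gInner (hF.differentiableAt (by simp))
    ((contDiffAt_pderiv hF i).differentiableAt (by simp)) hN (basisVec j)
  have h2 : (fun z => gInner G (F z) (pderiv i F z) (N z)) =ᶠ[𝓝 x] fun _ => 0 :=
    hn.mono fun z hz => hz _
  rw [h2.fderiv_eq] at h1
  simp only [fderiv_fun_const, Pi.zero_apply, zero_apply] at h1
  simp only [secondForm, Matrix.of_apply]
  linarith

theorem secondForm_comm (hG : IsMetricAt G (F x)) (hF : ContDiffAt ℝ ∞ F x)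
    (hN : DifferentiableAt ℝ N x)
    (hn : ∀ᶠ z in 𝓝 x, ∀ a, gInner G (F z) (fderiv ℝ F z a) (N z) = 0) (i j : Fin 2) :
    secondForm G F N x i j = secondForm G F N x j i := by
  rw [secondForm_apply hG hF hN hn, secondForm_apply hG hF hN hn]
  have : covDeriv G F (pderiv i F) x (basisVec j) = covDeriv G F (pderiv j F) x (basisVec i) :=
    hG.covDeriv_fderiv_comm hF (basisVec i) (basisVec j)
  rw [this]

theorem eventually_isMetricAt_firstForm (hG : ∀ᶠ z in 𝓝 (F x), IsMetricAt G z)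
    (hF : ∀ᶠ z in 𝓝 x, ContDiffAt ℝ ∞ F z) (hd : (firstForm G F x).det ≠ 0) :
    ∀ᶠ z in 𝓝 x, IsMetricAt (firstForm G F) z := by
  have hFx := hF.self_of_nhds
  have hc := (ContDiffAt.matrix_det (isMetricAt_firstForm hG hFx hd).contDiffAt).continuousAt
  filter_upwards [hF, hFx.continuousAt.eventually hG.eventually_nhds, hc.eventually_ne hd]
    with z h1 h2 h3
  exact isMetricAt_firstForm h2 h1 h3

/-- The Gauss equation. -/
theorem gaussCurvature_firstForm (hG : ∀ᶠ z in 𝓝 (F x), IsMetricAt G z)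
    (hpd : (G (F x)).PosDef) (hF : ∀ᶠ z in 𝓝 x, ContDiffAt ℝ ∞ F z)
    (hN : DifferentiableAt ℝ N x) (hu : gInner G (F x) (N x) (N x) = 1)
    (hn : ∀ᶠ z in 𝓝 x, ∀ a, gInner G (F z) (fderiv ℝ F z a) (N z) = 0)
    (hd : (firstForm G F x).det ≠ 0) :
    gaussCurvature (firstForm G F) x =
      (gInner G (F x) (curvatureForm G (F x) (pderiv 0 F x) (pderiv 1 F x) (pderiv 1 F x))
        (pderiv 0 F x) + (secondForm G F N x).det) / (firstForm G F x).det := by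
  have hGx := hG.self_of_nhds
  have hFx := hF.self_of_nhds
  have hs := gInner_comm hGx.symm_self
  have hI := eventually_isMetricAt_firstForm hG hF hd
  have hIx := hI.self_of_nhds
  set a : Fin 2 → Fin 2 → Euc 3 := fun i j => covDeriv G F (pderiv j F) x (basisVec i) with ha
  have hac : a 1 0 = a 0 1 := hGx.covDeriv_fderiv_comm hFx _ _
  have hlow : ∀ i j l, lowerChristoffel (firstForm G F) i j l x =
      gInner G (F x) (a i j) (pderiv l F x) := lowerChristoffel_firstForm hGx hFx
  have hlow' : ∀ i j l, lowerChristoffel (firstForm G F) i j l =ᶠ[𝓝 x] fun z =>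
      gInner G (F z) (covDeriv G F (pderiv j F) z (basisVec i)) (pderiv l F z) := by
    intro i j l
    filter_upwards [hF, hFx.continuousAt.eventually hG] with z h1 h2
    exact lowerChristoffel_firstForm h2 h1 i j l
  have hsec : ∀ i j, secondForm G F N x i j = gInner G (F x) (a j i) (N x) :=
    secondForm_apply hGx hFx hN hn
  have hsmooth : ∀ j i, DifferentiableAt ℝ
      (fun z => covDeriv G F (pderiv j F) z (basisVec i)) x := fun j i =>
    (hGx.contDiffAt_covDeriv hFx (contDiffAt_pderiv hFx j) contDiffAt_const).differentiableAt
      (by simp)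
  have hP : ∀ l, DifferentiableAt ℝ (pderiv l F) x := fun l =>
    (contDiffAt_pderiv hFx l).differentiableAt (by simp)
  have hder : ∀ k i j, pderiv k (lowerChristoffel (firstForm G F) i j 0) x =
      gInner G (F x) (covDeriv G F (fun z => covDeriv G F (pderiv j F) z (basisVec i)) x
        (basisVec k)) (pderiv 0 F x) + gInner G (F x) (a i j) (a k 0) := by
    intro k i j
    rw [pderiv, (hlow' i j 0).fderiv_eq, hGx.fderiv_gInner (hFx.differentiableAt (by simp))
      (hsmooth j i) (hP 0)]
  have hcurv := hGx.covDeriv_covDeriv_sub hFx (contDiffAt_pderiv hFx 1) (basisVec 0) (basisVec 1)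
  -- T is the tangential part of ∇ᵢF_j: by `hTa` the rest is orthogonal to both coordinate vectors,
  -- hence a multiple of N.
  set T : Fin 2 → Fin 2 → Euc 3 := fun i j =>
    christoffel (firstForm G F) 0 i j x • pderiv 0 F x +
    christoffel (firstForm G F) 1 i j x • pderiv 1 F x with hT
  have hgram : gram G (F x) (pderiv 0 F x) (pderiv 1 F x) ≠ 0 := by
    rwa [← det_firstForm hGx.symm_self]
  have hTa : ∀ i j l, gInner G (F x) (a i j - T i j) (pderiv l F x) = 0 := by
    intro i j l
    have := sum_mul_christoffel hd l i j
    rw [hlow, Fin.sum_univ_two] at this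
    rw [gInner_sub_left, ← this, hT]
    simp only [gInner_add_left, gInner_smul_left, firstForm_apply]
    rw [hs (pderiv l F x), hs (pderiv l F x)]
    ring
  have hnx : ∀ l, gInner G (F x) (pderiv l F x) (N x) = 0 := fun l => hn.self_of_nhds _
  have hTN : ∀ i j, gInner G (F x) (T i j) (N x) = 0 := by
    intro i j
    simp only [hT, gInner_add_left, gInner_smul_left, hnx]; ring
  have hnormal : ∀ i j, a i j = T i j + gInner G (F x) (a i j) (N x) • N x := by
    intro i j
    have := eq_smul_normal hpd hgram (hnx 0) (hnx 1) hu (hTa i j 0) (hTa i j 1)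
    rw [gInner_sub_left, hTN, sub_zero] at this
    rw [← this]; abel
  have hTsum : ∀ b i j, gInner G (F x) b (T i j) = gInner G (F x) b (a i j) -
      gInner G (F x) (a i j) (N x) * gInner G (F x) b (N x) := by
    intro b i j
    conv_rhs => enter [1]; rw [hnormal i j, gInner_add_right, gInner_smul_right]
    ring
  have hTexp : ∀ b i j, gInner G (F x) b (T i j) =
      gInner G (F x) b (pderiv 0 F x) * christoffel (firstForm G F) 0 i j x +
      gInner G (F x) b (pderiv 1 F x) * christoffel (firstForm G F) 1 i j x := by
    intro b i j
    simp only [hT, gInner_add_right, gInner_smul_right]; ring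
  -- These two pairings are the quadratic Christoffel terms of the intrinsic curvature; the normal
  -- parts subtracted by `hTsum` add up to det II.
  have h00 := hTexp (a 0 0) 1 1
  have h01 := hTexp (a 0 1) 0 1
  rw [hTsum] at h00 h01
  rw [gaussCurvature, sum_riemann hI]
  congr 1
  rw [hder, hder]
  simp only [Fin.sum_univ_two, hlow]
  have hcurv' : gInner G (F x) (curvatureForm G (F x) (pderiv 0 F x) (pderiv 1 F x) (pderiv 1 F x))
        (pderiv 0 F x) = _ := congrArg (fun v => gInner G (F x) v (pderiv 0 F x)) hcurv.symm
  rw [hcurv', Matrix.det_fin_two]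
  simp only [hsec, gInner_sub_left]
  rw [hac]
  rw [hs (a 1 1) (a 0 0)]
  linear_combination h00 - h01

end Gauss

/-! ### Surfaces with a frame adapted to a swallowtail -/

/-- The direction `(1, m u)`, which is null along the `u`-axis for the surfaces considered below. -/
def nullDir (m : ℝ) (y : Euc 2) : Euc 2 := !₂[1, m * y 0]

/-- Near `x`, the surface `F` with unit normal field `N` satisfies `F_u = v h - m u F_v`, where
`h` and `F_v` are independent. -/
structure FrameAt (G : Euc 3 → Matrix (Fin 3) (Fin 3) ℝ) (F N h : Euc 2 → Euc 3) (m : ℝ)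
    (x : Euc 2) : Prop where
  metric : ∀ᶠ y in 𝓝 (F x), IsMetricAt G y
  posDef : ∀ᶠ y in 𝓝 (F x), (G y).PosDef
  smooth : ∀ᶠ z in 𝓝 x, ContDiffAt ℝ ∞ F z
  smooth_normal : ∀ᶠ z in 𝓝 x, ContDiffAt ℝ ∞ N z
  smooth_frame : ∀ᶠ z in 𝓝 x, ContDiffAt ℝ ∞ h z
  unit : ∀ᶠ z in 𝓝 x, gInner G (F z) (N z) (N z) = 1
  normal : ∀ᶠ z in 𝓝 x, ∀ a, gInner G (F z) (fderiv ℝ F z a) (N z) = 0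
  normal_frame : ∀ᶠ z in 𝓝 x, gInner G (F z) (h z) (N z) = 0
  frame : ∀ᶠ z in 𝓝 x, pderiv 0 F z = z 1 • h z - (m * z 0) • pderiv 1 F z
  indep : gram G (F x) (h x) (pderiv 1 F x) ≠ 0

section

variable {G : Euc 3 → Matrix (Fin 3) (Fin 3) ℝ} {F N h : Euc 2 → Euc 3} {m : ℝ} {x : Euc 2}

theorem euc_two_eq (w : Euc 2) : w = w 0 • (basisVec 0 : Euc 2) + w 1 • (basisVec 1 : Euc 2) := by
  ext i; fin_cases i <;> simp [basisVec]

theorem ContDiffAt.gram {n : ℕ} {G : Euc n → Matrix (Fin n) (Fin n) ℝ} {D : Type*}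
    [NormedAddCommGroup D] [NormedSpace ℝ D] {F A B : D → Euc n} {x : D}
    (hG : ∀ i j, ContDiffAt ℝ ∞ (fun z => G z i j) (F x))
    (hF : ContDiffAt ℝ ∞ F x) (hA : ContDiffAt ℝ ∞ A x) (hB : ContDiffAt ℝ ∞ B x) :
    ContDiffAt ℝ ∞ (fun z => gram G (F z) (A z) (B z)) x :=
  ((ContDiffAt.gInner hG hF hA hA).mul (ContDiffAt.gInner hG hF hB hB)).sub
    ((ContDiffAt.gInner hG hF hA hB).pow 2)

theorem FrameAt.eventually (H : FrameAt G F N h m x) : ∀ᶠ z in 𝓝 x, FrameAt G F N h m z := by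
  have hFx := H.smooth.self_of_nhds
  have hc := hFx.continuousAt
  have hgr := (ContDiffAt.gram H.metric.self_of_nhds.contDiffAt hFx H.smooth_frame.self_of_nhds
    (contDiffAt_pderiv hFx 1)).continuousAt.eventually_ne H.indep
  filter_upwards [hc.eventually H.metric.eventually_nhds, hc.eventually H.posDef.eventually_nhds,
    H.smooth.eventually_nhds, H.smooth_normal.eventually_nhds, H.smooth_frame.eventually_nhds,
    H.unit.eventually_nhds, H.normal.eventually_nhds, H.normal_frame.eventually_nhds,
    H.frame.eventually_nhds, hgr] with z h1 h2 h3 h4 h5 h6 h7 h8 h9 h10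
  exact ⟨h1, h2, h3, h4, h5, h6, h7, h8, h9, h10⟩

theorem FrameAt.fderiv_eq (H : FrameAt G F N h m x) (w : Euc 2) :
    fderiv ℝ F x w = (w 0 * x 1) • h x + (w 1 - m * x 0 * w 0) • pderiv 1 F x := by
  have h1 := H.frame.self_of_nhds
  have h2 : fderiv ℝ F x w = w 0 • pderiv 0 F x + w 1 • pderiv 1 F x := by
    conv_lhs => rw [euc_two_eq w]
    simp [pderiv]
  rw [h2, h1]
  module

/-- Decomposition of the direction in the basis (X, ∂_v), with X = `nullDir m x`. In this basis both
fundamental forms show their powers of v. -/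
theorem covDeriv_eq_nullDir (w : Euc 2) (V : Euc 2 → Euc 3) :
    covDeriv G F V x w = w 0 • covDeriv G F V x (nullDir m x) +
      (w 1 - m * x 0 * w 0) • covDeriv G F V x (basisVec 1) := by
  have : w = w 0 • nullDir m x + (w 1 - m * x 0 * w 0) • (basisVec 1 : Euc 2) := by
    ext i; fin_cases i <;> simp [basisVec, nullDir]; ring
  conv_lhs => rw [this]
  rw [covDeriv_add_dir, covDeriv_smul_dir, covDeriv_smul_dir]

/-- Symmetry of the second fundamental form in u and v, after substituting F_u = v h - m u F_v. It
gives the mixed entry its factor v. -/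
theorem FrameAt.gInner_pderiv_covDeriv_nullDir (H : FrameAt G F N h m x) :
    gInner G (F x) (pderiv 1 F x) (covDeriv G F N x (nullDir m x)) =
      x 1 * gInner G (F x) (h x) (covDeriv G F N x (basisVec 1)) := by
  have hN := H.smooth_normal.self_of_nhds.differentiableAt (by simp)
  have hF := H.smooth.self_of_nhds
  have hs := secondForm_comm H.metric.self_of_nhds hF hN H.normal 0 1
  simp only [secondForm, Matrix.of_apply] at hs
  have hX : nullDir m x = basisVec 0 + (m * x 0) • (basisVec 1 : Euc 2) := by
    ext i; fin_cases i <;> simp [basisVec, nullDir]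
  rw [H.frame.self_of_nhds, gInner_sub_left, gInner_smul_left, gInner_smul_left] at hs
  rw [hX, covDeriv_add_dir, covDeriv_smul_dir, gInner_add_right, gInner_smul_right]
  linarith

theorem FrameAt.gInner_fderiv_fderiv (H : FrameAt G F N h m x) (w w' : Euc 2) :
    gInner G (F x) (fderiv ℝ F x w) (fderiv ℝ F x w') =
      (w 0 * x 1) * (w' 0 * x 1) * gInner G (F x) (h x) (h x) +
      ((w 0 * x 1) * (w' 1 - m * x 0 * w' 0) + (w 1 - m * x 0 * w 0) * (w' 0 * x 1)) *
        gInner G (F x) (h x) (pderiv 1 F x) +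
      (w 1 - m * x 0 * w 0) * (w' 1 - m * x 0 * w' 0) *
        gInner G (F x) (pderiv 1 F x) (pderiv 1 F x) := by
  have hs := gInner_comm H.metric.self_of_nhds.symm_self (pderiv 1 F x) (h x)
  simp only [H.fderiv_eq, gInner_add_left, gInner_add_right, gInner_smul_left, gInner_smul_right, hs]
  ring

/-- Every entry except the pure ∂_v one has a factor v, from df(X) = v h and from the symmetry just
used. -/
theorem FrameAt.gInner_fderiv_covDeriv (H : FrameAt G F N h m x) (w w' : Euc 2) :
    gInner G (F x) (fderiv ℝ F x w) (covDeriv G F N x w') =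
      x 1 * (w 0 * w' 0 * gInner G (F x) (h x) (covDeriv G F N x (nullDir m x)) +
      (w 0 * (w' 1 - m * x 0 * w' 0) + (w 1 - m * x 0 * w 0) * w' 0) *
        gInner G (F x) (h x) (covDeriv G F N x (basisVec 1))) +
      (w 1 - m * x 0 * w 0) * (w' 1 - m * x 0 * w' 0) *
        gInner G (F x) (pderiv 1 F x) (covDeriv G F N x (basisVec 1)) := by
  rw [H.fderiv_eq, covDeriv_eq_nullDir (m := m) w']
  simp only [gInner_add_left, gInner_add_right, gInner_smul_left, gInner_smul_right,
    H.gInner_pderiv_covDeriv_nullDir]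
  ring

variable {θ : Euc 2 → Euc 2} {z : Euc 2}

/-- The Jacobian determinant. -/
def jacobian (θ : Euc 2 → Euc 2) (z : Euc 2) : ℝ :=
  fderiv ℝ θ z (basisVec 0) 0 * fderiv ℝ θ z (basisVec 1) 1 -
    fderiv ℝ θ z (basisVec 0) 1 * fderiv ℝ θ z (basisVec 1) 0

theorem FrameAt.pderiv_comp (H : FrameAt G F N h m (θ z)) (hθ : DifferentiableAt ℝ θ z)
    (i : Fin 2) : pderiv i (F ∘ θ) z = fderiv ℝ F (θ z) (fderiv ℝ θ z (basisVec i)) := by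
  rw [pderiv, fderiv_comp z (H.smooth.self_of_nhds.differentiableAt (by simp)) hθ]; rfl

theorem FrameAt.covDeriv_normal_comp (H : FrameAt G F N h m (θ z)) (hθ : DifferentiableAt ℝ θ z)
    (w : Euc 2) :
    covDeriv G (F ∘ θ) (N ∘ θ) z w = covDeriv G F N (θ z) (fderiv ℝ θ z w) :=
  covDeriv_comp (H.smooth.self_of_nhds.differentiableAt (by simp))
    (H.smooth_normal.self_of_nhds.differentiableAt (by simp)) hθ w

theorem FrameAt.det_firstForm_comp (H : FrameAt G F N h m (θ z)) (hθ : DifferentiableAt ℝ θ z) :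
    (firstForm G (F ∘ θ) z).det =
      (θ z 1 * jacobian θ z) ^ 2 * gram G (F (θ z)) (h (θ z)) (pderiv 1 F (θ z)) := by
  simp only [Matrix.det_fin_two, firstForm_apply, H.pderiv_comp hθ, Function.comp_apply,
    H.gInner_fderiv_fderiv, jacobian, gram]
  ring

/-- With v = `θ z 1` and J the Jacobian, the numerator of H has the factor v J² against (v J)² in
det I. The pole along the axis is therefore simple, and its coefficient does not involve J. -/
theorem FrameAt.meanCurvature_comp (H : FrameAt G F N h m (θ z)) (hθ : DifferentiableAt ℝ θ z)
    (hJ : jacobian θ z ≠ 0) (hz : θ z 1 ≠ 0) :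
    meanCurvature G (F ∘ θ) (N ∘ θ) z = -(gInner G (F (θ z)) (pderiv 1 F (θ z)) (pderiv 1 F (θ z)) *
        gInner G (F (θ z)) (h (θ z)) (covDeriv G F N (θ z) (nullDir m (θ z))) +
      θ z 1 * (gInner G (F (θ z)) (h (θ z)) (h (θ z)) *
          gInner G (F (θ z)) (pderiv 1 F (θ z)) (covDeriv G F N (θ z) (basisVec 1)) -
        2 * gInner G (F (θ z)) (h (θ z)) (pderiv 1 F (θ z)) *
          gInner G (F (θ z)) (h (θ z)) (covDeriv G F N (θ z) (basisVec 1)))) /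
      (2 * (θ z 1 * gram G (F (θ z)) (h (θ z)) (pderiv 1 F (θ z)))) := by
  have hg := H.indep
  have hd : (2 * (firstForm G (F ∘ θ) z).det) ≠ 0 := by
    rw [H.det_firstForm_comp hθ]; positivity
  simp only [meanCurvature]
  rw [div_eq_div_iff hd (by positivity), H.det_firstForm_comp hθ]
  simp only [firstForm_apply, secondForm, Matrix.of_apply, H.pderiv_comp hθ, Function.comp_apply,
    H.covDeriv_normal_comp hθ, H.gInner_fderiv_fderiv, H.gInner_fderiv_covDeriv, jacobian]
  ring

theorem FrameAt.det_secondForm_comp (H : FrameAt G F N h m (θ z)) (hθ : DifferentiableAt ℝ θ z) :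
    (secondForm G (F ∘ θ) (N ∘ θ) z).det = θ z 1 * jacobian θ z ^ 2 *
      (gInner G (F (θ z)) (h (θ z)) (covDeriv G F N (θ z) (nullDir m (θ z))) *
        gInner G (F (θ z)) (pderiv 1 F (θ z)) (covDeriv G F N (θ z) (basisVec 1)) -
      θ z 1 * gInner G (F (θ z)) (h (θ z)) (covDeriv G F N (θ z) (basisVec 1)) ^ 2) := by
  simp only [Matrix.det_fin_two, secondForm, Matrix.of_apply, H.pderiv_comp hθ, Function.comp_apply,
    H.covDeriv_normal_comp hθ, H.gInner_fderiv_covDeriv, jacobian]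
  ring

/-- R alternates in its first two arguments, so they contribute the determinant v J of their
coefficients in (h, F_v). The other two are left alone, to keep a slot for the vector F_u that
vanishes at the swallowtail. -/
theorem FrameAt.gInner_curvatureForm_comp (H : FrameAt G F N h m (θ z))
    (hθ : DifferentiableAt ℝ θ z) (V W : Euc 3) :
    gInner G (F (θ z)) (curvatureForm G (F (θ z)) (pderiv 0 (F ∘ θ) z) (pderiv 1 (F ∘ θ) z) V) W =
      θ z 1 * jacobian θ z * gInner G (F (θ z))
        (curvatureForm G (F (θ z)) (h (θ z)) (pderiv 1 F (θ z)) V) W := by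
  have h1 : ∀ a b c d : ℝ, ∀ A B : Euc 3, ∀ y, curvatureForm G y (a • A + b • B) (c • A + d • B) V =
      (a * d - b * c) • curvatureForm G y A B V := by
    intro a b c d A B y
    rw [curvatureForm_add_left, curvatureForm_smul_left, curvatureForm_smul_left,
      curvatureForm_swap y (c • A + d • B) A, curvatureForm_swap y (c • A + d • B) B]
    simp only [curvatureForm_add_left, curvatureForm_smul_left, curvatureForm_self]
    rw [curvatureForm_swap y A B]
    module
  rw [H.pderiv_comp hθ, H.pderiv_comp hθ, H.fderiv_eq, H.fderiv_eq, h1, gInner_smul_left, jacobian]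
  ring

theorem FrameAt.normal_comp (H : FrameAt G F N h m (θ z)) (hθ : ContDiffAt ℝ ∞ θ z)
    (hθ' : ∀ᶠ y in 𝓝 z, DifferentiableAt ℝ θ y) :
    ∀ᶠ y in 𝓝 z, ∀ a, gInner G ((F ∘ θ) y) (fderiv ℝ (F ∘ θ) y a) ((N ∘ θ) y) = 0 := by
  filter_upwards [hθ', hθ.continuousAt.eventually H.normal, hθ.continuousAt.eventually H.smooth]
    with y h1 h2 h3 a
  rw [fderiv_comp y (h3.differentiableAt (by simp)) h1]
  exact h2 _

/-- In the Gauss equation det II has the factor v J² and the ambient term the factor v J, against (v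
J)² in det I: again a simple pole. -/
theorem FrameAt.gaussCurvature_comp (H : FrameAt G F N h m (θ z))
    (hθ : ∀ᶠ y in 𝓝 z, ContDiffAt ℝ ∞ θ y) (hJ : jacobian θ z ≠ 0) (hz : θ z 1 ≠ 0) :
    gaussCurvature (firstForm G (F ∘ θ)) z =
      ((gInner G (F (θ z)) (h (θ z)) (covDeriv G F N (θ z) (nullDir m (θ z))) *
        gInner G (F (θ z)) (pderiv 1 F (θ z)) (covDeriv G F N (θ z) (basisVec 1)) -
      θ z 1 * gInner G (F (θ z)) (h (θ z)) (covDeriv G F N (θ z) (basisVec 1)) ^ 2) +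
      gInner G (F (θ z)) (curvatureForm G (F (θ z)) (h (θ z)) (pderiv 1 F (θ z))
        (pderiv 1 (F ∘ θ) z)) (pderiv 0 (F ∘ θ) z) / jacobian θ z) /
      (θ z 1 * gram G (F (θ z)) (h (θ z)) (pderiv 1 F (θ z))) := by
  have hg := H.indep
  have hθz := hθ.self_of_nhds
  have hθd := hθz.differentiableAt (by simp)
  have hd : (firstForm G (F ∘ θ) z).det ≠ 0 := by
    rw [H.det_firstForm_comp hθd]; positivity
  have hF : ∀ᶠ y in 𝓝 z, ContDiffAt ℝ ∞ (F ∘ θ) y := by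
    filter_upwards [hθ, hθz.continuousAt.eventually H.smooth] with y h1 h2 using h2.comp y h1
  rw [gaussCurvature_firstForm (F := F ∘ θ) (N := N ∘ θ) H.metric H.posDef.self_of_nhds hF
    ((H.smooth_normal.self_of_nhds.comp z hθz).differentiableAt (by simp)) H.unit.self_of_nhds
    (H.normal_comp hθz (hθ.mono fun y hy => hy.differentiableAt (by simp))) hd,
    H.det_firstForm_comp hθd, H.det_secondForm_comp hθd]
  simp only [Function.comp_apply]
  rw [H.gInner_curvatureForm_comp hθd]
  field_simp
  ring

end

section

variable {G : Euc 3 → Matrix (Fin 3) (Fin 3) ℝ} {F N h : Euc 2 → Euc 3} {m : ℝ}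

/-! ### Germs -/

theorem firstForm_congr {F F' : Euc 2 → Euc 3} {x : Euc 2} (h : F =ᶠ[𝓝 x] F') :
    firstForm G F x = firstForm G F' x := by
  ext i j
  simp only [firstForm_apply, pderiv, h.fderiv_eq, h.self_of_nhds]

theorem secondForm_congr {F F' N N' : Euc 2 → Euc 3} {x : Euc 2} (h : F =ᶠ[𝓝 x] F')
    (hN : N =ᶠ[𝓝 x] N') : secondForm G F N x = secondForm G F' N' x := by
  ext i j
  simp only [secondForm, Matrix.of_apply, pderiv, covDeriv_congr h hN, h.fderiv_eq, h.self_of_nhds]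

theorem meanCurvature_congr {F F' N N' : Euc 2 → Euc 3} {x : Euc 2} (h : F =ᶠ[𝓝 x] F')
    (hN : N =ᶠ[𝓝 x] N') : meanCurvature G F N x = meanCurvature G F' N' x := by
  simp only [meanCurvature, firstForm_congr h, secondForm_congr h hN]

theorem Filter.EventuallyEq.pderiv {n : ℕ} {W : Type*} [NormedAddCommGroup W] [NormedSpace ℝ W]
    {f f' : Euc n → W} {x : Euc n} (h : f =ᶠ[𝓝 x] f') (i : Fin n) :
    pderiv i f =ᶠ[𝓝 x] pderiv i f' :=
  h.eventuallyEq_nhds.mono fun z hz => by simp only [_root_.pderiv, hz.fderiv_eq]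

theorem gaussCurvature_congr {I I' : Euc 2 → Matrix (Fin 2) (Fin 2) ℝ} {x : Euc 2}
    (h : I =ᶠ[𝓝 x] I') : gaussCurvature I x = gaussCurvature I' x := by
  have hij : ∀ i j, (fun z => I z i j) =ᶠ[𝓝 x] fun z => I' z i j := fun i j =>
    h.mono fun z hz => congrArg (fun A : Matrix (Fin 2) (Fin 2) ℝ => A i j) hz
  have hc : ∀ k i j, christoffel I k i j =ᶠ[𝓝 x] christoffel I' k i j := by
    intro k i j
    filter_upwards [h.eventuallyEq_nhds] with z hz
    have hij : ∀ i j, (fun z => I z i j) =ᶠ[𝓝 z] fun z => I' z i j := fun i j =>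
      hz.mono fun z hz => congrArg (fun A : Matrix (Fin 2) (Fin 2) ℝ => A i j) hz
    simp only [christoffel, hz.self_of_nhds, ((hij _ _).pderiv _).self_of_nhds]
  simp only [gaussCurvature, riemann, h.self_of_nhds, ((hc _ _ _).pderiv _).self_of_nhds,
    (hc _ _ _).self_of_nhds]

/-! ### Limits at the swallowtail -/

/-- The punctured neighborhood filter used for the extensions of `2vH` and `vK`. -/
theorem neBot_nhdsWithin_snd : (𝓝[{x : Euc 2 | x 1 ≠ 0}] 0).NeBot := by
  have h1 : Tendsto (fun t : ℝ => t • (basisVec 1 : Euc 2)) (𝓝[≠] 0) (𝓝[{x : Euc 2 | x 1 ≠ 0}] 0) := by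
    refine tendsto_nhdsWithin_iff.2 ⟨?_, ?_⟩
    · have : Tendsto (fun t : ℝ => t • (basisVec 1 : Euc 2)) (𝓝 0) (𝓝 ((0 : ℝ) • basisVec 1)) :=
        (continuous_id.smul continuous_const).tendsto 0
      rw [zero_smul] at this
      exact this.mono_left nhdsWithin_le_nhds
    · filter_upwards [self_mem_nhdsWithin] with t ht
      simpa [basisVec] using ht
  exact h1.neBot

/-- Strict differentiability at 0 is applied to z and its projection to the axis, where the second
component of `θ` vanishes. This gives the limit in a full neighborhood, not merely along lines. -/
theorem tendsto_div_snd {θ : Euc 2 → Euc 2} (hθ : ContDiffAt ℝ ∞ θ 0)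
    (hax : ∀ᶠ z in 𝓝 (0 : Euc 2), z 1 = 0 → θ z 1 = 0) :
    Tendsto (fun z => θ z 1 / z 1) (𝓝[{x : Euc 2 | x 1 ≠ 0}] 0)
      (𝓝 (fderiv ℝ θ 0 (basisVec 1) 1)) := by
  have hs : HasStrictFDerivAt θ (fderiv ℝ θ 0) 0 := hθ.hasStrictFDerivAt (by simp)
  have hs1 : HasStrictFDerivAt (fun z => θ z 1)
      ((EuclideanSpace.proj (𝕜 := ℝ) (1 : Fin 2)).comp (fderiv ℝ θ 0)) 0 :=
    (EuclideanSpace.proj (𝕜 := ℝ) (1 : Fin 2)).hasStrictFDerivAt.comp 0 hs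
  have hc : Continuous fun z : Euc 2 => z 0 • (basisVec 0 : Euc 2) := by fun_prop
  have hc0 : Tendsto (fun z : Euc 2 => z 0 • (basisVec 0 : Euc 2)) (𝓝 0) (𝓝 0) := by
    have := hc.tendsto 0
    simpa using this
  have ht : Tendsto (fun z : Euc 2 => (z, z 0 • (basisVec 0 : Euc 2))) (𝓝 0) (𝓝 (0, 0)) :=
    tendsto_id.prodMk_nhds hc0
  have ho := hs1.isLittleO.comp_tendsto ht
  have hlim : Tendsto (fun z : Euc 2 => (θ z 1 - z 1 * fderiv ℝ θ 0 (basisVec 1) 1) / z 1)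
      (𝓝[{x : Euc 2 | x 1 ≠ 0}] 0) (𝓝 0) := by
    refine Asymptotics.IsLittleO.tendsto_div_nhds_zero ?_
    refine Asymptotics.IsLittleO.congr' (ho.norm_right.mono nhdsWithin_le_nhds |>.trans_isBigO ?_) ?_
      (EventuallyEq.refl _ _) (g₁ := fun z : Euc 2 => z 1)
    · refine Asymptotics.IsBigO.of_bound 1 (Eventually.of_forall fun z => ?_)
      have : z - z 0 • (basisVec 0 : Euc 2) = z 1 • basisVec 1 := by
        conv_lhs => enter [1]; rw [euc_two_eq z]
        abel
      rw [norm_norm]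
      show ‖z - z 0 • (basisVec 0 : Euc 2)‖ ≤ 1 * ‖z 1‖
      rw [this, norm_smul]
      simp [basisVec]
    · filter_upwards [nhdsWithin_le_nhds (hc0.eventually hax)] with z hz
      have : z - z 0 • (basisVec 0 : Euc 2) = z 1 • basisVec 1 := by
        conv_lhs => enter [1]; rw [euc_two_eq z]
        abel
      have h0 := hz (by simp [basisVec])
      show θ z 1 - θ (z 0 • (basisVec 0 : Euc 2)) 1 - fderiv ℝ θ 0 (z - z 0 • basisVec 0) 1 = _
      rw [this, h0]
      simp
  have := hlim.add_const (fderiv ℝ θ 0 (basisVec 1) 1)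
  rw [zero_add] at this
  refine this.congr' ?_
  filter_upwards [self_mem_nhdsWithin] with z hz
  have hz' : z 1 ≠ 0 := hz
  field_simp
  ring

/-- The frame at a swallowtail, in coordinates `(u, v)` adapted to it. -/
structure SwallowtailFrame (G : Euc 3 → Matrix (Fin 3) (Fin 3) ℝ) (F N h : Euc 2 → Euc 3)
    (m : ℝ) : Prop where
  frameAt : FrameAt G F N h m 0
  norm_one : gInner G (F 0) (pderiv 1 F 0) (pderiv 1 F 0) = 1
  ne_zero : m ≠ 0

/-- The Gram determinant of the frame at the swallowtail. -/
def frameGram (G : Euc 3 → Matrix (Fin 3) (Fin 3) ℝ) (F h : Euc 2 → Euc 3) : ℝ :=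
  gram G (F 0) (h 0) (pderiv 1 F 0)

/-- The number `⟨∇_u h, N⟩` at the swallowtail. -/
def frameBending (G : Euc 3 → Matrix (Fin 3) (Fin 3) ℝ) (F N h : Euc 2 → Euc 3) : ℝ :=
  -gInner G (F 0) (h 0) (covDeriv G F N 0 (basisVec 0))

/-- The limiting normal curvature in terms of the frame. -/
def frameNormalCurvature (G : Euc 3 → Matrix (Fin 3) (Fin 3) ℝ) (F N : Euc 2 → Euc 3) : ℝ :=
  -gInner G (F 0) (pderiv 1 F 0) (covDeriv G F N 0 (basisVec 1))

/-- `θ` is a change of coordinates from adapted ones. -/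
structure IsAdaptedChange (F : Euc 2 → Euc 3) (G : Euc 3 → Matrix (Fin 3) (Fin 3) ℝ)
    (θ : Euc 2 → Euc 2) : Prop where
  smooth : ∀ᶠ z in 𝓝 (0 : Euc 2), ContDiffAt ℝ ∞ θ z
  zero : θ 0 = 0
  jacobian_ne : jacobian θ 0 ≠ 0
  axis : ∀ᶠ z in 𝓝 (0 : Euc 2), z 1 = 0 → θ z 1 = 0
  pderiv_zero : pderiv 0 (F ∘ θ) 0 = 0
  norm_one : gInner G (F 0) (pderiv 1 (F ∘ θ) 0) (pderiv 1 (F ∘ θ) 0) = 1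

variable {θ : Euc 2 → Euc 2}

theorem SwallowtailFrame.fderiv_zero (H : SwallowtailFrame G F N h m) (w : Euc 2) :
    fderiv ℝ F 0 w = w 1 • pderiv 1 F 0 := by
  rw [H.frameAt.fderiv_eq]; simp

theorem SwallowtailFrame.pderiv_one_ne (H : SwallowtailFrame G F N h m) : pderiv 1 F 0 ≠ 0 := by
  intro h0
  have := H.norm_one
  rw [h0, gInner_zero_left] at this
  exact zero_ne_one this

theorem IsAdaptedChange.fderiv_zero_snd (hθ : IsAdaptedChange F G θ)
    (H : SwallowtailFrame G F N h m) : fderiv ℝ θ 0 (basisVec 0) 1 = 0 := by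
  have H0 : FrameAt G F N h m (θ 0) := by rw [hθ.zero]; exact H.frameAt
  have := hθ.pderiv_zero
  rw [H0.pderiv_comp (hθ.smooth.self_of_nhds.differentiableAt (by simp)), hθ.zero, H.fderiv_zero]
    at this
  exact (smul_eq_zero.1 this).resolve_right H.pderiv_one_ne

/-- Both coordinate systems send their second coordinate vector to a unit vector, and dF at 0 sees
only second components. The resulting value ±1 is the whole ambiguity of κ_H and K̂. -/
theorem IsAdaptedChange.fderiv_one_snd_sq (hθ : IsAdaptedChange F G θ)
    (H : SwallowtailFrame G F N h m) : fderiv ℝ θ 0 (basisVec 1) 1 ^ 2 = 1 := by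
  have H0 : FrameAt G F N h m (θ 0) := by rw [hθ.zero]; exact H.frameAt
  have := hθ.norm_one
  rw [H0.pderiv_comp (hθ.smooth.self_of_nhds.differentiableAt (by simp)), hθ.zero, H.fderiv_zero,
    gInner_smul_left, gInner_smul_right, H.norm_one] at this
  linarith

theorem IsAdaptedChange.tendsto (hθ : IsAdaptedChange F G θ) : Tendsto θ (𝓝 0) (𝓝 0) := by
  simpa [ContinuousAt, hθ.zero] using hθ.smooth.self_of_nhds.continuousAt

theorem IsAdaptedChange.eventually_frameAt (hθ : IsAdaptedChange F G θ)
    (H : SwallowtailFrame G F N h m) : ∀ᶠ z in 𝓝 0, FrameAt G F N h m (θ z) :=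
  hθ.tendsto.eventually H.frameAt.eventually

/-- The sign is its own inverse, so the inverted quotient has the same limit. -/
theorem IsAdaptedChange.tendsto_inv (hθ : IsAdaptedChange F G θ) (H : SwallowtailFrame G F N h m) :
    Tendsto (fun z => z 1 / θ z 1) (𝓝[{x : Euc 2 | x 1 ≠ 0}] 0)
      (𝓝 (fderiv ℝ θ 0 (basisVec 1) 1)) := by
  have hσ := hθ.fderiv_one_snd_sq H
  have h1 := (tendsto_div_snd hθ.smooth.self_of_nhds hθ.axis).inv₀
    (by intro h0; rw [h0] at hσ; norm_num at hσ)
  rw [inv_eq_of_mul_eq_one_left (b := fderiv ℝ θ 0 (basisVec 1) 1) (by rw [← sq, hσ])] at h1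
  simpa using h1

theorem IsAdaptedChange.eventually_snd_ne (hθ : IsAdaptedChange F G θ)
    (H : SwallowtailFrame G F N h m) :
    ∀ᶠ z in 𝓝[{x : Euc 2 | x 1 ≠ 0}] 0, θ z 1 ≠ 0 := by
  have hσ := hθ.fderiv_one_snd_sq H
  have h1 := (hθ.tendsto_inv H).eventually_ne
    (by intro h0; rw [h0] at hσ; norm_num at hσ : fderiv ℝ θ 0 (basisVec 1) 1 ≠ 0)
  filter_upwards [h1] with z hz h0
  rw [h0, div_zero] at hz
  exact hz rfl

theorem continuousAt_jacobian {z : Euc 2} (hθ : ContDiffAt ℝ ∞ θ z) :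
    ContDiffAt ℝ ∞ (jacobian θ) z := by
  unfold jacobian
  exact (((hθ.fderiv_apply_const _).coord _).mul ((hθ.fderiv_apply_const _).coord _)).sub
    (((hθ.fderiv_apply_const _).coord _).mul ((hθ.fderiv_apply_const _).coord _))

theorem IsAdaptedChange.eventually_jacobian_ne (hθ : IsAdaptedChange F G θ) :
    ∀ᶠ z in 𝓝 0, jacobian θ z ≠ 0 :=
  (continuousAt_jacobian hθ.smooth.self_of_nhds).continuousAt.eventually_ne hθ.jacobian_ne

theorem contDiff_nullDir : ContDiff ℝ ∞ (nullDir m) := by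
  refine contDiff_piLp' 2 fun i => ?_
  fin_cases i
  · exact contDiff_const
  · exact contDiff_const.mul (EuclideanSpace.proj (𝕜 := ℝ) (0 : Fin 2)).contDiff

theorem nullDir_zero : nullDir m 0 = basisVec 0 := by
  ext i; fin_cases i <;> simp [nullDir, basisVec]

theorem FrameAt.contDiffAt_bending {x : Euc 2} (H : FrameAt G F N h m x) {V : Euc 2 → Euc 3}
    {w : Euc 2 → Euc 2} (hV : ContDiffAt ℝ ∞ V x) (hw : ContDiffAt ℝ ∞ w x) :
    ContDiffAt ℝ ∞ (fun y => gInner G (F y) (V y) (covDeriv G F N y (w y))) x :=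
  ContDiffAt.gInner H.metric.self_of_nhds.contDiffAt H.smooth.self_of_nhds hV
    (H.metric.self_of_nhds.contDiffAt_covDeriv H.smooth.self_of_nhds H.smooth_normal.self_of_nhds hw)

/-- The limit of `2vH`. -/
theorem IsAdaptedChange.tendsto_meanCurvature (hθ : IsAdaptedChange F G θ)
    (H : SwallowtailFrame G F N h m) :
    Tendsto (fun z => 2 * (z 1 * meanCurvature G (F ∘ θ) (N ∘ θ) z))
      (𝓝[{x : Euc 2 | x 1 ≠ 0}] 0)
      (𝓝 (fderiv ℝ θ 0 (basisVec 1) 1 * (frameBending G F N h / frameGram G F h))) := by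
  have H0 := H.frameAt
  have hFx := H0.smooth.self_of_nhds
  have hA := contDiffAt_pderiv hFx 1
  have hh := H0.smooth_frame.self_of_nhds
  have hM := H0.metric.self_of_nhds.contDiffAt
  have hcoord : ContDiffAt ℝ ∞ (fun y : Euc 2 => y 1) 0 := contDiffAt_id.coord 1
  -- `hQ` concerns the smooth extension of 2vH in the frame coordinates; the remaining factor `z 1 /
  -- θ z 1` tends to the sign.
  have hQ := (((ContDiffAt.gInner hM hFx hA hA).mul
    (H0.contDiffAt_bending hh (contDiff_nullDir (m := m)).contDiffAt)).add
    (hcoord.mul (((ContDiffAt.gInner hM hFx hh hh).mul (H0.contDiffAt_bending hA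
    (contDiffAt_const (c := basisVec 1)))).sub ((contDiffAt_const (c := (2 : ℝ))).mul
    (ContDiffAt.gInner hM hFx hh hA) |>.mul (H0.contDiffAt_bending hh
    (contDiffAt_const (c := basisVec 1))))))).neg.div
    (ContDiffAt.gram hM hFx hh hA) H0.indep
  have hlim := ((hθ.tendsto_inv H).mul
    ((hQ.continuousAt.tendsto.comp hθ.tendsto).mono_left nhdsWithin_le_nhds))
  simp only [Pi.div_apply, nullDir_zero, H.norm_one, PiLp.zero_apply, zero_mul, add_zero,
    one_mul] at hlim
  refine hlim.congr' ?_
  filter_upwards [nhdsWithin_le_nhds (hθ.eventually_frameAt H), hθ.eventually_snd_ne H,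
    nhdsWithin_le_nhds hθ.eventually_jacobian_ne, nhdsWithin_le_nhds hθ.smooth] with z h1 h2 h3 h4
  rw [h1.meanCurvature_comp (h4.differentiableAt (by simp)) h3 h2]
  have := h1.indep
  simp only [Function.comp_apply, Pi.div_apply]
  field_simp

/-- The limit of `vK`. -/
theorem IsAdaptedChange.tendsto_gaussCurvature (hθ : IsAdaptedChange F G θ)
    (H : SwallowtailFrame G F N h m) :
    Tendsto (fun z => z 1 * gaussCurvature (firstForm G (F ∘ θ)) z)
      (𝓝[{x : Euc 2 | x 1 ≠ 0}] 0)
      (𝓝 (fderiv ℝ θ 0 (basisVec 1) 1 *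
        (frameBending G F N h * frameNormalCurvature G F N / frameGram G F h))) := by
  have H0 := H.frameAt
  have hFx := H0.smooth.self_of_nhds
  have hA := contDiffAt_pderiv hFx 1
  have hh := H0.smooth_frame.self_of_nhds
  have hM := H0.metric.self_of_nhds.contDiffAt
  have hθ0 := hθ.smooth.self_of_nhds
  have hcoord : ContDiffAt ℝ ∞ (fun y : Euc 2 => y 1) 0 := contDiffAt_id.coord 1
  have hQ := (((H0.contDiffAt_bending hh (contDiff_nullDir (m := m)).contDiffAt).mul
    (H0.contDiffAt_bending hA (contDiffAt_const (c := basisVec 1)))).sub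
    (hcoord.mul ((H0.contDiffAt_bending hh (contDiffAt_const (c := basisVec 1))).pow 2)))
  have hgr := ContDiffAt.gram hM hFx hh hA
  have hcomp : ∀ {W : Type} [NormedAddCommGroup W] [NormedSpace ℝ W] {f : Euc 2 → W},
      ContDiffAt ℝ ∞ f 0 → ContDiffAt ℝ ∞ (fun z => f (θ z)) 0 := by
    intro W _ _ f hf
    exact ContDiffAt.comp (g := f) (0 : Euc 2) (by rw [hθ.zero]; exact hf) hθ0
  have hFθ : ContDiffAt ℝ ∞ (F ∘ θ) 0 := hcomp hFx
  have H0' : FrameAt G F N h m (θ 0) := by rw [hθ.zero]; exact H0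
  -- The ambient curvature term: its last argument is ∂_u(F ∘ θ), zero at the origin, so it drops
  -- out of the limit.
  have hR := (ContDiffAt.gInner (F := fun z => F (θ z)) (by rw [hθ.zero]; exact hM) (hcomp hFx)
    (IsMetricAt.contDiffAt_curvatureForm (F := fun z => F (θ z)) H0'.metric.self_of_nhds (hcomp hFx) (hcomp hh) (hcomp hA)
      (contDiffAt_pderiv hFθ 1)) (contDiffAt_pderiv hFθ 0)).div
      (continuousAt_jacobian hθ0) hθ.jacobian_ne
  have hall := ((hcomp hQ).add hR).div (hcomp hgr) (by rw [hθ.zero]; exact H0.indep)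
  have hlim := ((hθ.tendsto_inv H).mul
    (hall.continuousAt.tendsto.mono_left nhdsWithin_le_nhds))
  simp only [Pi.div_apply, hθ.zero, nullDir_zero, hθ.pderiv_zero, gInner_zero_right, PiLp.zero_apply, zero_mul,
    add_zero, sub_zero, zero_div] at hlim
  have hval : frameBending G F N h * frameNormalCurvature G F N / frameGram G F h =
      gInner G (F 0) (h 0) (covDeriv G F N 0 (basisVec 0)) *
      gInner G (F 0) (pderiv 1 F 0) (covDeriv G F N 0 (basisVec 1)) /
      gram G (F 0) (h 0) (pderiv 1 F 0) := by
    simp only [frameBending, frameNormalCurvature, frameGram, neg_mul_neg]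
  rw [hval]
  refine hlim.congr' ?_
  filter_upwards [nhdsWithin_le_nhds (hθ.eventually_frameAt H), hθ.eventually_snd_ne H,
    nhdsWithin_le_nhds hθ.eventually_jacobian_ne, nhdsWithin_le_nhds hθ.smooth.eventually_nhds]
    with z h1 h2 h3 h4
  rw [h1.gaussCurvature_comp h4 h3 h2]
  have := h1.indep
  field_simp

/-- The limiting normal curvature in coordinates with `f_v = 0` at the swallowtail. -/
theorem SwallowtailFrame.normalCurvature_comp (H : SwallowtailFrame G F N h m)
    (hθ : ∀ᶠ z in 𝓝 (0 : Euc 2), ContDiffAt ℝ ∞ θ z) (h0 : θ 0 = 0) (hJ : jacobian θ 0 ≠ 0)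
    (hv : pderiv 1 (F ∘ θ) 0 = 0) :
    gInner G ((F ∘ θ) 0) (covDeriv G (F ∘ θ) (pderiv 0 (F ∘ θ)) 0 (basisVec 0)) ((N ∘ θ) 0) /
      gNorm G ((F ∘ θ) 0) (pderiv 0 (F ∘ θ) 0) ^ 2 = frameNormalCurvature G F N := by
  have H0 : FrameAt G F N h m (θ 0) := by rw [h0]; exact H.frameAt
  have hθ0 := hθ.self_of_nhds
  have hθd := hθ0.differentiableAt (by simp)
  have hFθ : ContDiffAt ℝ ∞ (F ∘ θ) 0 := H0.smooth.self_of_nhds.comp _ hθ0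
  have hNθ : ContDiffAt ℝ ∞ (N ∘ θ) 0 := H0.smooth_normal.self_of_nhds.comp _ hθ0
  have hM : IsMetricAt G ((F ∘ θ) 0) := H0.metric.self_of_nhds
  have hpd : (G ((F ∘ θ) 0)).PosDef := H0.posDef.self_of_nhds
  rw [gNorm_sq hpd, ← secondForm_apply hM hFθ (hNθ.differentiableAt (by simp))
    (H0.normal_comp hθ0 (hθ.mono fun y hy => hy.differentiableAt (by simp)))]
  rw [H0.pderiv_comp hθd, h0, H.fderiv_zero] at hv
  -- As f_v = 0, the image of ∂_v under dθ has no second component. Invertibility forces one on the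
  -- image of ∂_u, and its square cancels in the quotient.
  have hq1 := (smul_eq_zero.1 hv).resolve_right H.pderiv_one_ne
  have hq0 : fderiv ℝ θ 0 (basisVec 0) 1 ≠ 0 := by
    intro hq0; apply hJ; rw [jacobian, hq0, hq1]; ring
  simp only [secondForm, Matrix.of_apply, H0.pderiv_comp hθd, H0.covDeriv_normal_comp hθd,
    Function.comp_apply]
  have hs := H0.gInner_fderiv_covDeriv (fderiv ℝ θ 0 (basisVec 0)) (fderiv ℝ θ 0 (basisVec 0))
  rw [h0] at hs ⊢
  rw [hs, H.fderiv_zero, gInner_smul_left, gInner_smul_right, H.norm_one, frameNormalCurvature]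
  simp
  field_simp

theorem IsAdaptedChange.tendsto_det_firstForm (hθ : IsAdaptedChange F G θ)
    (H : SwallowtailFrame G F N h m) :
    Tendsto (fun z => (firstForm G (F ∘ θ) z).det / z 1 ^ 2) (𝓝[{x : Euc 2 | x 1 ≠ 0}] 0)
      (𝓝 (jacobian θ 0 ^ 2 * frameGram G F h)) := by
  have H0 := H.frameAt
  have hFx := H0.smooth.self_of_nhds
  have hgr := (ContDiffAt.gram H0.metric.self_of_nhds.contDiffAt hFx H0.smooth_frame.self_of_nhds
    (contDiffAt_pderiv hFx 1)).continuousAt.tendsto.comp hθ.tendsto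
  have hj := (continuousAt_jacobian hθ.smooth.self_of_nhds).continuousAt.tendsto
  have hlim := (((tendsto_div_snd hθ.smooth.self_of_nhds hθ.axis).pow 2).mul
    ((hj.pow 2).mono_left nhdsWithin_le_nhds)).mul (hgr.mono_left nhdsWithin_le_nhds)
  rw [hθ.fderiv_one_snd_sq H, one_mul] at hlim
  refine hlim.congr' ?_
  filter_upwards [nhdsWithin_le_nhds (hθ.eventually_frameAt H), nhdsWithin_le_nhds hθ.smooth]
    with z h1 h4
  rw [h1.det_firstForm_comp (h4.differentiableAt (by simp))]
  simp only [Function.comp_apply]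
  ring

theorem IsAdaptedChange.tendsto_firstForm_div (hθ : IsAdaptedChange F G θ)
    (H : SwallowtailFrame G F N h m) :
    Tendsto (fun t : ℝ => |firstForm G (F ∘ θ) (t • basisVec 0) 0 1 / t|) (𝓝[≠] 0)
      (𝓝 (|m| * jacobian θ 0 ^ 2)) := by
  have H0 := H.frameAt
  have hFx := H0.smooth.self_of_nhds
  have hθ0 := hθ.smooth.self_of_nhds
  have hM := H0.metric.self_of_nhds.contDiffAt
  have hσ := hθ.fderiv_one_snd_sq H
  have h01 := hθ.fderiv_zero_snd H
  have hline : Tendsto (fun t : ℝ => t • (basisVec 0 : Euc 2)) (𝓝[≠] 0) (𝓝 0) := by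
    have : Tendsto (fun t : ℝ => t • (basisVec 0 : Euc 2)) (𝓝 0) (𝓝 ((0 : ℝ) • basisVec 0)) :=
      (continuous_id.smul continuous_const).tendsto 0
    rw [zero_smul] at this
    exact this.mono_left nhdsWithin_le_nhds
  have hU : Tendsto (fun t : ℝ => θ (t • basisVec 0) 0 / t) (𝓝[≠] 0)
      (𝓝 (fderiv ℝ θ 0 (basisVec 0) 0)) := by
    have h1 : HasDerivAt (fun t : ℝ => θ (t • basisVec 0) 0) (fderiv ℝ θ 0 (basisVec 0) 0) 0 := by
      have h2 : HasDerivAt (fun t : ℝ => t • (basisVec 0 : Euc 2)) (basisVec 0) 0 := by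
        simpa using (hasDerivAt_id (0 : ℝ)).smul_const (basisVec 0 : Euc 2)
      have h3 : HasFDerivAt (fun z => θ z 0) ((EuclideanSpace.proj (𝕜 := ℝ) (0 : Fin 2)).comp
          (fderiv ℝ θ 0)) ((0 : ℝ) • (basisVec 0 : Euc 2)) := by
        rw [zero_smul]
        exact hasFDerivAt_coord (hθ0.differentiableAt (by simp)) 0
      exact h3.comp_hasDerivAt (0 : ℝ) h2
    have h4 := hasDerivAt_iff_tendsto_slope.1 h1
    refine h4.congr' ?_
    filter_upwards with t
    simp [slope_def_field, hθ.zero]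
  have hp : ∀ i j, Tendsto (fun z => fderiv ℝ θ z (basisVec i) j) (𝓝 0)
      (𝓝 (fderiv ℝ θ 0 (basisVec i) j)) := fun i j =>
    ((hθ0.fderiv_apply_const (basisVec i)).coord j).continuousAt.tendsto
  have hAA := (ContDiffAt.gInner hM hFx (contDiffAt_pderiv hFx 1)
    (contDiffAt_pderiv hFx 1)).continuousAt.tendsto.comp hθ.tendsto
  have hU0 : Tendsto (fun z => θ z 0) (𝓝 0) (𝓝 0) := by
    have := (hθ0.coord 0).continuousAt.tendsto
    simpa [hθ.zero] using this
  -- On the axis only F_v-components remain, so I₀₁ = -m θ₀ ∂₀θ₀ (∂₁θ₁ - m θ₀ ∂₁θ₀)|F_v|². At 0 the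
  -- Jacobian is ∂₀θ₀ ∂₁θ₁ with ∂₁θ₁ = ±1, hence the limit |m| J².
  have hlim := ((((hU.const_mul (-m)).mul ((hp 0 0).comp hline)).mul
    ((((hp 1 1).sub ((hU0.const_mul m).mul (hp 1 0)))).comp hline)).mul (hAA.comp hline)).abs
  have hval : |-m * fderiv ℝ θ 0 (basisVec 0) 0 * fderiv ℝ θ 0 (basisVec 0) 0 *
      (fderiv ℝ θ 0 (basisVec 1) 1 - m * 0 * fderiv ℝ θ 0 (basisVec 1) 0) *
      gInner G (F 0) (pderiv 1 F 0) (pderiv 1 F 0)| = |m| * jacobian θ 0 ^ 2 := by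
    have h1 : |fderiv ℝ θ 0 (basisVec 1) 1| = 1 := by
      rw [← Real.sqrt_sq_eq_abs, hσ, Real.sqrt_one]
    rw [H.norm_one, jacobian, h01]
    simp only [mul_zero, zero_mul, sub_zero, mul_one]
    rw [abs_mul, h1, mul_pow, hσ, abs_mul, abs_mul, abs_neg]
    rw [← sq_abs (fderiv ℝ θ 0 (basisVec 0) 0)]; ring
  rw [hval] at hlim
  refine hlim.congr' ?_
  -- Differentiating θ₁ = 0 along the axis gives ∂₀θ₁ = 0 at every axis point near 0.
  have hax : ∀ᶠ z in 𝓝 (0 : Euc 2), z 1 = 0 →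
      (θ z 1 = 0 ∧ fderiv ℝ θ z (basisVec 0) 1 = 0) := by
    filter_upwards [hθ.axis.eventually_nhds, hθ.smooth] with z hz hs hz1
    refine ⟨hz.self_of_nhds hz1, ?_⟩
    have h2 : HasDerivAt (fun t : ℝ => z + t • (basisVec 0 : Euc 2)) (basisVec 0) 0 := by
      simpa using ((hasDerivAt_id (0 : ℝ)).smul_const (basisVec 0 : Euc 2)).const_add z
    have h3 : HasFDerivAt (fun z => θ z 1) _ (z + (0 : ℝ) • (basisVec 0 : Euc 2)) :=
      hasFDerivAt_coord (by rw [zero_smul, add_zero]; exact hs.differentiableAt (by simp)) 1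
    have h4 := h3.comp_hasDerivAt (0 : ℝ) h2
    have h5 : Tendsto (fun t : ℝ => z + t • (basisVec 0 : Euc 2)) (𝓝 0) (𝓝 z) := by
      simpa using h2.continuousAt.tendsto
    have h6 : ((fun z => θ z 1) ∘ fun t : ℝ => z + t • (basisVec 0 : Euc 2)) =ᶠ[𝓝 0] fun _ => 0 := by
      filter_upwards [h5.eventually hz] with t ht
      exact ht (by simp [hz1, basisVec])
    have h7 := h4.unique ((hasDerivAt_const (0 : ℝ) (0 : ℝ)).congr_of_eventuallyEq h6)
    simpa using h7
  filter_upwards [hline.eventually (hθ.eventually_frameAt H), hline.eventually hθ.smooth,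
    hline.eventually hax] with t h1 h4 h5
  obtain ⟨h6, h7⟩ := h5 (by simp [basisVec])
  have hθd := h4.differentiableAt (by simp : (∞ : WithTop ℕ∞) ≠ 0)
  simp only [firstForm_apply, h1.pderiv_comp hθd, Function.comp_apply, h1.gInner_fderiv_fderiv,
    h6, h7]
  congr 1
  ring

end

/-! ### Singular and cuspidal curvature at points of the singular curve off the swallowtail. -/

section

variable {G : Euc 3 → Matrix (Fin 3) (Fin 3) ℝ} {F N h F' N' : Euc 2 → Euc 3} {m : ℝ}
  {θ : Euc 2 → Euc 2} {c : ℝ → Euc 2} {t : ℝ}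

theorem fderiv_eq_zero_of_jacobian_ne {z w : Euc 2} (hJ : jacobian θ z ≠ 0)
    (h0 : fderiv ℝ θ z w = 0) : w = 0 := by
  rw [euc_two_eq w, map_add, map_smul, map_smul] at h0
  have e0 : w 0 * fderiv ℝ θ z (basisVec 0) 0 + w 1 * fderiv ℝ θ z (basisVec 1) 0 = 0 := by
    simpa using congrArg (fun v : Euc 2 => v 0) h0
  have e1 : w 0 * fderiv ℝ θ z (basisVec 0) 1 + w 1 * fderiv ℝ θ z (basisVec 1) 1 = 0 := by
    simpa using congrArg (fun v : Euc 2 => v 1) h0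
  have hw0 : jacobian θ z * w 0 = 0 := by
    rw [jacobian]
    linear_combination fderiv ℝ θ z (basisVec 1) 1 * e0 - fderiv ℝ θ z (basisVec 1) 0 * e1
  have hw1 : jacobian θ z * w 1 = 0 := by
    rw [jacobian]
    linear_combination fderiv ℝ θ z (basisVec 0) 0 * e1 - fderiv ℝ θ z (basisVec 0) 1 * e0
  ext i
  fin_cases i
  · exact (mul_eq_zero.1 hw0).resolve_left hJ
  · exact (mul_eq_zero.1 hw1).resolve_left hJ

theorem eq_zero_of_coord {w : Euc 2} (h0 : w 0 = 0) (h1 : w 1 = 0) : w = 0 := by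
  ext i; fin_cases i <;> assumption

/-- A chart change `θ` to coordinates in which the singular curve `c` becomes a part of the
`u`-axis. -/
structure IsAxisChange (F F' N N' : Euc 2 → Euc 3) (θ : Euc 2 → Euc 2) (c : ℝ → Euc 2)
    (t : ℝ) : Prop where
  smooth : ∀ᶠ z in 𝓝 (c t), ContDiffAt ℝ ∞ θ z
  smooth_curve : ContDiffAt ℝ ∞ c t
  jacobian_ne : jacobian θ (c t) ≠ 0
  axis : ∀ᶠ s in 𝓝 t, θ (c s) 1 = 0
  fst_ne : θ (c t) 0 ≠ 0
  eq_comp : F' =ᶠ[𝓝 (c t)] F ∘ θ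
  normal_eq_comp : N' =ᶠ[𝓝 (c t)] N ∘ θ

namespace IsAxisChange

theorem axis_self (K : IsAxisChange F F' N N' θ c t) : θ (c t) 1 = 0 := K.axis.self_of_nhds

theorem smooth_comp (K : IsAxisChange F F' N N' θ c t) : ContDiffAt ℝ ∞ (θ ∘ c) t :=
  K.smooth.self_of_nhds.comp t K.smooth_curve

theorem deriv_comp_snd (K : IsAxisChange F F' N N' θ c t) :
    ∀ᶠ s in 𝓝 t, deriv (θ ∘ c) s 1 = 0 := by
  have hd : ∀ᶠ s in 𝓝 t, DifferentiableAt ℝ (θ ∘ c) s := by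
    have : ContDiffAt ℝ 1 (θ ∘ c) t := K.smooth_comp.of_le (by simp)
    exact (this.eventually (by simp)).mono fun s hs => hs.differentiableAt (by simp)
  filter_upwards [hd, K.axis.eventually_nhds] with s h1 h2
  have h3 : HasDerivAt (fun s => (θ ∘ c) s 1) (deriv (θ ∘ c) s 1) s :=
    (EuclideanSpace.proj (𝕜 := ℝ) (1 : Fin 2)).hasFDerivAt.comp_hasDerivAt s h1.hasDerivAt
  exact h3.unique ((hasDerivAt_const s (0 : ℝ)).congr_of_eventuallyEq h2)

theorem deriv_comp (K : IsAxisChange F F' N N' θ c t) :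
    deriv (θ ∘ c) t = fderiv ℝ θ (c t) (deriv c t) :=
  ((K.smooth.self_of_nhds.differentiableAt (by simp)).hasFDerivAt.comp_hasDerivAt t
    (K.smooth_curve.differentiableAt (by simp)).hasDerivAt).deriv

theorem deriv_comp_fst_ne (K : IsAxisChange F F' N N' θ c t) (hc : deriv c t ≠ 0) :
    deriv (θ ∘ c) t 0 ≠ 0 := by
  intro h0
  have h1 := eq_zero_of_coord h0 K.deriv_comp_snd.self_of_nhds
  rw [K.deriv_comp] at h1
  exact hc (fderiv_eq_zero_of_jacobian_ne K.jacobian_ne h1)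

theorem comp_eq (K : IsAxisChange F F' N N' θ c t) : F' ∘ c =ᶠ[𝓝 t] F ∘ (θ ∘ c) :=
  K.smooth_curve.continuousAt.eventually K.eq_comp

/-- On the axis F_u = -m u F_v, so the image curve has velocity -m u u' F_v. -/
theorem deriv_image (K : IsAxisChange F F' N N' θ c t) (H : FrameAt G F N h m (θ (c t))) :
    deriv (F' ∘ c) =ᶠ[𝓝 t] fun s =>
      (-(m * θ (c s) 0 * deriv (θ ∘ c) s 0)) • (pderiv 1 F ∘ (θ ∘ c)) s := by
  have hd : ∀ᶠ s in 𝓝 t, DifferentiableAt ℝ (θ ∘ c) s := by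
    have : ContDiffAt ℝ 1 (θ ∘ c) t := K.smooth_comp.of_le (by simp)
    exact (this.eventually (by simp)).mono fun s hs => hs.differentiableAt (by simp)
  filter_upwards [hd, K.axis, K.deriv_comp_snd, K.comp_eq.eventuallyEq_nhds,
    K.smooth_comp.continuousAt.eventually H.eventually] with s h1 h2 h3 h4 h5
  rw [h4.deriv_eq, ((h5.smooth.self_of_nhds.differentiableAt
    (by simp)).hasFDerivAt.comp_hasDerivAt s h1.hasDerivAt).deriv, h5.fderiv_eq, h3]
  simp only [Function.comp_apply, h2]
  simp

/-- The coefficient `r` stays unspecified: it disappears from det(ĉ', ĉ'', N) because ĉ' is itself a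
multiple of F_v. -/
theorem covDeriv_deriv_image (K : IsAxisChange F F' N N' θ c t)
    (H : FrameAt G F N h m (θ (c t))) :
    ∃ r : ℝ, covDeriv G (F' ∘ c) (deriv (F' ∘ c)) t 1 = r • pderiv 1 F (θ (c t)) +
      (-(m * θ (c t) 0 * deriv (θ ∘ c) t 0) * deriv (θ ∘ c) t 0) •
        covDeriv G F (pderiv 1 F) (θ (c t)) (basisVec 0) := by
  have hdd : ContDiffAt ℝ ∞ (deriv (θ ∘ c)) t := by
    have := K.smooth_comp.fderiv_apply_const (1 : ℝ)
    exact this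
  have hr : ContDiffAt ℝ ∞ (fun s => -(m * θ (c s) 0 * deriv (θ ∘ c) s 0)) t :=
    ((contDiffAt_const.mul (K.smooth_comp.coord 0)).mul (hdd.coord 0)).neg
  have hF := H.smooth.self_of_nhds
  have hA : DifferentiableAt ℝ (pderiv 1 F) (θ (c t)) :=
    (contDiffAt_pderiv hF 1).differentiableAt (by simp)
  have hAc : DifferentiableAt ℝ (pderiv 1 F ∘ (θ ∘ c)) t :=
    DifferentiableAt.comp t hA (K.smooth_comp.differentiableAt (by simp))
  refine ⟨fderiv ℝ (fun s => -(m * θ (c s) 0 * deriv (θ ∘ c) s 0)) t 1,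
    (covDeriv_congr K.comp_eq (K.deriv_image H) 1).trans ?_⟩
  rw [covDeriv_smul (hr.differentiableAt (by simp)) hAc,
    covDeriv_comp (F := F) (V := pderiv 1 F) (θ := θ ∘ c) (hF.differentiableAt (by simp)) hA
      (K.smooth_comp.differentiableAt (by simp))]
  have h1 : fderiv ℝ (θ ∘ c) t 1 = deriv (θ ∘ c) t 0 • (basisVec 0 : Euc 2) := by
    have h2 : fderiv ℝ (θ ∘ c) t 1 = deriv (θ ∘ c) t := rfl
    rw [h2]
    conv_lhs => rw [euc_two_eq (deriv (θ ∘ c) t), K.deriv_comp_snd.self_of_nhds]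
    simp
  rw [h1, covDeriv_smul_dir, smul_smul]
  rfl

/-- On the axis dF only sees the F_v-component, and F_v ≠ 0, so null vectors are multiples of (1, m
u) in the frame coordinates. -/
theorem fderiv_null (K : IsAxisChange F F' N N' θ c t) (H : FrameAt G F N h m (θ (c t)))
    {w : Euc 2} (hw : fderiv ℝ F' (c t) w = 0) :
    fderiv ℝ θ (c t) w 1 = m * θ (c t) 0 * fderiv ℝ θ (c t) w 0 := by
  rw [K.eq_comp.fderiv_eq, fderiv_comp _ (H.smooth.self_of_nhds.differentiableAt (by simp))
    (K.smooth.self_of_nhds.differentiableAt (by simp)), ContinuousLinearMap.comp_apply,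
    H.fderiv_eq, K.axis_self, mul_zero, zero_smul, zero_add] at hw
  have hA : pderiv 1 F (θ (c t)) ≠ 0 := by
    intro h0; apply H.indep; simp [gram, h0, gInner_zero_right]
  have := (smul_eq_zero.1 hw).resolve_right hA
  linarith

theorem fderiv_null_fst_ne (K : IsAxisChange F F' N N' θ c t) (H : FrameAt G F N h m (θ (c t)))
    {w : Euc 2} (hw : fderiv ℝ F' (c t) w = 0) (hw0 : w ≠ 0) :
    fderiv ℝ θ (c t) w 0 ≠ 0 := by
  intro h0
  have h1 := K.fderiv_null H hw
  rw [h0, mul_zero] at h1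
  exact hw0 (fderiv_eq_zero_of_jacobian_ne K.jacobian_ne (eq_zero_of_coord h0 h1))

end IsAxisChange

theorem ContDiffAt.gDet {D : Type*} [NormedAddCommGroup D] [NormedSpace ℝ D]
    {F A B C : D → Euc 3} {x : D}
    (hG : ∀ i j, ContDiffAt ℝ ∞ (fun z => G z i j) (F x)) (hd : (G (F x)).det ≠ 0)
    (hF : ContDiffAt ℝ ∞ F x) (hA : ContDiffAt ℝ ∞ A x) (hB : ContDiffAt ℝ ∞ B x)
    (hC : ContDiffAt ℝ ∞ C x) :
    ContDiffAt ℝ ∞ (fun z => gDet G (F z) (A z) (B z) (C z)) x := by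
  refine ContDiffAt.mul (ContDiffAt.sqrt ((ContDiffAt.matrix_det hG).comp x hF) hd)
    (ContDiffAt.matrix_det fun i j => ?_)
  fin_cases i <;> fin_cases j
  · exact hA.coord 0
  · exact hA.coord 1
  · exact hA.coord 2
  · exact hB.coord 0
  · exact hB.coord 1
  · exact hB.coord 2
  · exact hC.coord 0
  · exact hC.coord 1
  · exact hC.coord 2

theorem areaDensity_congr {x : Euc 2} (hF : F =ᶠ[𝓝 x] F') (hN : N =ᶠ[𝓝 x] N') :
    areaDensity G F N =ᶠ[𝓝 x] areaDensity G F' N' := by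
  filter_upwards [hF, hN, hF.pderiv 0, hF.pderiv 1] with z h1 h2 h3 h4
  simp only [areaDensity, h1, h2, h3, h4]

theorem FrameAt.areaDensity_comp {z : Euc 2} (H : FrameAt G F N h m (θ z))
    (hθ : DifferentiableAt ℝ θ z) : areaDensity G (F ∘ θ) (N ∘ θ) z =
      θ z 1 * (jacobian θ z * gDet G (F (θ z)) (h (θ z)) (pderiv 1 F (θ z)) (N (θ z))) := by
  rw [areaDensity, H.pderiv_comp hθ, H.pderiv_comp hθ, H.fderiv_eq, H.fderiv_eq]
  simp only [gDet_add_left, gDet_add_mid, gDet_smul_left, gDet_smul_mid, gDet_self_left,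
    Function.comp_apply, gDet_swap_left (h (θ z)), jacobian]
  ring

theorem IsPositiveFrame.ne_zero {a b : Euc 2} (hp : IsPositiveFrame a b) : a ≠ 0 ∧ b ≠ 0 := by
  constructor <;> rintro rfl <;> simp [IsPositiveFrame] at hp

theorem FrameAt.gDet_frame_ne {x : Euc 2} (H : FrameAt G F N h m x) :
    gDet G (F x) (h x) (pderiv 1 F x) (N x) ≠ 0 := by
  intro h0
  have := gDet_normal_sq H.posDef.self_of_nhds H.normal_frame.self_of_nhds
    (H.normal.self_of_nhds (basisVec 1)) H.unit.self_of_nhds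
  apply H.indep
  rw [pderiv, ← this]
  rw [pderiv] at h0
  rw [h0]; ring

/-- λ is θ₁ times a nonvanishing function, so on the axis dλ(w) is a nonzero multiple of dθ₁(w) = m
u dθ₀(w), which is nonzero for a null vector w ≠ 0. Hence sgn(dλ(η)) = ±1 and is invisible in |κ_s|.
-/
theorem IsAxisChange.fderiv_areaDensity_ne (K : IsAxisChange F F' N N' θ c t)
    (H : FrameAt G F N h m (θ (c t))) (hm : m ≠ 0) {w : Euc 2} (hw : fderiv ℝ F' (c t) w = 0)
    (hw0 : w ≠ 0) : fderiv ℝ (areaDensity G F' N') (c t) w ≠ 0 := by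
  have hθ := K.smooth.self_of_nhds
  have hF := H.smooth.self_of_nhds
  have h1 : areaDensity G F' N' =ᶠ[𝓝 (c t)] fun z => θ z 1 *
      (jacobian θ z * gDet G (F (θ z)) (h (θ z)) (pderiv 1 F (θ z)) (N (θ z))) := by
    refine (areaDensity_congr K.eq_comp K.normal_eq_comp).trans ?_
    filter_upwards [K.smooth, hθ.continuousAt.eventually H.eventually] with z h1 h2
    exact h2.areaDensity_comp (h1.differentiableAt (by simp))
  have h2 : ContDiffAt ℝ ∞ (fun z => jacobian θ z *
      gDet G (F (θ z)) (h (θ z)) (pderiv 1 F (θ z)) (N (θ z))) (c t) := by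
    refine (continuousAt_jacobian hθ).mul ?_
    exact ContDiffAt.comp (g := fun y => _root_.gDet G (F y) (h y) (pderiv 1 F y) (N y)) (c t)
      (ContDiffAt.gDet H.metric.self_of_nhds.contDiffAt H.metric.self_of_nhds.det_ne hF
        H.smooth_frame.self_of_nhds (contDiffAt_pderiv hF 1) H.smooth_normal.self_of_nhds) hθ
  have h3 := (hasFDerivAt_coord (hθ.differentiableAt (by simp)) 1).mul
    (h2.differentiableAt (by simp)).hasFDerivAt
  have h4 := h3.congr_of_eventuallyEq h1
  rw [h4.fderiv, K.axis_self]
  have h5 := K.fderiv_null_fst_ne H hw hw0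
  have h6 := K.fderiv_null H hw
  have h7 := H.gDet_frame_ne
  have h8 := K.fst_ne
  have h9 := K.jacobian_ne
  simp [h6, h5, h7, h8, h9, hm]

/-- The absolute value of the singular curvature. -/
theorem IsAxisChange.abs_singularCurvature (K : IsAxisChange F F' N N' θ c t)
    (H : FrameAt G F N h m (θ (c t))) (hm : m ≠ 0) {k : ℝ}
    (hk : IsSingularCurvatureAt G F' N' c t k) :
    |k| = |gDet G (F (θ (c t))) (pderiv 1 F (θ (c t)))
        (covDeriv G F (pderiv 1 F) (θ (c t)) (basisVec 0)) (N (θ (c t)))| /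
      (|m| * |θ (c t) 0| * gNorm G (F (θ (c t))) (pderiv 1 F (θ (c t))) ^ 3) := by
  obtain ⟨η, hη, hpos, rfl⟩ := hk
  obtain ⟨hc0, hη0⟩ := hpos.ne_zero
  have hu := K.deriv_comp_fst_ne hc0
  have hu0 := K.fst_ne
  have hsgn : |Real.sign (fderiv ℝ (areaDensity G F' N') (c t) η)| = 1 := by
    rcases Real.sign_apply_eq_of_ne_zero _ (K.fderiv_areaDensity_ne H hm hη hη0) with h1 | h1 <;>
      simp [h1]
  obtain ⟨r, hr⟩ := K.covDeriv_deriv_image H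
  have hd := (K.deriv_image H).self_of_nhds
  simp only [Function.comp_apply] at hd
  have hN : N' (c t) = N (θ (c t)) := K.normal_eq_comp.self_of_nhds
  have hF : F' (c t) = F (θ (c t)) := K.eq_comp.self_of_nhds
  have hA : 0 < gNorm G (F (θ (c t))) (pderiv 1 F (θ (c t))) := by
    refine gNorm_pos H.posDef.self_of_nhds ?_
    intro h0; apply H.indep; simp [gram, h0, gInner_zero_right]
  rw [hr, hd, hN, hF, gNorm_smul, abs_div, abs_mul, hsgn, one_mul, abs_pow, abs_mul, abs_abs,
    abs_of_pos hA, abs_neg, abs_mul, abs_mul]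
  simp only [gDet_smul_left, gDet_add_mid, gDet_smul_mid, gDet_self_left, abs_mul, abs_neg,
    mul_zero, zero_add]
  field_simp

/-- Two derivatives of a field which vanishes at a point, in terms of a frame. -/
theorem covAlong_covAlong {P A B : Euc 2 → Euc 3} {η : Euc 2 → Euc 2} {V : Euc 2 → Euc 3}
    {a b : Euc 2 → ℝ} {x : Euc 2} (hG : ∀ᶠ z in 𝓝 x, IsMetricAt G (P z))
    (hP : ∀ᶠ z in 𝓝 x, ContDiffAt ℝ ∞ P z) (hA : ∀ᶠ z in 𝓝 x, ContDiffAt ℝ ∞ A z)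
    (hB : ∀ᶠ z in 𝓝 x, ContDiffAt ℝ ∞ B z) (hη : ∀ᶠ z in 𝓝 x, ContDiffAt ℝ ∞ η z)
    (ha : ∀ᶠ z in 𝓝 x, ContDiffAt ℝ ∞ a z) (hb : ∀ᶠ z in 𝓝 x, ContDiffAt ℝ ∞ b z)
    (hV : V =ᶠ[𝓝 x] fun z => a z • A z + b z • B z) (hax : a x = 0) (hbx : b x = 0) :
    covAlong G P η V x = fderiv ℝ a x (η x) • A x + fderiv ℝ b x (η x) • B x ∧
    ∃ a' b' : ℝ, covAlong G P η (covAlong G P η V) x = a' • A x + b' • B x +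
      (2 * fderiv ℝ a x (η x)) • covDeriv G P A x (η x) +
      (2 * fderiv ℝ b x (η x)) • covDeriv G P B x (η x) := by
  have h1 : covAlong G P η V =ᶠ[𝓝 x] fun z =>
      (fderiv ℝ a z (η z) • A z + a z • covDeriv G P A z (η z)) +
      (fderiv ℝ b z (η z) • B z + b z • covDeriv G P B z (η z)) := by
    filter_upwards [hA, hB, ha, hb, hV.eventuallyEq_nhds] with z h1 h2 h3 h4 h5
    have e1 := h1.differentiableAt (by simp : (∞ : WithTop ℕ∞) ≠ 0)
    have e2 := h2.differentiableAt (by simp : (∞ : WithTop ℕ∞) ≠ 0)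
    have e3 := h3.differentiableAt (by simp : (∞ : WithTop ℕ∞) ≠ 0)
    have e4 := h4.differentiableAt (by simp : (∞ : WithTop ℕ∞) ≠ 0)
    rw [covAlong, covDeriv_congr (EventuallyEq.refl _ _) h5,
      covDeriv_add (e3.fun_smul e1) (e4.fun_smul e2), covDeriv_smul e3 e1, covDeriv_smul e4 e2]
  -- Since a and b vanish at x, a second differentiation meets a'∇A and b'∇B twice each. The second
  -- derivatives of the coefficients only multiply A and B, which are orthogonal to N in the
  -- application.
  refine ⟨by rw [h1.self_of_nhds]; simp [hax, hbx], ?_⟩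
  have hηx := hη.self_of_nhds
  have hdda := ha.self_of_nhds.fderiv_apply_field hηx
  have hddb := hb.self_of_nhds.fderiv_apply_field hηx
  have hddA := hG.self_of_nhds.contDiffAt_covDeriv hP.self_of_nhds hA.self_of_nhds hηx
  have hddB := hG.self_of_nhds.contDiffAt_covDeriv hP.self_of_nhds hB.self_of_nhds hηx
  have hAd := hA.self_of_nhds.differentiableAt (by simp : (∞ : WithTop ℕ∞) ≠ 0)
  have hBd := hB.self_of_nhds.differentiableAt (by simp : (∞ : WithTop ℕ∞) ≠ 0)
  have had := ha.self_of_nhds.differentiableAt (by simp : (∞ : WithTop ℕ∞) ≠ 0)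
  have hbd := hb.self_of_nhds.differentiableAt (by simp : (∞ : WithTop ℕ∞) ≠ 0)
  have hda := hdda.differentiableAt (by simp : (∞ : WithTop ℕ∞) ≠ 0)
  have hdb := hddb.differentiableAt (by simp : (∞ : WithTop ℕ∞) ≠ 0)
  have hdA := hddA.differentiableAt (by simp : (∞ : WithTop ℕ∞) ≠ 0)
  have hdB := hddB.differentiableAt (by simp : (∞ : WithTop ℕ∞) ≠ 0)
  refine ⟨fderiv ℝ (fun z => fderiv ℝ a z (η z)) x (η x),
    fderiv ℝ (fun z => fderiv ℝ b z (η z)) x (η x), ?_⟩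
  rw [covAlong, covDeriv_congr (EventuallyEq.refl _ _) h1,
    covDeriv_add ((hda.fun_smul hAd).fun_add (had.fun_smul hdA))
      ((hdb.fun_smul hBd).fun_add (hbd.fun_smul hdB)),
    covDeriv_add (hda.fun_smul hAd) (had.fun_smul hdA),
    covDeriv_add (hdb.fun_smul hBd) (hbd.fun_smul hdB),
    covDeriv_smul hda hAd, covDeriv_smul had hdA, covDeriv_smul hdb hBd, covDeriv_smul hbd hdB,
    hax, hbx]
  simp only [zero_smul, add_zero, two_mul, add_smul]
  abel

theorem rpow_half_nat {x : ℝ} (hx : 0 ≤ x) (n : ℕ) : x ^ ((n : ℝ) / 2) = √x ^ n := by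
  rw [Real.sqrt_eq_rpow, ← Real.rpow_natCast, ← Real.rpow_mul hx]
  congr 1; ring

/-- The absolute value of the cuspidal curvature. -/
theorem IsAxisChange.abs_cuspidalCurvature (K : IsAxisChange F F' N N' θ c t)
    (H : FrameAt G F N h m (θ (c t))) (hm : m ≠ 0) {k : ℝ}
    (hk : IsCuspidalCurvatureAt G F' c t k) :
    |k| = 2 * √(gNorm G (F (θ (c t))) (pderiv 1 F (θ (c t)))) ^ 3 *
        |gInner G (F (θ (c t))) (h (θ (c t)))
          (covDeriv G F N (θ (c t)) (nullDir m (θ (c t))))| /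
      (√(|m| * |θ (c t) 0|) *
        √√(gram G (F (θ (c t))) (h (θ (c t))) (pderiv 1 F (θ (c t)))) ^ 3) := by
  obtain ⟨η, hη, hnull, hpos, rfl⟩ := hk
  obtain ⟨hc0, hη0⟩ := hpos.ne_zero
  have hη' := hη.self_of_nhds
  have hn := hnull.self_of_nhds
  have hu := K.deriv_comp_fst_ne hc0
  have hu0 := K.fst_ne
  have hζ0 := K.fderiv_null_fst_ne H hn hη0
  have hζ1 := K.fderiv_null H hn
  have hθ := K.smooth.self_of_nhds
  have hθd : DifferentiableAt ℝ θ (c t) := hθ.differentiableAt (by simp)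
  have hF := H.smooth.self_of_nhds
  have hFd : DifferentiableAt ℝ F (θ (c t)) := hF.differentiableAt (by simp)
  have hAc := contDiffAt_pderiv hF 1
  have hpd := H.posDef.self_of_nhds
  have hd := (K.deriv_image H).self_of_nhds
  simp only [Function.comp_apply] at hd
  have hFx : F' (c t) = F (θ (c t)) := K.eq_comp.self_of_nhds
  have hHev := hθ.continuousAt.eventually H.eventually
  -- On the axis v = 0, so symmetry of the second form gives ⟨F_v, ∇_X N⟩ = 0, and the null vector
  -- is a multiple of X.
  have hNη : gInner G (F (θ (c t))) (pderiv 1 F (θ (c t)))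
      (covDeriv G F N (θ (c t)) (fderiv ℝ θ (c t) (η (c t)))) = 0 := by
    have := H.gInner_fderiv_covDeriv (basisVec 1) (fderiv ℝ θ (c t) (η (c t)))
    rw [pderiv, this, K.axis_self, hζ1]
    simp [basisVec]
  -- Differentiating ⟨F_v, N⟩ = 0, and below ⟨h, N⟩ = 0, moves derivatives of the frame onto N.
  have hNA : gInner G (F (θ (c t))) (covDeriv G F (pderiv 1 F) (θ (c t))
      (fderiv ℝ θ (c t) (η (c t)))) (N (θ (c t))) = 0 := by
    have h1 := H.metric.self_of_nhds.fderiv_gInner hFd (hAc.differentiableAt (by simp))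
      (H.smooth_normal.self_of_nhds.differentiableAt (by simp)) (fderiv ℝ θ (c t) (η (c t)))
    have h2 : (fun z => gInner G (F z) (pderiv 1 F z) (N z)) =ᶠ[𝓝 (θ (c t))] fun _ => 0 :=
      H.normal.mono fun z hz => hz _
    rw [h2.fderiv_eq, hNη] at h1
    simpa using h1.symm
  have hNh : gInner G (F (θ (c t))) (covDeriv G F h (θ (c t)) (fderiv ℝ θ (c t) (η (c t))))
      (N (θ (c t))) = -(fderiv ℝ θ (c t) (η (c t)) 0 *
        gInner G (F (θ (c t))) (h (θ (c t))) (covDeriv G F N (θ (c t)) (nullDir m (θ (c t))))) := by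
    have h1 := H.metric.self_of_nhds.fderiv_gInner hFd
      (H.smooth_frame.self_of_nhds.differentiableAt (by simp))
      (H.smooth_normal.self_of_nhds.differentiableAt (by simp)) (fderiv ℝ θ (c t) (η (c t)))
    have h2 : (fun z => gInner G (F z) (h z) (N z)) =ᶠ[𝓝 (θ (c t))] fun _ => 0 := H.normal_frame
    rw [h2.fderiv_eq, covDeriv_eq_nullDir (m := m) (V := N), hζ1, gInner_add_right,
      gInner_smul_right, gInner_smul_right] at h1
    simp only [fderiv_fun_const, Pi.zero_apply, zero_apply] at h1
    linarith
  let ζ : Euc 2 → Euc 2 := fun z => fderiv ℝ θ z (η z)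
  have hζ : ∀ᶠ z in 𝓝 (c t), ContDiffAt ℝ ∞ ζ z := by
    filter_upwards [K.smooth, hη] with z h1 h2 using h1.fderiv_apply_field h2
  have hF' : ∀ᶠ z in 𝓝 (c t), ContDiffAt ℝ ∞ F' z := by
    filter_upwards [K.eq_comp.eventuallyEq_nhds, hHev, K.smooth] with z h1 h2 h3
    exact (h2.smooth.self_of_nhds.comp z h3).congr_of_eventuallyEq h1
  -- With ζ = dθ(η), df(η) = ζ₀θ₁ h + (ζ₁ - m θ₀ ζ₀) F_v. Both coefficients vanish at `c t`, where η
  -- is null.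
  obtain ⟨h1, a', b', h2⟩ := covAlong_covAlong (G := G) (P := F') (A := h ∘ θ)
    (B := pderiv 1 F ∘ θ) (η := η) (V := fun z => fderiv ℝ F' z (η z))
    (a := fun z => ζ z 0 * θ z 1) (b := fun z => ζ z 1 - m * θ z 0 * ζ z 0) (x := c t)
    (by filter_upwards [K.eq_comp, hHev] with z h1 h2
        rw [h1]; exact h2.metric.self_of_nhds) hF'
    (by filter_upwards [K.smooth, hHev] with z h1 h2
        exact h2.smooth_frame.self_of_nhds.comp z h1)
    (by filter_upwards [K.smooth, hHev] with z h1 h2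
        exact (contDiffAt_pderiv h2.smooth.self_of_nhds 1).comp z h1) hη
    (by filter_upwards [K.smooth, hζ] with z h1 h2
        exact (h2.coord 0).mul (h1.coord 1))
    (by filter_upwards [K.smooth, hζ] with z h1 h2
        exact (h2.coord 1).sub ((contDiffAt_const.mul (h1.coord 0)).mul (h2.coord 0)))
    (by filter_upwards [K.smooth, hHev, K.eq_comp.eventuallyEq_nhds] with z h1 h2 h3
        simp only [h3.fderiv_eq]
        rw [fderiv_comp z (h2.smooth.self_of_nhds.differentiableAt (by simp))
          (h1.differentiableAt (by simp)), ContinuousLinearMap.comp_apply, h2.fderiv_eq]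
        rfl)
    (by simp only [K.axis_self, mul_zero]) (by simp only [ζ, hζ1, sub_self])
  -- Only the factor θ₁ needs differentiating, since it vanishes here; its derivative along η is m
  -- θ₀ ζ₀.
  have hDα : fderiv ℝ (fun z => ζ z 0 * θ z 1) (c t) (η (c t)) =
      ζ (c t) 0 ^ 2 * (m * θ (c t) 0) := by
    have e1 := (hasFDerivAt_coord (hζ.self_of_nhds.differentiableAt (by simp)) 0).mul
      (hasFDerivAt_coord hθd 1)
    have e2 : HasFDerivAt (fun z => ζ z 0 * θ z 1) _ (c t) := e1
    rw [e2.fderiv, K.axis_self]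
    simp [hζ1, ζ]
    ring
  have hcomp : ∀ {V : Euc 2 → Euc 3}, DifferentiableAt ℝ V (θ (c t)) →
      covDeriv G F' (V ∘ θ) (c t) (η (c t)) = covDeriv G F V (θ (c t)) (ζ (c t)) := by
    intro V hV
    rw [covDeriv_congr K.eq_comp (EventuallyEq.refl _ _), covDeriv_comp hFd hV hθd]
  rw [hcomp (H.smooth_frame.self_of_nhds.differentiableAt (by simp)),
    hcomp (hAc.differentiableAt (by simp))] at h2
  rw [hDα] at h1 h2
  set b₁ := fderiv ℝ (fun z => ζ z 1 - m * θ z 0 * ζ z 0) (c t) (η (c t))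
  set V1 := covAlong G F' η (fun z => fderiv ℝ F' z (η z)) (c t)
  set V2 := covAlong G F' η (covAlong G F' η fun z => fderiv ℝ F' z (η z)) (c t)
  set q := gram G (F (θ (c t))) (h (θ (c t))) (pderiv 1 F (θ (c t))) with hq
  set A := pderiv 1 F (θ (c t)) with hAdef
  set B := h (θ (c t)) with hBdef
  set bend := gInner G (F (θ (c t))) B (covDeriv G F N (θ (c t)) (nullDir m (θ (c t)))) with hbend
  set r := -(m * θ (c t) 0 * deriv (θ ∘ c) t 0) with hr
  have hr0 : r ≠ 0 := by rw [hr]; simp [hm, hu, hu0]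
  set Z := ζ (c t) 0 with hZ
  have hZ0 : Z ≠ 0 := hζ0
  have hsym := gInner_comm H.metric.self_of_nhds.symm_self
  have hq0 : 0 < q := by
    have := gDet_normal_sq hpd H.normal_frame.self_of_nhds
      (H.normal.self_of_nhds (basisVec 1)) H.unit.self_of_nhds
    have h3 : 0 ≤ q := by rw [hq, hAdef, pderiv, ← this]; positivity
    exact lt_of_le_of_ne h3 (Ne.symm H.indep)
  have hA0 : A ≠ 0 := by
    intro h0; apply H.indep; rw [← hAdef, h0]; simp [gram, gInner_zero_right]
  -- The F_v-component `b₁` of f_ηη, which depends on how η is extended, drops out because the other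
  -- vector is parallel to F_v.
  have hgram : gram G (F (θ (c t))) (r • A) V1 = r ^ 2 * (Z ^ 2 * (m * θ (c t) 0)) ^ 2 * q := by
    rw [h1, gram, hq, gram]
    simp only [Function.comp_apply, ← hAdef, ← hBdef, gInner_add_left, gInner_add_right,
      gInner_smul_left, gInner_smul_right, hsym A B]
    ring
  have hgram0 : gram G (F (θ (c t))) (r • A) V1 ≠ 0 := by
    rw [hgram]; positivity
  have hAN : gInner G (F (θ (c t))) A (N (θ (c t))) = 0 := H.normal.self_of_nhds (basisVec 1)
  have hBN : gInner G (F (θ (c t))) B (N (θ (c t))) = 0 := H.normal_frame.self_of_nhds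
  have hrA : gInner G (F (θ (c t))) (r • A) (N (θ (c t))) = 0 := by
    rw [gInner_smul_left, hAN, mul_zero]
  have hV1 : gInner G (F (θ (c t))) V1 (N (θ (c t))) = 0 := by
    rw [h1, gInner_add_left, gInner_smul_left, gInner_smul_left]
    simp only [Function.comp_apply, ← hAdef, ← hBdef, hAN, hBN, mul_zero, add_zero]
  have hV2 : gInner G (F (θ (c t))) V2 (N (θ (c t))) =
      -(2 * (Z ^ 2 * (m * θ (c t) 0)) * (Z * bend)) := by
    rw [h2]
    simp only [gInner_add_left, gInner_smul_left, Function.comp_apply, ← hAdef, ← hBdef, hAN, hBN,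
      mul_zero, add_zero, zero_add]
    rw [hNh, hNA, hZ]
    ring
  have hdet := gDet_sq_eq hpd hrA hV1 H.unit.self_of_nhds hgram0 V2
  have hcross := gNorm_gCross_sq hpd hrA hV1 H.unit.self_of_nhds hgram0
  rw [hgram] at hdet hcross
  rw [hV2] at hdet
  simp only
  rw [hd, hFx]
  have hs2 := Real.sq_sqrt hq0.le
  have hqs : 0 < √q := Real.sqrt_pos.2 hq0
  have hdet' : |gDet G (F (θ (c t))) (r • A) V1 V2| =
      |r| * (|Z| ^ 2 * (|m| * |θ (c t) 0|)) * √q *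
        (2 * (|Z| ^ 2 * (|m| * |θ (c t) 0|)) * (|Z| * |bend|)) := by
    rw [← abs_of_nonneg (a := |r| * (|Z| ^ 2 * (|m| * |θ (c t) 0|)) * √q *
        (2 * (|Z| ^ 2 * (|m| * |θ (c t) 0|)) * (|Z| * |bend|))) (by positivity),
      ← sq_eq_sq_iff_abs_eq_abs, hdet]
    simp only [mul_pow, sq_abs, hs2, neg_sq]
  have hcross' : gNorm G (F (θ (c t))) (gCross G (F (θ (c t))) (r • A) V1) =
      |r| * (|Z| ^ 2 * (|m| * |θ (c t) 0|)) * √q := by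
    rw [← abs_of_nonneg (a := gNorm G (F (θ (c t))) (gCross G (F (θ (c t))) (r • A) V1))
      (gNorm_nonneg _), ← abs_of_nonneg (a := |r| * (|Z| ^ 2 * (|m| * |θ (c t) 0|)) * √q)
      (by positivity), ← sq_eq_sq_iff_abs_eq_abs, hcross]
    simp only [mul_pow, sq_abs, hs2]
  -- The speed factor |r| occurs with exponent 3/2 + 1 - 5/2 and the size |Z| of the null vector
  -- with 2 + 3 - 5, so both cancel.
  rw [abs_div, abs_mul, hdet', hcross', gNorm_smul]
  have e3 : (3 / 2 : ℝ) = ((3 : ℕ) : ℝ) / 2 := by norm_num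
  have e5 : (5 / 2 : ℝ) = ((5 : ℕ) : ℝ) / 2 := by norm_num
  have hnA := gNorm_pos hpd hA0
  have hr' : 0 < |r| := abs_pos.2 hr0
  have hZ' : 0 < |Z| := abs_pos.2 hZ0
  have hM' : 0 < |m| * |θ (c t) 0| := mul_pos (abs_pos.2 hm) (abs_pos.2 hu0)
  rw [e3, e5, rpow_half_nat (by positivity), rpow_half_nat (by positivity)]
  set M := |m| * |θ (c t) 0|
  rw [abs_of_nonneg (a := √(|r| * gNorm G (F (θ (c t))) A) ^ 3) (by positivity),
    abs_of_nonneg (a := √(|r| * (|Z| ^ 2 * M) * √q) ^ 5) (by positivity), Real.sqrt_mul (by positivity), Real.sqrt_mul (by positivity), Real.sqrt_mul (by positivity),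
    Real.sqrt_mul (by positivity), Real.sqrt_sq hZ'.le]
  have hρ := Real.sq_sqrt hr'.le
  have hμ := Real.sq_sqrt hM'.le
  have hκ := Real.sq_sqrt hqs.le
  have hρ0 := Real.sqrt_pos.2 hr'
  have hμ0 := Real.sqrt_pos.2 hM'
  have hκ0 := Real.sqrt_pos.2 hqs
  set ρ := √|r|
  set μ := √M
  set κ := √√q
  rw [← hρ, ← hμ, ← hκ]
  field_simp

end

/-! ### Limits along the singular curve -/

theorem integral_abs_eq (t : ℝ) : ∫ s in (0 : ℝ)..t, |s| = t * |t| / 2 := by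
  rcases le_total 0 t with h | h
  · rw [intervalIntegral.integral_congr (g := fun s => s), integral_id, abs_of_nonneg h]
    · ring
    · intro s hs
      rw [uIcc_of_le h] at hs
      exact abs_of_nonneg hs.1
  · rw [intervalIntegral.integral_congr (g := fun s => -s), intervalIntegral.integral_neg,
      integral_id, abs_of_nonpos h]
    · ring
    · intro s hs
      rw [uIcc_of_ge h] at hs
      exact abs_of_nonpos hs.2

theorem eventually_forall_uIcc {p : ℝ → Prop} (hp : ∀ᶠ s in 𝓝 (0 : ℝ), p s) :
    ∀ᶠ t in 𝓝 (0 : ℝ), ∀ s ∈ uIcc 0 t, p s := by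
  obtain ⟨ε, hε, h⟩ := Metric.eventually_nhds_iff.1 hp
  filter_upwards [Metric.ball_mem_nhds (0 : ℝ) hε] with t ht s hs
  apply h
  rw [Metric.mem_ball] at ht
  rw [Real.dist_eq, sub_zero] at ht ⊢
  refine lt_of_le_of_lt ?_ ht
  rcases le_total 0 t with h0 | h0
  · rw [uIcc_of_le h0] at hs
    rw [abs_of_nonneg hs.1, abs_of_nonneg h0]; exact hs.2
  · rw [uIcc_of_ge h0] at hs
    rw [abs_of_nonpos hs.2, abs_of_nonpos h0]; linarith [hs.1]

/-- Integrate |n(s) - l|s|| ≤ (ε/2)|s| from 0 to t and use ∫|s| = t|t|/2, valid for both signs of t.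
The value `n 0` has to be given separately, since the quotient says nothing at 0. -/
theorem tendsto_integral_div_sq {n : ℝ → ℝ} {l : ℝ} (hl : 0 ≤ l)
    (hc : ∀ᶠ s in 𝓝 (0 : ℝ), ContinuousAt n s)
    (hn : Tendsto (fun s => n s / |s|) (𝓝[≠] 0) (𝓝 l)) (hn0 : n 0 = 0) :
    Tendsto (fun t => |∫ s in (0 : ℝ)..t, n s| / t ^ 2) (𝓝[≠] 0) (𝓝 (l / 2)) := by
  have key : Tendsto (fun t => (∫ s in (0 : ℝ)..t, n s) / (t * |t|)) (𝓝[≠] 0) (𝓝 (l / 2)) := by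
    rw [Metric.tendsto_nhds]
    intro ε hε
    have h1 : ∀ᶠ s in 𝓝 (0 : ℝ), |n s - l * abs s| ≤ ε / 2 * |s| := by
      have := (Metric.tendsto_nhds.1 hn (ε / 2) (by positivity))
      rw [eventually_nhdsWithin_iff] at this
      filter_upwards [this] with s hs
      by_cases h0 : s = 0
      · simp [h0, hn0]
      · have h2 := (hs h0).le
        have hs0 : 0 < |s| := abs_pos.2 h0
        rw [Real.dist_eq] at h2
        have h3 : n s - l * |s| = (n s / |s| - l) * |s| := by field_simp
        rw [h3, abs_mul, abs_abs]
        gcongr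
    filter_upwards [nhdsWithin_le_nhds (eventually_forall_uIcc h1),
      nhdsWithin_le_nhds (eventually_forall_uIcc hc), self_mem_nhdsWithin] with t h2 h3 ht0
    have ht : 0 < |t| := abs_pos.2 ht0
    have hi : IntervalIntegrable n volume 0 t :=
      ContinuousOn.intervalIntegrable fun s hs => (h3 s hs).continuousWithinAt
    have hi2 : IntervalIntegrable (fun s => l * |s|) volume 0 t :=
      (continuous_const.mul continuous_abs).intervalIntegrable _ _
    have h4 : ‖∫ s in (0 : ℝ)..t, (n s - l * |s|)‖ ≤ (ε / 2 * |t|) * |t - 0| := by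
      refine intervalIntegral.norm_integral_le_of_norm_le_const fun s hs => ?_
      have hs' := uIoc_subset_uIcc hs
      refine (h2 s hs').trans (mul_le_mul_of_nonneg_left ?_ (by positivity))
      rcases le_total 0 t with h0 | h0
      · rw [uIcc_of_le h0] at hs'
        rw [abs_of_nonneg hs'.1, abs_of_nonneg h0]; exact hs'.2
      · rw [uIcc_of_ge h0] at hs'
        rw [abs_of_nonpos hs'.2, abs_of_nonpos h0]; linarith [hs'.1]
    rw [intervalIntegral.integral_sub hi hi2, intervalIntegral.integral_const_mul, integral_abs_eq,
      sub_zero, Real.norm_eq_abs] at h4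
    have ht1 : t ≠ 0 := ht0
    have h5 : (∫ s in (0 : ℝ)..t, n s) / (t * |t|) - l / 2 =
        ((∫ s in (0 : ℝ)..t, n s) - l * (t * |t| / 2)) / (t * |t|) := by
      field_simp
    rw [Real.dist_eq, h5, abs_div, abs_mul, abs_abs, div_lt_iff₀ (by positivity)]
    calc _ ≤ ε / 2 * |t| * |t| := h4
      _ < ε * (|t| * |t|) := by nlinarith [mul_pos ht ht]
  have h6 := key.abs
  rw [abs_of_nonneg (by positivity : 0 ≤ l / 2)] at h6
  refine h6.congr fun t => ?_
  rw [abs_div, abs_mul, abs_abs, abs_mul_abs_self, sq]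

/-- A regular parametrization of the `u`-axis. -/
structure IsAxisCurve (c : ℝ → Euc 2) : Prop where
  smooth : ∀ᶠ t in 𝓝 (0 : ℝ), ContDiffAt ℝ ∞ c t
  zero : c 0 = 0
  deriv_ne : deriv c 0 ≠ 0
  axis : ∀ᶠ t in 𝓝 (0 : ℝ), c t 1 = 0

section

variable {G : Euc 3 → Matrix (Fin 3) (Fin 3) ℝ} {F N h : Euc 2 → Euc 3} {m : ℝ} {c : ℝ → Euc 2}

namespace IsAxisCurve

theorem hasDerivAt_coord (K : IsAxisCurve c) (i : Fin 2) :
    HasDerivAt (fun t => c t i) (deriv c 0 i) 0 :=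
  (EuclideanSpace.proj (𝕜 := ℝ) i).hasFDerivAt.comp_hasDerivAt 0
    (K.smooth.self_of_nhds.differentiableAt (by simp)).hasDerivAt

theorem deriv_fst_ne (K : IsAxisCurve c) : deriv c 0 0 ≠ 0 := by
  intro h0
  refine K.deriv_ne (eq_zero_of_coord h0 ?_)
  exact (K.hasDerivAt_coord 1).unique
    ((hasDerivAt_const (0 : ℝ) (0 : ℝ)).congr_of_eventuallyEq K.axis)

theorem tendsto_fst_div (K : IsAxisCurve c) :
    Tendsto (fun t => c t 0 / t) (𝓝[≠] 0) (𝓝 (deriv c 0 0)) := by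
  refine (hasDerivAt_iff_tendsto_slope.1 (K.hasDerivAt_coord 0)).congr fun t => ?_
  simp [slope_def_field, K.zero]

theorem eventually_fst_ne (K : IsAxisCurve c) : ∀ᶠ t in 𝓝[≠] (0 : ℝ), c t 0 ≠ 0 := by
  filter_upwards [K.tendsto_fst_div.eventually_ne K.deriv_fst_ne] with t ht h0
  rw [h0, zero_div] at ht
  exact ht rfl

theorem tendsto (K : IsAxisCurve c) : Tendsto c (𝓝 0) (𝓝 0) := by
  simpa [ContinuousAt, K.zero] using K.smooth.self_of_nhds.continuousAt

theorem isAxisChange (K : IsAxisCurve c) :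
    ∀ᶠ t in 𝓝[≠] (0 : ℝ), IsAxisChange F F N N id c t := by
  filter_upwards [nhdsWithin_le_nhds K.smooth, nhdsWithin_le_nhds K.axis.eventually_nhds,
    K.eventually_fst_ne] with t h1 h2 h3
  refine ⟨Eventually.of_forall fun z => contDiffAt_id, h1, ?_, h2, h3, EventuallyEq.refl _ _,
    EventuallyEq.refl _ _⟩
  simp [jacobian, basisVec]

theorem contDiffAt_deriv (K : IsAxisCurve c) : ContDiffAt ℝ ∞ (deriv c) 0 :=
  K.smooth.self_of_nhds.fderiv_apply_const (1 : ℝ)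

/-- The arclength of the image of the singular curve. -/
theorem tendsto_arclength (K : IsAxisCurve c) (H : SwallowtailFrame G F N h m) {n : ℝ → ℝ}
    (hn : n =ᶠ[𝓝 0] fun s => gNorm G (F (c s)) (deriv (F ∘ c) s)) :
    Tendsto (fun t => √|∫ s in (0 : ℝ)..t, n s| / |c t 0|) (𝓝[≠] 0) (𝓝 √(|m| / 2)) := by
  have H0 := H.frameAt
  have hframe := K.tendsto.eventually H0.eventually
  have hsm : ∀ᶠ s in 𝓝 (0 : ℝ), ContDiffAt ℝ ∞ (F ∘ c) s := by
    filter_upwards [K.smooth, hframe] with s h1 h2 using h2.smooth.self_of_nhds.comp s h1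
  have hcont : ∀ᶠ s in 𝓝 (0 : ℝ), ContinuousAt n s := by
    filter_upwards [hn.eventuallyEq_nhds, hsm, hframe] with s h1 h2 h3
    have h4 : ContDiffAt ℝ ∞ (deriv (F ∘ c)) s := h2.fderiv_apply_const (1 : ℝ)
    have h5 : ContinuousAt (fun s => gNorm G ((F ∘ c) s) (deriv (F ∘ c) s)) s :=
      (ContDiffAt.gInner (F := F ∘ c) (V := deriv (F ∘ c)) (W := deriv (F ∘ c))
        h3.metric.self_of_nhds.contDiffAt h2 h4 h4).continuousAt.sqrt
    exact h5.congr h1.symm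
  have hc0 : Tendsto c (𝓝[≠] 0) (𝓝 0) := K.tendsto.mono_left nhdsWithin_le_nhds
  have hu0 := K.deriv_fst_ne
  have hA : Tendsto (fun s => gNorm G (F (c s)) (pderiv 1 F (c s))) (𝓝[≠] 0) (𝓝 1) := by
    have h1 := (ContDiffAt.gInner H0.metric.self_of_nhds.contDiffAt H0.smooth.self_of_nhds
      (contDiffAt_pderiv H0.smooth.self_of_nhds 1)
      (contDiffAt_pderiv H0.smooth.self_of_nhds 1)).continuousAt.tendsto.sqrt
    rw [H.norm_one, Real.sqrt_one] at h1
    exact h1.comp hc0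
  have hu' : Tendsto (fun s => deriv c s 0) (𝓝[≠] 0) (𝓝 (deriv c 0 0)) :=
    (K.contDiffAt_deriv.coord 0).continuousAt.tendsto.mono_left nhdsWithin_le_nhds
  -- The speed is |m| |u| |u'| |F_v|, with u/s → u'(0) and |F_v| → 1.
  have hlim : Tendsto (fun s => n s / |s|) (𝓝[≠] 0) (𝓝 (|m| * deriv c 0 0 ^ 2)) := by
    have h1 := (((K.tendsto_fst_div.abs.const_mul |m|).mul hu'.abs).mul hA)
    have h2 : |m| * |deriv c 0 0| * |deriv c 0 0| * 1 = |m| * deriv c 0 0 ^ 2 := by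
      rw [mul_one, mul_assoc, abs_mul_abs_self, sq]
    rw [h2] at h1
    refine h1.congr' ?_
    filter_upwards [K.isAxisChange (F := F) (N := N), nhdsWithin_le_nhds hn,
      nhdsWithin_le_nhds hframe] with s h3 h4 h5
    have h6 := (h3.deriv_image (m := m) (h := h) (G := G) h5).self_of_nhds
    rw [h4, h6, gNorm_smul, abs_neg, abs_mul, abs_mul, abs_div]
    simp only [Function.comp_apply, id, Function.id_comp]
    ring
  have hn0 : n 0 = 0 := by
    have h1 : deriv (F ∘ c) 0 = 0 := by
      have h2 : HasFDerivAt F (fderiv ℝ F (c 0)) (c 0) := by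
        rw [K.zero]
        exact (H0.smooth.self_of_nhds.differentiableAt (by simp)).hasFDerivAt
      have h3 := h2.comp_hasDerivAt (0 : ℝ)
        (K.smooth.self_of_nhds.differentiableAt (by simp)).hasDerivAt
      rw [h3.deriv, K.zero, H.fderiv_zero]
      have h4 : deriv c 0 1 = 0 := (K.hasDerivAt_coord 1).unique
        ((hasDerivAt_const (0 : ℝ) (0 : ℝ)).congr_of_eventuallyEq K.axis)
      rw [h4, zero_smul]
    rw [hn.self_of_nhds, show (fun s => gNorm G (F (c s)) (deriv (F ∘ c) s)) 0 =
      gNorm G (F (c 0)) (deriv (F ∘ c) 0) from rfl, h1, gNorm, gInner_zero_left, Real.sqrt_zero]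
  have hS := tendsto_integral_div_sq (by positivity) hcont hlim hn0
  -- Dividing by (u/t)² removes the parametrization: arclength over u² tends to |m|/2 in absolute
  -- value.
  have h7 := (hS.div (K.tendsto_fst_div.pow 2) (pow_ne_zero 2 hu0)).sqrt
  have h8 : |m| * deriv c 0 0 ^ 2 / 2 / deriv c 0 0 ^ 2 = |m| / 2 := by
    field_simp
  rw [h8] at h7
  refine h7.congr' ?_
  filter_upwards [K.eventually_fst_ne, self_mem_nhdsWithin] with t h9 h10
  have h10' : t ≠ 0 := h10
  rw [← Real.sqrt_sq_eq_abs (c t 0), ← Real.sqrt_div (abs_nonneg _)]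
  congr 1
  simp only [Pi.div_apply]
  field_simp

end IsAxisCurve

/-- The limiting singular curvature in terms of the frame. -/
def frameSingularCurvature (G : Euc 3 → Matrix (Fin 3) (Fin 3) ℝ) (F h : Euc 2 → Euc 3)
    (m : ℝ) : ℝ := 2 * √(frameGram G F h / |m|)

theorem FrameAt.gram_pos {x : Euc 2} (H : FrameAt G F N h m x) :
    0 < gram G (F x) (h x) (pderiv 1 F x) := by
  have h1 := gDet_normal_sq H.posDef.self_of_nhds H.normal_frame.self_of_nhds
    (H.normal.self_of_nhds (basisVec 1)) H.unit.self_of_nhds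
  rw [pderiv, ← h1]
  exact sq_pos_of_ne_zero H.gDet_frame_ne

/-- ∇_u F_v = ∇_v F_u, and the v-derivative of v h - m u F_v at the origin is h. -/
theorem SwallowtailFrame.covDeriv_pderiv_one (H : SwallowtailFrame G F N h m) :
    covDeriv G F (pderiv 1 F) 0 (basisVec 0) = h 0 := by
  have H0 := H.frameAt
  have hF := H0.smooth.self_of_nhds
  have h1 : covDeriv G F (pderiv 1 F) 0 (basisVec 0) = covDeriv G F (pderiv 0 F) 0 (basisVec 1) :=
    H0.metric.self_of_nhds.covDeriv_fderiv_comm hF _ _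
  have hf : pderiv 0 F =ᶠ[𝓝 0] fun z => z 1 • h z + (-(m * z 0)) • pderiv 1 F z := by
    filter_upwards [H0.frame] with z hz
    rw [hz, neg_smul]; abel
  have hA := (contDiffAt_pderiv hF 1).differentiableAt (by simp : (∞ : WithTop ℕ∞) ≠ 0)
  have hh := H0.smooth_frame.self_of_nhds.differentiableAt (by simp : (∞ : WithTop ℕ∞) ≠ 0)
  have d1 : HasFDerivAt (fun z : Euc 2 => z 1) (EuclideanSpace.proj (𝕜 := ℝ) (1 : Fin 2)) 0 :=
    (EuclideanSpace.proj (𝕜 := ℝ) (1 : Fin 2)).hasFDerivAt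
  have d0 : HasFDerivAt (fun z : Euc 2 => -(m * z 0))
      (-(m • EuclideanSpace.proj (𝕜 := ℝ) (0 : Fin 2))) 0 :=
    ((EuclideanSpace.proj (𝕜 := ℝ) (0 : Fin 2)).hasFDerivAt.const_mul m).neg
  rw [h1, covDeriv_congr (EventuallyEq.refl _ _) hf,
    covDeriv_add (d1.differentiableAt.fun_smul hh) (d0.differentiableAt.fun_smul hA),
    covDeriv_smul d1.differentiableAt hh, covDeriv_smul d0.differentiableAt hA, d1.fderiv, d0.fderiv]
  simp [basisVec]

/-- The limit of the singular curvature, normalized by the arclength `s`. -/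
theorem SwallowtailFrame.tendsto_singularCurvature (H : SwallowtailFrame G F N h m)
    {s k u : ℝ → ℝ} {x : ℝ → Euc 2} (hx : Tendsto x (𝓝[≠] 0) (𝓝 0))
    (hu : ∀ᶠ t in 𝓝[≠] (0 : ℝ), u t ≠ 0)
    (hs : Tendsto (fun t => √|s t| / |u t|) (𝓝[≠] 0) (𝓝 √(|m| / 2)))
    (hk : ∀ᶠ t in 𝓝[≠] (0 : ℝ), |k t| = |gDet G (F (x t)) (pderiv 1 F (x t))
        (covDeriv G F (pderiv 1 F) (x t) (basisVec 0)) (N (x t))| /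
      (|m| * |u t| * gNorm G (F (x t)) (pderiv 1 F (x t)) ^ 3)) :
    Tendsto (fun t => 2 * √2 * (√|s t| * |k t|)) (𝓝[≠] 0)
      (𝓝 (frameSingularCurvature G F h m)) := by
  have H0 := H.frameAt
  have hM := H0.metric.self_of_nhds
  have hF := H0.smooth.self_of_nhds
  have hA := contDiffAt_pderiv hF 1
  have h1 := (ContDiffAt.gDet hM.contDiffAt hM.det_ne hF hA (hM.contDiffAt_covDeriv hF hA
    (contDiffAt_const (c := basisVec 0))) H0.smooth_normal.self_of_nhds).continuousAt.tendsto.abs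
  have h2 := (ContDiffAt.gInner hM.contDiffAt hF hA hA).continuousAt.tendsto.sqrt
  rw [H.norm_one, Real.sqrt_one] at h2
  have hg : 0 < frameGram G F h := H0.gram_pos
  have hgd : |gDet G (F 0) (pderiv 1 F 0) (h 0) (N 0)| = √(frameGram G F h) := by
    have h3 := gDet_normal_sq H0.posDef.self_of_nhds H0.normal_frame.self_of_nhds
      (H0.normal.self_of_nhds (basisVec 1)) H0.unit.self_of_nhds
    rw [gDet_swap_left, abs_neg, frameGram, ← Real.sqrt_sq_eq_abs]
    congr 1
  rw [H.covDeriv_pderiv_one, hgd] at h1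
  have hm : 0 < |m| := abs_pos.2 H.ne_zero
  have h4 := (((hs.const_mul (2 * √2)).mul (h1.comp hx)).div
    (((h2.comp hx).pow 3).const_mul |m|) (by simpa using H.ne_zero))
  have h5 : 2 * √2 * √(|m| / 2) * √(frameGram G F h) / (|m| * 1 ^ 3) =
      frameSingularCurvature G F h m := by
    rw [frameSingularCurvature, Real.sqrt_div (abs_nonneg m), Real.sqrt_div (le_of_lt hg)]
    have h6 := Real.sq_sqrt hm.le
    have h7 : 0 < √|m| := Real.sqrt_pos.2 hm
    have h8 : 0 < √(2 : ℝ) := Real.sqrt_pos.2 (by norm_num)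
    field_simp
    rw [h6]
  rw [h5] at h4
  refine h4.congr' ?_
  filter_upwards [hk, hu] with t h9 h10
  rw [h9]
  have h11 : 0 < |u t| := abs_pos.2 h10
  simp only [Pi.div_apply, Function.comp_apply, gNorm]
  field_simp

/-- The limit of the cuspidal curvature, normalized by the arclength `s`. -/
theorem SwallowtailFrame.tendsto_cuspidalCurvature (H : SwallowtailFrame G F N h m)
    {s k u : ℝ → ℝ} {x : ℝ → Euc 2} (hx : Tendsto x (𝓝[≠] 0) (𝓝 0))
    (hu : ∀ᶠ t in 𝓝[≠] (0 : ℝ), u t ≠ 0)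
    (hs : Tendsto (fun t => √|s t| / |u t|) (𝓝[≠] 0) (𝓝 √(|m| / 2)))
    (hk : ∀ᶠ t in 𝓝[≠] (0 : ℝ), |k t| = 2 * √(gNorm G (F (x t)) (pderiv 1 F (x t))) ^ 3 *
        |gInner G (F (x t)) (h (x t)) (covDeriv G F N (x t) (nullDir m (x t)))| /
      (√(|m| * |u t|) * √√(gram G (F (x t)) (h (x t)) (pderiv 1 F (x t))) ^ 3)) :
    Tendsto (fun t => √(2 * √2) / 2 * |(|s t| ^ (1 / 4 : ℝ) * k t)|) (𝓝[≠] 0)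
      (𝓝 (√(frameSingularCurvature G F h m) * |frameBending G F N h / frameGram G F h|)) := by
  have H0 := H.frameAt
  have hM := H0.metric.self_of_nhds
  have hF := H0.smooth.self_of_nhds
  have hA := contDiffAt_pderiv hF 1
  have hh := H0.smooth_frame.self_of_nhds
  have h1 := (H0.contDiffAt_bending hh
    (contDiff_nullDir (m := m)).contDiffAt).continuousAt.tendsto.abs
  rw [nullDir_zero] at h1
  have h2 := (ContDiffAt.gInner hM.contDiffAt hF hA hA).continuousAt.tendsto.sqrt.sqrt
  rw [H.norm_one, Real.sqrt_one, Real.sqrt_one] at h2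
  have h3 := (ContDiffAt.gram hM.contDiffAt hF hh hA).continuousAt.tendsto.sqrt.sqrt
  have hg : 0 < frameGram G F h := H0.gram_pos
  have hm : 0 < |m| := abs_pos.2 H.ne_zero
  have hm' : 0 < √|m| := Real.sqrt_pos.2 hm
  have hg' : 0 < √(frameGram G F h) := Real.sqrt_pos.2 hg
  have hg'' : 0 < √√(frameGram G F h) := Real.sqrt_pos.2 hg'
  have h4 := ((((hs.sqrt.const_mul √(2 * √2)).mul ((h2.comp hx).pow 3)).mul (h1.comp hx))).div
    (((h3.comp hx).pow 3).const_mul √|m|) (mul_pos hm' (pow_pos hg'' 3)).ne'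
  have h5 : √(2 * √2) * √√(|m| / 2) * 1 ^ 3 * |gInner G (F 0) (h 0)
      (covDeriv G F N 0 (basisVec 0))| / (√|m| * √√(gram G (F 0) (h 0) (pderiv 1 F 0)) ^ 3) =
      √(frameSingularCurvature G F h m) * |frameBending G F N h / frameGram G F h| := by
    -- Both sides are nonnegative, and fourth powers clear the nested square roots.
    refine (pow_left_inj₀ (n := 4) (by positivity) (by positivity) (by norm_num)).1 ?_
    have four : ∀ a : ℝ, a ^ 4 = (a ^ 2) ^ 2 := fun a => by ring
    have twelve : ∀ a : ℝ, (a ^ 3) ^ 4 = ((a ^ 2) ^ 2) ^ 3 := fun a => by ring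
    have e1 : √(2 * √2) ^ 4 = 8 := by
      rw [four, Real.sq_sqrt (by positivity), mul_pow, Real.sq_sqrt (by norm_num)]; norm_num
    have e2 : √√(|m| / 2) ^ 4 = |m| / 2 := by
      rw [four, Real.sq_sqrt (by positivity), Real.sq_sqrt (by positivity)]
    have e3 : √|m| ^ 4 = |m| ^ 2 := by rw [four, Real.sq_sqrt (by positivity)]
    have e4 : (√√(gram G (F 0) (h 0) (pderiv 1 F 0)) ^ 3) ^ 4 = frameGram G F h ^ 3 := by
      rw [twelve, Real.sq_sqrt (by positivity), Real.sq_sqrt H0.gram_pos.le, frameGram]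
    have e5 : √(frameSingularCurvature G F h m) ^ 4 = 4 * (frameGram G F h / |m|) := by
      rw [frameSingularCurvature, four, Real.sq_sqrt (by positivity), mul_pow,
        Real.sq_sqrt (by positivity)]; norm_num
    simp only [div_pow, mul_pow, e1, e2, e3, e4, e5, abs_div, frameBending, abs_neg,
      abs_of_pos hg]
    field_simp
    ring
  rw [h5] at h4
  refine h4.congr' ?_
  filter_upwards [hk, hu] with t h9 h10
  have h11 : 0 < |u t| := abs_pos.2 h10
  have h12 : |s t| ^ (1 / 4 : ℝ) = √√|s t| := by
    rw [Real.sqrt_eq_rpow, Real.sqrt_eq_rpow, ← Real.rpow_mul (abs_nonneg _)]; norm_num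
  rw [abs_mul, h9, h12, abs_of_nonneg (Real.sqrt_nonneg _)]
  simp only [Pi.div_apply, Function.comp_apply, gNorm]
  rw [Real.sqrt_div (Real.sqrt_nonneg _), Real.sqrt_mul (abs_nonneg m)]
  have h13 : 0 < √|u t| := Real.sqrt_pos.2 h11
  field_simp

end

/-! ### Coordinate expressions on manifolds -/

section Charts

variable {n d : ℕ} {X : Type*} [TopologicalSpace X] [ChartedSpace (Euc n) X]
  {e φ φ' : OpenPartialHomeomorph X (Euc n)} {q : X}

/-- The derivative of a coordinate system, as a map of `ℝⁿ`. -/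
def chartDeriv (φ : OpenPartialHomeomorph X (Euc n)) (q : X) : Euc n →L[ℝ] Euc n :=
  mfderiv (𝓡 n) (𝓡 n) φ q

/-- The derivative of the inverse of a coordinate system, as a map of `ℝⁿ`. -/
def chartDerivSymm (φ : OpenPartialHomeomorph X (Euc n)) (y : Euc n) : Euc n →L[ℝ] Euc n :=
  mfderiv (𝓡 n) (𝓡 n) φ.symm y

theorem IsCoordAt.of_mem (he : IsCoordAt e q) {x : X} (hx : x ∈ e.source) : IsCoordAt e x :=
  ⟨he.1, hx⟩

theorem IsCoordAt.eventually (he : IsCoordAt e q) : ∀ᶠ x in 𝓝 q, IsCoordAt e x := by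
  filter_upwards [e.open_source.mem_nhds he.2] with x hx using he.of_mem hx

theorem IsCoordAt.eventually_target (he : IsCoordAt e q) :
    ∀ᶠ z in 𝓝 (e q), z ∈ e.target ∧ IsCoordAt e (e.symm z) := by
  filter_upwards [e.open_target.mem_nhds (e.map_source he.2)] with z hz
    using ⟨hz, he.of_mem (e.map_target hz)⟩

theorem IsCoordAt.contMDiffAt (he : IsCoordAt e q) : ContMDiffAt (𝓡 n) (𝓡 n) ∞ e q :=
  contMDiffAt_of_mem_maximalAtlas he.1 he.2

theorem IsCoordAt.contMDiffAt_symm (he : IsCoordAt e q) :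
    ContMDiffAt (𝓡 n) (𝓡 n) ∞ e.symm (e q) :=
  contMDiffAt_symm_of_mem_maximalAtlas he.1 (e.map_source he.2)

theorem IsCoordAt.mdifferentiable (he : IsCoordAt e q) : e.MDifferentiable (𝓡 n) (𝓡 n) :=
  ⟨(contMDiffOn_of_mem_maximalAtlas he.1).mdifferentiableOn (by simp),
    (contMDiffOn_symm_of_mem_maximalAtlas he.1).mdifferentiableOn (by simp)⟩

theorem IsCoordAt.chartDerivSymm_chartDeriv (he : IsCoordAt e q) (a : Euc n) :
    chartDerivSymm e (e q) (chartDeriv e q a) = a :=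
  DFunLike.congr_fun (he.mdifferentiable.symm_comp_deriv he.2) a

theorem IsCoordAt.chartDeriv_chartDerivSymm (he : IsCoordAt e q) (a : Euc n) :
    chartDeriv e q (chartDerivSymm e (e q) a) = a := by
  have h := DFunLike.congr_fun (he.mdifferentiable.comp_symm_deriv (e.map_source he.2)) a
  have h' : chartDeriv e (e.symm (e q)) (chartDerivSymm e (e q) a) = a := h
  rwa [e.left_inv he.2] at h'

theorem chartDerivSymm_injective {y : Euc n} (hφ : IsCoordAt φ (φ.symm y)) (hy : y ∈ φ.target)
    {a : Euc n} (ha : chartDerivSymm φ y a = 0) : a = 0 := by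
  have h := hφ.chartDeriv_chartDerivSymm a
  rw [φ.right_inv hy, ha, map_zero] at h
  exact h.symm

variable [IsManifold (𝓡 n) ∞ X]

/-- The coordinate expression of a smooth vector field along a map is smooth. -/
theorem contDiffAt_chartDeriv {T : Euc d → TangentBundle (𝓡 n) X} {z : Euc d}
    (hT : ContMDiffAt (𝓡 d) (𝓡 n).tangent ∞ T z) (hφ : IsCoordAt φ (T z).1) :
    ContDiffAt ℝ ∞ (fun y => chartDeriv φ (T y).1 (T y).2) z := by
  have h1 : ContMDiffOn (𝓡 n) (𝓡 n) ∞ φ φ.source := contMDiffOn_of_mem_maximalAtlas hφ.1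
  have h2 := h1.contMDiffOn_tangentMapWithin (m := ∞) (by simp) φ.open_source.uniqueMDiffOn
  have hT' : ∀ᶠ y in 𝓝 z, (T y).1 ∈ φ.source :=
    ((FiberBundle.continuous_proj (Euc n) (TangentSpace (𝓡 n) (M := X))).continuousAt.comp
      hT.continuousAt).eventually (φ.open_source.mem_nhds hφ.2)
  have h3 : ContMDiffAt (𝓡 n).tangent (𝓡 n).tangent ∞
      (tangentMapWithin (𝓡 n) (𝓡 n) φ φ.source) (T z) := by
    refine h2.contMDiffAt ?_
    exact (FiberBundle.continuous_proj (Euc n) (TangentSpace (𝓡 n) (M := X))).continuousAt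
      (φ.open_source.mem_nhds hφ.2)
  have h4 := (contMDiff_snd_tangentBundle_modelSpace (n := ∞) (Euc n) (𝓡 n)).contMDiffAt.comp z
    (h3.comp z hT)
  refine (contMDiffAt_iff_contDiffAt.1 h4).congr_of_eventuallyEq ?_
  filter_upwards [hT'] with y hy
  exact (congrArg (fun L : Euc n →L[ℝ] Euc n => L (T y).2)
    (mfderivWithin_of_mem_nhds (φ.open_source.mem_nhds hy) :
      mfderivWithin (𝓡 n) (𝓡 n) φ φ.source (T y).1 = mfderiv (𝓡 n) (𝓡 n) φ (T y).1)).symm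

theorem contMDiffAt_chartDerivSymm {y : Euc n} (hφ : IsCoordAt φ (φ.symm y))
    (hy : y ∈ φ.target) (c : Euc n) :
    ContMDiffAt (𝓡 n) (𝓡 n).tangent ∞
      (fun z => (⟨φ.symm z, chartDerivSymm φ z c⟩ : TangentBundle (𝓡 n) X)) y := by
  have h1 : ContMDiffOn (𝓡 n) (𝓡 n) ∞ φ.symm φ.target := contMDiffOn_symm_of_mem_maximalAtlas hφ.1
  have h2 := h1.contMDiffOn_tangentMapWithin (m := ∞) (by simp) φ.open_target.uniqueMDiffOn
  have h3 : ContMDiffAt (𝓡 n).tangent (𝓡 n).tangent ∞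
      (tangentMapWithin (𝓡 n) (𝓡 n) φ.symm φ.target)
        (⟨y, c⟩ : TangentBundle (𝓡 n) (Euc n)) := by
    refine h2.contMDiffAt ?_
    exact (FiberBundle.continuous_proj (Euc n)
      (TangentSpace (𝓡 n) (M := Euc n))).continuousAt (φ.open_target.mem_nhds hy)
  have h4 : ContMDiffAt (𝓡 n) (𝓡 n).tangent ∞
      (fun z : Euc n => (⟨z, c⟩ : TangentBundle (𝓡 n) (Euc n))) y :=
    contMDiffAt_vectorSpace_iff_contDiffAt.2 contDiffAt_const
  have h5 := h3.comp y h4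
  refine h5.congr_of_eventuallyEq ?_
  filter_upwards [φ.open_target.mem_nhds hy] with z hz
  simp only [Function.comp_apply, tangentMapWithin]
  rw [mfderivWithin_of_mem_nhds (φ.open_target.mem_nhds hz)]
  rfl

end Charts

/-! ### The ambient metric read in a chart. -/

section Metric

variable {M : Type*} [TopologicalSpace M] [ChartedSpace (Euc 3) M] [IsManifold (𝓡 3) ∞ M]
  {g : RMetric M} {φ φ' : OpenPartialHomeomorph M (Euc 3)} {q : M}

/-- The inner product of two tangent vectors, given as elements of `ℝ³`. -/
def metricAt (g : RMetric M) (q : M) (a b : Euc 3) : ℝ := g.inner q a b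

theorem gInner_localMetric (y a b : Euc 3) :
    gInner (localMetric g φ) y a b =
      metricAt g (φ.symm y) (chartDerivSymm φ y a) (chartDerivSymm φ y b) := by
  have key : ∀ c : Euc 3, chartDerivSymm φ y c =
      ∑ i, c i • chartDerivSymm φ y (basisVec i) := by
    intro c
    have hc : c = ∑ i, c i • (basisVec i : Euc 3) := by
      ext j; simp [basisVec, Fin.sum_univ_three]; fin_cases j <;> simp
    conv_lhs => rw [hc]
    simp
  rw [key a, key b]
  have h2 : ∀ (q : M) (a' b' : Fin 3 → Euc 3), metricAt g q (∑ i, a i • a' i) (∑ j, b j • b' j) =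
      ∑ i, ∑ j, metricAt g q (a' i) (b' j) * a i * b j := by
    intro q a' b'
    -- Stated for a bilinear map on ℝ³, so that linearity is used in the model space and not in the
    -- tangent space type.
    have h3 : ∀ B : Euc 3 →L[ℝ] Euc 3 →L[ℝ] ℝ, B (∑ i, a i • a' i) (∑ j, b j • b' j) =
        ∑ i, ∑ j, B (a' i) (b' j) * a i * b j := by
      intro B
      simp only [map_sum, map_smul, sum_apply, smul_apply, smul_eq_mul, Finset.mul_sum]
      rw [Finset.sum_comm]
      exact Finset.sum_congr rfl fun i _ => Finset.sum_congr rfl fun j _ => by ring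
    exact h3 (g.inner q)
  rw [h2]
  rfl

theorem metricAt_pos (q : M) {a : Euc 3} (ha : a ≠ 0) : 0 < metricAt g q a a := g.pos q a ha

theorem gInner_localMetric_chartDeriv (hφ : IsCoordAt φ q) (a b : Euc 3) :
    gInner (localMetric g φ) (φ q) (chartDeriv φ q a) (chartDeriv φ q b) = metricAt g q a b := by
  rw [gInner_localMetric, hφ.chartDerivSymm_chartDeriv, hφ.chartDerivSymm_chartDeriv,
    φ.left_inv hφ.2]

theorem localMetric_symm (y : Euc 3) (i j : Fin 3) :
    localMetric g φ y i j = localMetric g φ y j i := g.symm _ _ _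

theorem posDef_localMetric {y : Euc 3} (hφ : IsCoordAt φ (φ.symm y)) (hy : y ∈ φ.target) :
    (localMetric g φ y).PosDef := by
  refine Matrix.PosDef.of_dotProduct_mulVec_pos ?_ fun x hx => ?_
  · ext i j
    simp [Matrix.conjTranspose_apply, localMetric_symm y i j]
  · have h1 : gInner (localMetric g φ) y (WithLp.toLp 2 x) (WithLp.toLp 2 x) > 0 := by
      rw [gInner_localMetric]
      refine metricAt_pos _ fun h0 => hx ?_
      have := chartDerivSymm_injective hφ hy h0
      funext i
      exact congrArg (fun v : Euc 3 => v i) this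
    refine lt_of_lt_of_eq h1 ?_
    simp only [gInner, dotProduct, Matrix.mulVec, Finset.mul_sum, star_trivial]
    refine Finset.sum_congr rfl fun i _ => Finset.sum_congr rfl fun j _ => by ring

theorem contDiffAt_localMetric {y : Euc 3} (hφ : IsCoordAt φ (φ.symm y)) (hy : y ∈ φ.target)
    (i j : Fin 3) : ContDiffAt ℝ ∞ (fun z => localMetric g φ z i j) y := by
  have h1 := contMDiffAt_chartDerivSymm hφ hy (basisVec i)
  have h2 := contMDiffAt_chartDerivSymm hφ hy (basisVec j)
  have h0 : ContMDiffAt (𝓡 3) (𝓡 3) ∞ φ.symm y := contMDiffAt_symm_of_mem_maximalAtlas hφ.1 hy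
  have h3 : ContMDiffAt (𝓡 3) ((𝓡 3).prod 𝓘(ℝ)) ∞
      (fun z => Bundle.TotalSpace.mk' ℝ (E := Bundle.Trivial M ℝ) (φ.symm z)
        (g.inner (φ.symm z) (chartDerivSymm φ z (basisVec i))
          (chartDerivSymm φ z (basisVec j)))) y := by
    apply ContMDiffAt.clm_bundle_apply₂ (F₁ := Euc 3) (F₂ := Euc 3)
    · exact g.contMDiff.contMDiffAt.comp y h0
    · exact h1
    · exact h2
  rw [Bundle.contMDiffAt_totalSpace] at h3
  exact contMDiffAt_iff_contDiffAt.1 h3.2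

theorem IsCoordAt.isMetricAt (hφ : IsCoordAt φ q) : ∀ᶠ y in 𝓝 (φ q),
    IsMetricAt (localMetric g φ) y ∧ (localMetric g φ y).PosDef := by
  filter_upwards [hφ.eventually_target] with y hy
  exact ⟨⟨fun i j => contDiffAt_localMetric hy.2 hy.1 i j,
    Eventually.of_forall fun z i j => localMetric_symm z i j,
    (posDef_localMetric hy.2 hy.1).det_pos.ne'⟩, posDef_localMetric hy.2 hy.1⟩

end Metric

/-! ### Changes of coordinates, and maps and fields read in coordinates. -/

section Transition

variable {n : ℕ} {X : Type*} [TopologicalSpace X] [ChartedSpace (Euc n) X]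
  {e e' : OpenPartialHomeomorph X (Euc n)} {x : X}

theorem IsCoordAt.contDiffAt_transition (he : IsCoordAt e x) (he' : IsCoordAt e' x) :
    ContDiffAt ℝ ∞ (e ∘ e'.symm) (e' x) := by
  refine contMDiffAt_iff_contDiffAt.1 (ContMDiffAt.comp (e' x) ?_ he'.contMDiffAt_symm)
  rw [e'.left_inv he'.2]
  exact he.contMDiffAt

theorem IsCoordAt.fderiv_transition (he : IsCoordAt e x) (he' : IsCoordAt e' x) (w : Euc n) :
    fderiv ℝ (e ∘ e'.symm) (e' x) w = chartDeriv e x (chartDerivSymm e' (e' x) w) := by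
  have h1 : MDifferentiableAt (𝓡 n) (𝓡 n) e (e'.symm (e' x)) := by
    rw [e'.left_inv he'.2]
    exact he.mdifferentiable.mdifferentiableAt he.2
  have h2 := he'.contMDiffAt_symm.mdifferentiableAt (by simp)
  have h3 : fderiv ℝ (e ∘ e'.symm) (e' x) = mfderiv (𝓡 n) (𝓡 n) (e ∘ e'.symm) (e' x) :=
    mfderiv_eq_fderiv.symm
  have h4 : mfderiv (𝓡 n) (𝓡 n) (e ∘ e'.symm) (e' x) =
      (chartDeriv e (e'.symm (e' x))).comp (chartDerivSymm e' (e' x)) := mfderiv_comp _ h1 h2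
  rw [h3, h4, e'.left_inv he'.2]
  rfl

theorem IsCoordAt.transition_injective (he : IsCoordAt e x) (he' : IsCoordAt e' x) :
    Function.Injective (fderiv ℝ (e ∘ e'.symm) (e' x)) := by
  intro a b h
  rw [he.fderiv_transition he', he.fderiv_transition he'] at h
  have h2 := congrArg (fun v => chartDeriv e' x (chartDerivSymm e (e x) v)) h
  simpa only [he.chartDerivSymm_chartDeriv, he'.chartDeriv_chartDerivSymm] using h2

theorem IsCoordAt.transition_surjective (he : IsCoordAt e x) (he' : IsCoordAt e' x) :
    Function.Surjective (fderiv ℝ (e ∘ e'.symm) (e' x)) := by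
  intro a
  refine ⟨chartDeriv e' x (chartDerivSymm e (e x) a), ?_⟩
  rw [he.fderiv_transition he', he'.chartDerivSymm_chartDeriv, he.chartDeriv_chartDerivSymm]

/-- Composition of a coordinate system with a diffeomorphism of the model space. -/
theorem IsCoordAt.transHomeomorph [IsManifold (𝓡 n) ∞ X] (he : IsCoordAt e x)
    (ψ : Euc n ≃ₜ Euc n)
    (hψ : ContDiff ℝ ∞ ψ) (hψ' : ContDiff ℝ ∞ ψ.symm) : IsCoordAt (e.transHomeomorph ψ) x := by
  refine ⟨OpenPartialHomeomorph.mem_maximalAtlas_of_contMDiffOn _ ?_ ?_, he.2⟩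
  · exact hψ.contMDiff.comp_contMDiffOn (contMDiffOn_of_mem_maximalAtlas he.1)
  · exact (contMDiffOn_symm_of_mem_maximalAtlas he.1).comp hψ'.contMDiff.contMDiffOn
      fun z hz => hz

end Transition

/-- A vanishing determinant makes the cofactor combinations of the two columns zero; injectivity
then makes all their entries zero, which is absurd. -/
theorem jacobian_ne_of_injective {θ : Euc 2 → Euc 2} {z : Euc 2}
    (h : Function.Injective (fderiv ℝ θ z)) : jacobian θ z ≠ 0 := by
  intro hJ
  rw [jacobian] at hJ
  set a := fderiv ℝ θ z (basisVec 0)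
  set b := fderiv ℝ θ z (basisVec 1)
  have key : ∀ r s : ℝ, r • a + s • b = 0 → r = 0 ∧ s = 0 := by
    intro r s hrs
    have h1 : fderiv ℝ θ z (r • basisVec 0 + s • basisVec 1) = fderiv ℝ θ z 0 := by
      rw [map_add, map_smul, map_smul, map_zero]; exact hrs
    have h2 := h h1
    have h3 := congrArg (fun v : Euc 2 => v 0) h2
    have h4 := congrArg (fun v : Euc 2 => v 1) h2
    simp [basisVec] at h3 h4
    exact ⟨h3, h4⟩
  have h1 := key (b 1) (-(a 1)) (by
    refine eq_zero_of_coord ?_ ?_ <;> simp <;> linarith)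
  have h2 := key (b 0) (-(a 0)) (by
    refine eq_zero_of_coord ?_ ?_ <;> simp <;> linarith)
  have h3 := key 0 1 (by
    rw [zero_smul, one_smul, zero_add]; exact eq_zero_of_coord h2.1 h1.1)
  exact one_ne_zero h3.2

section LocalMap

theorem localMap_self {S M : Type*} [TopologicalSpace S] [ChartedSpace (Euc 2) S]
    [TopologicalSpace M] {f : S → M} {x : S} {e : OpenPartialHomeomorph S (Euc 2)}
    {φ : OpenPartialHomeomorph M (Euc 3)} (he : IsCoordAt e x) :
    localMap f e φ (e x) = φ (f x) := by
  rw [localMap, e.left_inv he.2]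

/-- Change of the coordinates of the source. -/
theorem localMap_transition {S M : Type*} [TopologicalSpace S] [ChartedSpace (Euc 2) S]
    [TopologicalSpace M] {f : S → M} {x : S} {e e' : OpenPartialHomeomorph S (Euc 2)}
    {φ : OpenPartialHomeomorph M (Euc 3)} (he : IsCoordAt e x) (he' : IsCoordAt e' x) :
    localMap f e' φ =ᶠ[𝓝 (e' x)] localMap f e φ ∘ (e ∘ e'.symm) := by
  rw [← e'.map_nhds_eq he'.2, EventuallyEq, eventually_map]
  filter_upwards [he.eventually, he'.eventually] with y h h'
  rw [localMap_self h', Function.comp_apply, Function.comp_apply, e'.left_inv h'.2,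
    localMap_self h]

variable {S : Type*} [TopologicalSpace S] [ChartedSpace (Euc 2) S]
  {M : Type*} [TopologicalSpace M] [ChartedSpace (Euc 3) M]
  {f : S → M} {ν : ∀ x, TangentSpace (𝓡 3) (f x)} {p x : S}
  {e e' : OpenPartialHomeomorph S (Euc 2)} {φ φ' : OpenPartialHomeomorph M (Euc 3)}

/-- The derivative of a map, as a map of the model spaces. -/
def surfDeriv (f : S → M) (x : S) : Euc 2 →L[ℝ] Euc 3 := mfderiv (𝓡 2) (𝓡 3) f x

/-- A vector field along a map, as a map to the model space. -/
def fieldVec (ν : ∀ x, TangentSpace (𝓡 3) (f x)) (x : S) : Euc 3 := ν x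

theorem eventually_isCoordAt (hf : ContMDiff (𝓡 2) (𝓡 3) ∞ f) (he : IsCoordAt e p)
    (hφ : IsCoordAt φ (f p)) : ∀ᶠ x in 𝓝 p, IsCoordAt e x ∧ IsCoordAt φ (f x) :=
  he.eventually.and (hf.continuous.continuousAt.eventually hφ.eventually)

/-- A property of the points near `p` in coordinates. -/
theorem IsCoordAt.eventually_iff (he : IsCoordAt e p) {P : Euc 2 → Prop} :
    (∀ᶠ z in 𝓝 (e p), P z) ↔ ∀ᶠ x in 𝓝 p, P (e x) := by
  rw [← e.map_nhds_eq he.2, eventually_map]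

theorem fderiv_localMap (hf : ContMDiff (𝓡 2) (𝓡 3) ∞ f) (he : IsCoordAt e x)
    (hφ : IsCoordAt φ (f x)) (w : Euc 2) :
    fderiv ℝ (localMap f e φ) (e x) w =
      chartDeriv φ (f x) (surfDeriv f x (chartDerivSymm e (e x) w)) := by
  have h1 : MDifferentiableAt (𝓡 2) (𝓡 2) e.symm (e x) :=
    he.contMDiffAt_symm.mdifferentiableAt (by simp)
  have h2 : MDifferentiableAt (𝓡 2) (𝓡 3) f (e.symm (e x)) :=
    hf.contMDiffAt.mdifferentiableAt (by simp)
  have h3 : MDifferentiableAt (𝓡 3) (𝓡 3) φ ((f ∘ e.symm) (e x)) := by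
    rw [Function.comp_apply, e.left_inv he.2]
    exact hφ.contMDiffAt.mdifferentiableAt (by simp)
  have h4 : fderiv ℝ (localMap f e φ) (e x) =
      mfderiv (𝓡 2) (𝓡 3) (φ ∘ (f ∘ e.symm)) (e x) := mfderiv_eq_fderiv.symm
  have h5 : mfderiv (𝓡 2) (𝓡 3) (φ ∘ (f ∘ e.symm)) (e x) =
      (mfderiv (𝓡 3) (𝓡 3) φ ((f ∘ e.symm) (e x))).comp
        (mfderiv (𝓡 2) (𝓡 3) (f ∘ e.symm) (e x)) := mfderiv_comp _ h3 (h2.comp _ h1)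
  have h6 : mfderiv (𝓡 2) (𝓡 3) (f ∘ e.symm) (e x) =
      (surfDeriv f (e.symm (e x))).comp (chartDerivSymm e (e x)) := mfderiv_comp _ h2 h1
  rw [h4, h5, h6]
  change chartDeriv φ (f (e.symm (e x))) (surfDeriv f (e.symm (e x)) (chartDerivSymm e (e x) w)) = _
  rw [e.left_inv he.2]

theorem localField_self (he : IsCoordAt e x) :
    localField f ν e φ (e x) = chartDeriv φ (f x) (fieldVec ν x) := by
  -- The base point occurs in the type of `ν`, so it is generalized before `e.symm (e x)` is
  -- replaced by `x`.
  have key : ∀ y : S, y = x → (mfderiv (𝓡 3) (𝓡 3) φ (f y) (ν y) : Euc 3) =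
    chartDeriv φ (f x) (fieldVec ν x) := by rintro y rfl; rfl
  exact key _ (e.left_inv he.2)

theorem isSingularPt_iff (hf : ContMDiff (𝓡 2) (𝓡 3) ∞ f) (he : IsCoordAt e x)
    (hφ : IsCoordAt φ (f x)) :
    IsSingularPt f x ↔ ∃ w ≠ 0, fderiv ℝ (localMap f e φ) (e x) w = 0 := by
  have h1 : IsSingularPt f x ↔ ∃ a ≠ 0, surfDeriv f x a = 0 := by
    change (¬ Function.Injective (surfDeriv f x)) ↔ _
    rw [injective_iff_map_eq_zero]
    push Not
    exact ⟨fun ⟨a, h, h'⟩ => ⟨a, h', h⟩, fun ⟨a, h, h'⟩ => ⟨a, h', h⟩⟩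
  rw [h1]
  constructor
  · rintro ⟨a, ha, h⟩
    refine ⟨chartDeriv e x a, fun h0 => ha ?_, ?_⟩
    · rw [← he.chartDerivSymm_chartDeriv a, h0, map_zero]
    · rw [fderiv_localMap hf he hφ, he.chartDerivSymm_chartDeriv, h, map_zero]
  · rintro ⟨w, hw, h⟩
    refine ⟨chartDerivSymm e (e x) w, fun h0 => hw ?_, ?_⟩
    · rw [← he.chartDeriv_chartDerivSymm w, h0, map_zero]
    · rw [fderiv_localMap hf he hφ] at h
      rw [← hφ.chartDerivSymm_chartDeriv (surfDeriv f x _), h, map_zero]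

theorem localField_transition (he : IsCoordAt e x) (he' : IsCoordAt e' x) :
    localField f ν e' φ =ᶠ[𝓝 (e' x)] localField f ν e φ ∘ (e ∘ e'.symm) := by
  refine he'.eventually_iff.2 ?_
  filter_upwards [he.eventually, he'.eventually] with y h h'
  rw [localField_self h', Function.comp_apply, Function.comp_apply, e'.left_inv h'.2,
    localField_self h]

/-- Change of the coordinates of the target. -/
theorem localMap_change (hf : ContMDiff (𝓡 2) (𝓡 3) ∞ f) (he : IsCoordAt e p)
    (hφ : IsCoordAt φ (f p)) (hφ' : IsCoordAt φ' (f p)) :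
    ∀ᶠ z in 𝓝 (e p), localMap f e φ' z = (φ' ∘ φ.symm) (localMap f e φ z) ∧
      localField f ν e φ' z =
        fderiv ℝ (φ' ∘ φ.symm) (localMap f e φ z) (localField f ν e φ z) := by
  refine he.eventually_iff.2 ?_
  filter_upwards [eventually_isCoordAt hf he hφ, eventually_isCoordAt hf he hφ'] with y h h'
  rw [localMap_self h.1, localMap_self h.1, localField_self h.1, localField_self h.1,
    h'.2.fderiv_transition h.2, h.2.chartDerivSymm_chartDeriv, Function.comp_apply,
    φ.left_inv h.2.2]
  exact ⟨rfl, rfl⟩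

variable [IsManifold (𝓡 3) ∞ M] {g : RMetric M}

theorem gInner_fderiv_localMap (hf : ContMDiff (𝓡 2) (𝓡 3) ∞ f) (he : IsCoordAt e x)
    (hφ : IsCoordAt φ (f x)) (a b : Euc 2) :
    gInner (localMetric g φ) (localMap f e φ (e x)) (fderiv ℝ (localMap f e φ) (e x) a)
      (fderiv ℝ (localMap f e φ) (e x) b) =
      firstFundamentalForm g f x (chartDerivSymm e (e x) a) (chartDerivSymm e (e x) b) := by
  rw [fderiv_localMap hf he hφ, fderiv_localMap hf he hφ, localMap_self he,
    gInner_localMetric_chartDeriv hφ]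
  rfl

/-- The isometry property of changes of coordinates. -/
theorem gInner_localMetric_transition {q : M} (hφ : IsCoordAt φ q) (hφ' : IsCoordAt φ' q)
    (a b : Euc 3) :
    gInner (localMetric g φ) (φ q) a b = gInner (localMetric g φ') ((φ' ∘ φ.symm) (φ q))
      (fderiv ℝ (φ' ∘ φ.symm) (φ q) a) (fderiv ℝ (φ' ∘ φ.symm) (φ q) b) := by
  rw [hφ'.fderiv_transition hφ, hφ'.fderiv_transition hφ, Function.comp_apply, φ.left_inv hφ.2,
    gInner_localMetric_chartDeriv hφ', gInner_localMetric, φ.left_inv hφ.2]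

theorem IsUnitNormalOn.localField {U : Set S} (hν : IsUnitNormalOn g f ν U) (hU : IsOpen U)
    (hpU : p ∈ U) (hf : ContMDiff (𝓡 2) (𝓡 3) ∞ f) (he : IsCoordAt e p)
    (hφ : IsCoordAt φ (f p)) : ∀ᶠ z in 𝓝 (e p), ContDiffAt ℝ ∞ (localField f ν e φ) z ∧
      gInner (localMetric g φ) (localMap f e φ z) (localField f ν e φ z)
        (localField f ν e φ z) = 1 ∧
      ∀ a, gInner (localMetric g φ) (localMap f e φ z) (fderiv ℝ (localMap f e φ) z a)
        (localField f ν e φ z) = 0 := by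
  refine he.eventually_iff.2 ?_
  filter_upwards [eventually_isCoordAt hf he hφ, hU.mem_nhds hpU] with y h hy
  refine ⟨?_, ?_, fun a => ?_⟩
  · have h1 : ContMDiffAt (𝓡 2) (𝓡 3).tangent ∞
        (fun x => (⟨f x, ν x⟩ : TangentBundle (𝓡 3) M)) (e.symm (e y)) := by
      rw [e.left_inv h.1.2]
      exact hν.smooth.contMDiffAt (hU.mem_nhds hy)
    have h2 := h1.comp (e y) h.1.contMDiffAt_symm
    refine contDiffAt_chartDeriv (φ := φ) h2 ?_
    change IsCoordAt φ (f (e.symm (e y)))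
    rw [e.left_inv h.1.2]
    exact h.2
  · rw [localMap_self h.1, localField_self h.1, gInner_localMetric_chartDeriv h.2]
    exact hν.unit y hy
  · rw [localMap_self h.1, localField_self h.1, fderiv_localMap hf h.1 h.2,
      gInner_localMetric_chartDeriv h.2]
    exact hν.normal y hy _

end LocalMap

/-! ### The frame along a swallowtail -/

/-- `χ` is a local isometry near `y`. -/
structure IsIsometryAt (G G' : Euc 3 → Matrix (Fin 3) (Fin 3) ℝ) (χ : Euc 3 → Euc 3)
    (y : Euc 3) : Prop where
  metric : ∀ᶠ z in 𝓝 y, IsMetricAt G z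
  metric' : ∀ᶠ z in 𝓝 (χ y), IsMetricAt G' z
  posDef' : ∀ᶠ z in 𝓝 (χ y), (G' z).PosDef
  smooth : ∀ᶠ z in 𝓝 y, ContDiffAt ℝ ∞ χ z
  iso : ∀ᶠ z in 𝓝 y, ∀ a b, gInner G z a b = gInner G' (χ z) (fderiv ℝ χ z a) (fderiv ℝ χ z b)
  surj : Function.Surjective (fderiv ℝ χ y)

section

variable {G G' : Euc 3 → Matrix (Fin 3) (Fin 3) ℝ} {χ : Euc 3 → Euc 3} {m : ℝ}
  {F N h F' N' : Euc 2 → Euc 3}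

theorem IsIsometryAt.covDeriv (I : IsIsometryAt G G' χ (F 0)) (hF : ContDiffAt ℝ ∞ F 0)
    (hN : ContDiffAt ℝ ∞ N 0) (hF' : F' =ᶠ[𝓝 0] χ ∘ F)
    (hN' : N' =ᶠ[𝓝 0] fun z => fderiv ℝ χ (F z) (N z)) (w : Euc 2) :
    covDeriv G' F' N' 0 w = fderiv ℝ χ (F 0) (covDeriv G F N 0 w) := by
  rw [covDeriv_congr hF' hN']
  exact covDeriv_change_coord I.metric.self_of_nhds I.metric'.self_of_nhds I.smooth.self_of_nhds
    I.surj I.iso (hF.differentiableAt (by simp)) (hN.differentiableAt (by simp)) w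

/-- Transport of the frame of a swallowtail by a change of coordinates of the target. -/
theorem SwallowtailFrame.change_coord (H : SwallowtailFrame G F N h m)
    (I : IsIsometryAt G G' χ (F 0)) (hF' : F' =ᶠ[𝓝 0] χ ∘ F)
    (hN' : N' =ᶠ[𝓝 0] fun z => fderiv ℝ χ (F z) (N z)) :
    SwallowtailFrame G' F' N' (fun z => fderiv ℝ χ (F z) (h z)) m ∧
      frameGram G' F' (fun z => fderiv ℝ χ (F z) (h z)) = frameGram G F h ∧
      frameBending G' F' N' (fun z => fderiv ℝ χ (F z) (h z)) = frameBending G F N h ∧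
      frameNormalCurvature G' F' N' = frameNormalCurvature G F N := by
  have H0 := H.frameAt
  have hF := H0.smooth.self_of_nhds
  have hd : ∀ᶠ z in 𝓝 (0 : Euc 2), ∀ w, fderiv ℝ F' z w = fderiv ℝ χ (F z) (fderiv ℝ F z w) := by
    filter_upwards [hF'.eventuallyEq_nhds, H0.smooth, hF.continuousAt.eventually I.smooth]
      with z h1 h2 h3 w
    rw [h1.fderiv_eq, fderiv_comp z (h3.differentiableAt (by simp)) (h2.differentiableAt (by simp))]
    rfl
  have hiso := hF.continuousAt.eventually I.iso
  have hsm := hF.continuousAt.eventually I.smooth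
  have h0 : F' 0 = χ (F 0) := hF'.self_of_nhds
  have hN0 : N' 0 = fderiv ℝ χ (F 0) (N 0) := hN'.self_of_nhds
  have hA0 : ∀ i, pderiv i F' 0 = fderiv ℝ χ (F 0) (pderiv i F 0) :=
    fun i => hd.self_of_nhds (basisVec i)
  have hi0 := hiso.self_of_nhds
  have hsmN : ContDiffAt ℝ ∞ N 0 := H0.smooth_normal.self_of_nhds
  have hgram : gram G' (F' 0) (fderiv ℝ χ (F 0) (h 0)) (pderiv 1 F' 0) =
      gram G (F 0) (h 0) (pderiv 1 F 0) := by
    rw [gram, gram, h0, hA0, ← hi0, ← hi0, ← hi0]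
  have hfield : ∀ {V : Euc 2 → Euc 3}, (∀ᶠ z in 𝓝 (0 : Euc 2), ContDiffAt ℝ ∞ V z) →
      ∀ᶠ z in 𝓝 (0 : Euc 2), ContDiffAt ℝ ∞ (fun z => fderiv ℝ χ (F z) (V z)) z := by
    intro V hV
    filter_upwards [hsm, H0.smooth, hV] with z h1 h2 h3
    exact ((h1.fderiv_right (m := ∞) (by simp)).comp z h2).clm_apply h3
  refine ⟨⟨⟨?_, ?_, ?_, ?_, ?_, ?_, ?_, ?_, ?_, ?_⟩, ?_, H.ne_zero⟩, hgram, ?_, ?_⟩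
  · rw [h0]; exact I.metric'
  · rw [h0]; exact I.posDef'
  · filter_upwards [hF'.eventuallyEq_nhds, H0.smooth, hsm] with z h1 h2 h3
      using (h3.comp z h2).congr_of_eventuallyEq h1
  · filter_upwards [hN'.eventuallyEq_nhds, hfield H0.smooth_normal] with z h1 h2
      using h2.congr_of_eventuallyEq h1
  · exact hfield H0.smooth_frame
  · filter_upwards [hF', hN', hiso, H0.unit] with z h1 h2 h3 h4
    rw [h1, h2, Function.comp_apply, ← h3, h4]
  · filter_upwards [hF', hN', hiso, H0.normal, hd] with z h1 h2 h3 h4 h5 a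
    rw [h5, h1, h2, Function.comp_apply, ← h3, h4]
  · filter_upwards [hF', hN', hiso, H0.normal_frame] with z h1 h2 h3 h4
    rw [h1, h2, Function.comp_apply, ← h3, h4]
  · filter_upwards [hd, H0.frame] with z h1 h2
    rw [pderiv, pderiv, h1, h1, ← pderiv, h2, map_sub, map_smul, map_smul]
    rfl
  · rw [hgram]; exact H0.indep
  · rw [h0, hA0, ← hi0, H.norm_one]
  · rw [frameBending, frameBending, I.covDeriv hF hsmN hF' hN', h0, ← hi0]
  · rw [frameNormalCurvature, frameNormalCurvature, I.covDeriv hF hsmN hF' hN', h0, hA0, ← hi0]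

end

/-! ### The standard swallowtail with its singular set flattened. -/

section Gram

variable {n : ℕ} {G : Euc n → Matrix (Fin n) (Fin n) ℝ} {y : Euc n}

/-- Strict Cauchy–Schwarz: ⟨b, b⟩a - ⟨a, b⟩b is nonzero, and its squared length is ⟨b, b⟩ times the
Gram determinant. -/
theorem gram_pos (hG : (G y).PosDef) {a b : Euc n}
    (hab : ∀ r s : ℝ, r • a + s • b = 0 → r = 0 ∧ s = 0) : 0 < gram G y a b := by
  have hs := posDef_symm hG
  have hb : b ≠ 0 := by
    rintro rfl
    exact one_ne_zero (hab 0 1 (by simp)).2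
  have hbb : 0 < gInner G y b b := gInner_self_pos hG hb
  set v := gInner G y b b • a + (-gInner G y a b) • b with hv
  have hv0 : v ≠ 0 := fun h => hbb.ne' (hab _ _ h).1
  have h1 : gInner G y v v = gInner G y b b * gram G y a b := by
    rw [hv]
    simp only [gInner_add_left, gInner_add_right, gInner_smul_left, gInner_smul_right, gram,
      gInner_comm hs b a]
    ring
  have h2 := gInner_self_pos hG hv0
  rw [h1] at h2
  exact pos_of_mul_pos_right h2 hbb.le

end Gram

/-- The standard swallowtail in the coordinates in which the `u`-axis is the singular set. -/
def flatSwallowtail (c : ℝ) (z : Euc 2) : Euc 3 :=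
  !₂[c * z 1 - 6 * z 0 ^ 2, 2 * c * z 0 * z 1 - 8 * z 0 ^ 3, c * z 0 ^ 2 * z 1 - 3 * z 0 ^ 4]

/-- The change of coordinates which flattens the singular set of the standard swallowtail. -/
def flattening (c : ℝ) (hc : c ≠ 0) : Euc 2 ≃ₜ Euc 2 where
  -- The standard swallowtail is singular where 12v² + 2u = 0, that is on u = -6v². The constant `c`
  -- is kept free to normalize |F_v| at the origin.
  toFun z := !₂[z 1, (z 0 + 6 * z 1 ^ 2) / c]
  invFun z := !₂[c * z 1 - 6 * z 0 ^ 2, z 0]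
  left_inv z := by
    ext i; fin_cases i
    · simp; field_simp; ring
    · simp
  right_inv z := by
    ext i; fin_cases i
    · simp
    · simp; field_simp
  continuous_toFun := by
    refine (PiLp.continuous_toLp 2 _).comp (continuous_pi fun i => ?_)
    fin_cases i <;> simp <;> fun_prop
  continuous_invFun := by
    refine (PiLp.continuous_toLp 2 _).comp (continuous_pi fun i => ?_)
    fin_cases i <;> simp <;> fun_prop

theorem contDiff_euc_coord {n : ℕ} (i : Fin n) : ContDiff ℝ ∞ (fun z : Euc n => z i) :=
  (EuclideanSpace.proj (𝕜 := ℝ) i).contDiff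

theorem contDiff_flattening (c : ℝ) (hc : c ≠ 0) : ContDiff ℝ ∞ (flattening c hc) := by
  refine contDiff_piLp' 2 fun i => ?_
  have h0 := contDiff_euc_coord (n := 2) 0
  have h1 := contDiff_euc_coord (n := 2) 1
  fin_cases i
  · exact h1
  · exact (h0.add (contDiff_const.mul (h1.pow 2))).div_const c

theorem contDiff_flattening_symm (c : ℝ) (hc : c ≠ 0) :
    ContDiff ℝ ∞ (flattening c hc).symm := by
  refine contDiff_piLp' 2 fun i => ?_
  have h0 := contDiff_euc_coord (n := 2) 0
  have h1 := contDiff_euc_coord (n := 2) 1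
  fin_cases i
  · exact (contDiff_const.mul h1).sub (contDiff_const.mul (h0.pow 2))
  · exact h0

theorem stdSwallowtail_flattening_symm (c : ℝ) (hc : c ≠ 0) (z : Euc 2) :
    stdSwallowtail ((flattening c hc).symm z) = flatSwallowtail c z := by
  have h0 : (flattening c hc).symm z 0 = c * z 1 - 6 * z 0 ^ 2 := rfl
  have h1 : (flattening c hc).symm z 1 = z 0 := rfl
  rw [stdSwallowtail, h0, h1]
  ext i; fin_cases i <;> simp [flatSwallowtail] <;> ring

theorem contDiff_flatSwallowtail (c : ℝ) : ContDiff ℝ ∞ (flatSwallowtail c) := by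
  refine contDiff_piLp' 2 fun i => ?_
  have h0 := contDiff_euc_coord (n := 2) 0
  have h1 := contDiff_euc_coord (n := 2) 1
  fin_cases i
  · exact (contDiff_const.mul h1).sub (contDiff_const.mul (h0.pow 2))
  · exact ((contDiff_const.mul h0).mul h1).sub (contDiff_const.mul (h0.pow 3))
  · exact ((contDiff_const.mul (h0.pow 2)).mul h1).sub (contDiff_const.mul (h0.pow 4))

theorem hasFDerivAt_euc_coord {n : ℕ} (i : Fin n) (z : Euc n) :
    HasFDerivAt (fun z : Euc n => z i) (EuclideanSpace.proj (𝕜 := ℝ) i : Euc n →L[ℝ] ℝ) z :=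
  (EuclideanSpace.proj (𝕜 := ℝ) i).hasFDerivAt

theorem pderiv_coord {d n : ℕ} {F : Euc d → Euc n} {z : Euc d} (hF : DifferentiableAt ℝ F z)
    (i : Fin d) (k : Fin n) : pderiv i F z k = pderiv i (fun y => F y k) z := by
  rw [pderiv, pderiv, (hasFDerivAt_coord hF k).fderiv]
  rfl

theorem pderiv_flatSwallowtail (c : ℝ) (z : Euc 2) :
    pderiv 0 (flatSwallowtail c) z =
      !₂[-12 * z 0, 2 * c * z 1 - 24 * z 0 ^ 2, 2 * c * z 0 * z 1 - 12 * z 0 ^ 3] ∧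
    pderiv 1 (flatSwallowtail c) z = !₂[c, 2 * c * z 0, c * z 0 ^ 2] := by
  have hF := (contDiff_flatSwallowtail c).contDiffAt (x := z).differentiableAt (by simp)
  have h0 := hasFDerivAt_euc_coord (n := 2) 0 z
  have h1 := hasFDerivAt_euc_coord (n := 2) 1 z
  have e0 := (h1.const_mul c).sub ((h0.pow 2).const_mul 6)
  have e1 := ((h0.const_mul (2 * c)).mul h1).sub ((h0.pow 3).const_mul 8)
  have e2 := (((h0.pow 2).const_mul c).mul h1).sub ((h0.pow 4).const_mul 3)
  constructor <;>
  · ext k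
    rw [pderiv_coord hF]
    fin_cases k
    · refine (congrArg (fun L : Euc 2 →L[ℝ] ℝ => L (basisVec _)) e0.fderiv).trans ?_
      simp [basisVec] <;> ring
    · refine (congrArg (fun L : Euc 2 →L[ℝ] ℝ => L (basisVec _)) e1.fderiv).trans ?_
      simp [basisVec] <;> ring
    · refine (congrArg (fun L : Euc 2 →L[ℝ] ℝ => L (basisVec _)) e2.fderiv).trans ?_
      simp [basisVec] <;> ring

/-- The frame of the standard swallowtail. -/
theorem swallowtailFrame_flat {G : Euc 3 → Matrix (Fin 3) (Fin 3) ℝ} {F N : Euc 2 → Euc 3}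
    {c : ℝ} (hc : c ≠ 0) (hF : F =ᶠ[𝓝 0] flatSwallowtail c)
    (hG : ∀ᶠ y in 𝓝 (F 0), IsMetricAt G y ∧ (G y).PosDef)
    (hN : ∀ᶠ z in 𝓝 (0 : Euc 2), ContDiffAt ℝ ∞ N z ∧ gInner G (F z) (N z) (N z) = 1 ∧
      ∀ a, gInner G (F z) (fderiv ℝ F z a) (N z) = 0)
    (h1 : gInner G (F 0) (pderiv 1 F 0) (pderiv 1 F 0) = 1) :
    SwallowtailFrame G F N (fun z => !₂[0, 2 * c, 2 * c * z 0]) (12 / c) := by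
  have hsm : ∀ᶠ z in 𝓝 (0 : Euc 2), ContDiffAt ℝ ∞ F z := by
    filter_upwards [hF.eventuallyEq_nhds] with z hz
      using (contDiff_flatSwallowtail c).contDiffAt.congr_of_eventuallyEq hz
  have hh : ContDiff ℝ ∞ (fun z : Euc 2 => (!₂[0, 2 * c, 2 * c * z 0] : Euc 3)) := by
    refine contDiff_piLp' 2 fun i => ?_
    have h0 := contDiff_euc_coord (n := 2) 0
    fin_cases i
    · exact contDiff_const
    · exact contDiff_const
    · exact contDiff_const.mul h0
  -- 12/c is what cancels the first component -12u of F_u against the first component c of F_v; the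
  -- remainder is divisible by v.
  have hframe : ∀ᶠ z in 𝓝 (0 : Euc 2), pderiv 0 F z =
      z 1 • (!₂[0, 2 * c, 2 * c * z 0] : Euc 3) - (12 / c * z 0) • pderiv 1 F z := by
    filter_upwards [hF.pderiv 0, hF.pderiv 1] with z h2 h3
    rw [h2, h3, (pderiv_flatSwallowtail c z).1, (pderiv_flatSwallowtail c z).2]
    ext k
    fin_cases k
    · simp; field_simp
    · simp; field_simp; ring
    · simp; field_simp
  have hF0 := hsm.self_of_nhds
  refine ⟨⟨hG.mono fun _ h => h.1, hG.mono fun _ h => h.2, hsm, hN.mono fun _ h => h.1,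
    Eventually.of_forall fun z => hh.contDiffAt, hN.mono fun _ h => h.2.1,
    hN.mono fun _ h => h.2.2, ?_, hframe, ?_⟩, h1, by positivity⟩
  -- Tangency of F_u and F_v gives v⟨h, N⟩ = 0 near the origin. Off the axis divide by v, on the
  -- axis differentiate in v.
  · have hq : ∀ᶠ z in 𝓝 (0 : Euc 2), ContDiffAt ℝ ∞
        (fun z => gInner G (F z) (!₂[0, 2 * c, 2 * c * z 0] : Euc 3) (N z)) z := by
      filter_upwards [hF0.continuousAt.eventually hG, hsm, hN] with z h2 h3 h4
      exact ContDiffAt.gInner h2.1.contDiffAt h3 hh.contDiffAt h4.1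
    have hz0 : ∀ᶠ z in 𝓝 (0 : Euc 2),
        z 1 * gInner G (F z) (!₂[0, 2 * c, 2 * c * z 0] : Euc 3) (N z) = 0 := by
      filter_upwards [hframe, hN] with z h2 h3
      have h4 := h3.2.2 (basisVec 0)
      have h5 := h3.2.2 (basisVec 1)
      rw [← pderiv] at h4 h5
      rw [h2, gInner_sub_left, gInner_smul_left, gInner_smul_left, h5, mul_zero, sub_zero] at h4
      exact h4
    filter_upwards [hq, hz0.eventually_nhds] with z h2 h3
    have h4 := ((hasFDerivAt_euc_coord (n := 2) 1 z).mul
      (h2.differentiableAt (by simp)).hasFDerivAt).congr_of_eventuallyEq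
        (f₁ := fun _ => (0 : ℝ)) (h3.mono fun y hy => hy.symm)
    have h5 := congrArg (fun L : Euc 2 →L[ℝ] ℝ => L (basisVec 1))
      (h4.unique (hasFDerivAt_const (0 : ℝ) z))
    simp [basisVec] at h5
    rcases eq_or_ne (z 1) 0 with h6 | h6
    · simpa [h6] using h5
    · exact (mul_eq_zero.1 h3.self_of_nhds).resolve_left h6
  · refine (gram_pos hG.self_of_nhds.2 fun r s hrs => ?_).ne'
    rw [(hF.pderiv 1).self_of_nhds, (pderiv_flatSwallowtail c 0).2] at hrs
    have h2 := congrArg (fun v : Euc 3 => v 0) hrs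
    have h3 := congrArg (fun v : Euc 3 => v 1) hrs
    simp [hc] at h2 h3
    exact ⟨h3, h2⟩

/-! ### Swallowtail charts: the normal form in every target chart. -/

section

variable {S : Type*} [TopologicalSpace S] [ChartedSpace (Euc 2) S]
  {M : Type*} [TopologicalSpace M] [ChartedSpace (Euc 3) M]
  {f : S → M} {ν : ∀ x, TangentSpace (𝓡 3) (f x)} {p : S}
  {e e' : OpenPartialHomeomorph S (Euc 2)} {φ φ' : OpenPartialHomeomorph M (Euc 3)}

theorem mfderiv_coordVec_eq_zero_iff (hf : ContMDiff (𝓡 2) (𝓡 3) ∞ f) (he : IsCoordAt e p)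
    (hφ : IsCoordAt φ (f p)) (i : Fin 2) :
    mfderiv (𝓡 2) (𝓡 3) f p (coordVec e p i) = 0 ↔ pderiv i (localMap f e φ) (e p) = 0 := by
  rw [pderiv, fderiv_localMap hf he hφ]
  change surfDeriv f p (chartDerivSymm e (e p) (basisVec i)) = 0 ↔ _
  refine ⟨fun h => by rw [h, map_zero], fun h => ?_⟩
  rw [← hφ.chartDerivSymm_chartDeriv (surfDeriv f p _), h, map_zero]

variable [IsManifold (𝓡 3) ∞ M] {g : RMetric M}

theorem tangentNorm_coordVec (hf : ContMDiff (𝓡 2) (𝓡 3) ∞ f) (he : IsCoordAt e p)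
    (hφ : IsCoordAt φ (f p)) (i : Fin 2) :
    tangentNorm g (f p) (mfderiv (𝓡 2) (𝓡 3) f p (coordVec e p i)) =
      gNorm (localMetric g φ) (localMap f e φ (e p)) (pderiv i (localMap f e φ) (e p)) := by
  rw [gNorm, pderiv, gInner_fderiv_localMap hf he hφ]
  rfl

theorem IsCoordAt.isIsometryAt {q : M} (hφ : IsCoordAt φ q) (hφ' : IsCoordAt φ' q) :
    IsIsometryAt (localMetric g φ) (localMetric g φ') (φ' ∘ φ.symm) (φ q) := by
  have h0 : (φ' ∘ φ.symm) (φ q) = φ' q := by rw [Function.comp_apply, φ.left_inv hφ.2]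
  have hnear : ∀ᶠ z in 𝓝 (φ q), ∃ r, IsCoordAt φ r ∧ IsCoordAt φ' r ∧ φ r = z := by
    rw [← φ.map_nhds_eq hφ.2, eventually_map]
    filter_upwards [hφ.eventually, hφ'.eventually] with r h h' using ⟨r, h, h', rfl⟩
  refine ⟨hφ.isMetricAt.mono fun _ h => h.1, ?_, ?_, ?_, ?_, hφ'.transition_surjective hφ⟩
  · rw [h0]; exact hφ'.isMetricAt.mono fun _ h => h.1
  · rw [h0]; exact hφ'.isMetricAt.mono fun _ h => h.2
  · filter_upwards [hnear] with z ⟨r, h, h', hz⟩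
    rw [← hz]; exact h'.contDiffAt_transition h
  · filter_upwards [hnear] with z ⟨r, h, h', hz⟩ a b
    rw [← hz]; exact gInner_localMetric_transition h h' a b

/-- Coordinates `e` in which the map `f` with unit normal field `ν` has the frame of a swallowtail
at `p`, with the constants `d` (the Gram determinant), `b` (the bending) and `k` (the normal
curvature). -/
structure IsSwallowtailChart (g : RMetric M) (f : S → M) (ν : ∀ x, TangentSpace (𝓡 3) (f x))
    (p : S) (e : OpenPartialHomeomorph S (Euc 2)) (m d b k : ℝ) : Prop where
  coord : IsCoordAt e p
  base : e p = 0
  frame : ∀ φ, IsCoordAt φ (f p) → ∃ h : Euc 2 → Euc 3,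
    SwallowtailFrame (localMetric g φ) (localMap f e φ) (localField f ν e φ) h m ∧
    frameGram (localMetric g φ) (localMap f e φ) h = d ∧
    frameBending (localMetric g φ) (localMap f e φ) (localField f ν e φ) h = b ∧
    frameNormalCurvature (localMetric g φ) (localMap f e φ) (localField f ν e φ) = k

/-- The frame is computed in the target chart of the right-left equivalence and carried to every
other target chart by the transition isometry. The chart `e` and `m` are fixed before the normal
field. -/
theorem exists_isSwallowtailChart [IsManifold (𝓡 2) ∞ S] (hf : ContMDiff (𝓡 2) (𝓡 3) ∞ f)
    (hp : IsSwallowtail f p) :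
    ∃ (e : OpenPartialHomeomorph S (Euc 2)) (m : ℝ),
      ∀ (U : Set S) (ν : ∀ x, TangentSpace (𝓡 3) (f x)),
        IsOpen U → p ∈ U → IsUnitNormalOn g f ν U → ∃ d b k, IsSwallowtailChart g f ν p e m d b k := by
  obtain ⟨e, φ, he, hφ, he0, hφ0, hstd⟩ := hp
  have hG : (localMetric g φ 0).PosDef := by
    rw [← hφ0]; exact hφ.isMetricAt.self_of_nhds.2
  have hpos : 0 < gInner (localMetric g φ) 0 (basisVec 0) (basisVec 0) :=
    gInner_self_pos hG (by simp [basisVec])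
  set r := √(gInner (localMetric g φ) 0 (basisVec 0) (basisVec 0)) with hr
  have hr0 : 0 < r := Real.sqrt_pos.2 hpos
  have hc : (1 / r : ℝ) ≠ 0 := by positivity
  -- At the origin F_v is c times the first coordinate vector, whose length is r.
  set c := 1 / r with hcdef
  have hE : IsCoordAt (e.transHomeomorph (flattening c hc)) p :=
    he.transHomeomorph _ (contDiff_flattening c hc) (contDiff_flattening_symm c hc)
  have hE0 : e.transHomeomorph (flattening c hc) p = 0 := by
    change flattening c hc (e p) = 0
    rw [he0]
    exact eq_zero_of_coord (by simp [flattening]) (by simp [flattening])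
  have hF : localMap f (e.transHomeomorph (flattening c hc)) φ =ᶠ[𝓝 0] flatSwallowtail c := by
    have h0 : (flattening c hc).symm 0 = 0 :=
      eq_zero_of_coord (by simp [flattening]) (by simp [flattening])
    have h1 : Tendsto (flattening c hc).symm (𝓝 0) (𝓝 0) := by
      have := (flattening c hc).symm.continuous.tendsto 0
      rwa [h0] at this
    filter_upwards [h1.eventually hstd] with z hz
    rw [← stdSwallowtail_flattening_symm c hc, ← hz]
    rfl
  have hF0 : localMap f (e.transHomeomorph (flattening c hc)) φ 0 = φ (f p) := by
    rw [← hE0, localMap_self hE]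
  refine ⟨e.transHomeomorph (flattening c hc), 12 / c, fun U ν hU hpU hν => ?_⟩
  have hN := hν.localField hU hpU hf hE hφ
  rw [hE0] at hN
  have H := swallowtailFrame_flat (G := localMetric g φ)
    (N := localField f ν (e.transHomeomorph (flattening c hc)) φ) hc hF
    (by rw [hF0]; exact hφ.isMetricAt) hN (by
      rw [(hF.pderiv 1).self_of_nhds, (pderiv_flatSwallowtail c 0).2, hF0, hφ0]
      have h1 : (!₂[c, 2 * c * (0 : Euc 2) 0, c * (0 : Euc 2) 0 ^ 2] : Euc 3) =
          c • basisVec 0 := by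
        ext i; fin_cases i <;> simp [basisVec]
      rw [h1, gInner_smul_left, gInner_smul_right, ← Real.sq_sqrt hpos.le, ← hr, hcdef]
      field_simp)
  refine ⟨frameGram (localMetric g φ) (localMap f (e.transHomeomorph (flattening c hc)) φ)
      (fun z => !₂[0, 2 * c, 2 * c * z 0]),
    frameBending (localMetric g φ) (localMap f (e.transHomeomorph (flattening c hc)) φ)
      (localField f ν (e.transHomeomorph (flattening c hc)) φ) (fun z => !₂[0, 2 * c, 2 * c * z 0]),
    frameNormalCurvature (localMetric g φ) (localMap f (e.transHomeomorph (flattening c hc)) φ)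
      (localField f ν (e.transHomeomorph (flattening c hc)) φ), hE, hE0, fun φ' hφ' => ?_⟩
  have hchange := localMap_change (ν := ν) hf hE hφ hφ'
  rw [hE0] at hchange
  have I : IsIsometryAt (localMetric g φ) (localMetric g φ') (φ' ∘ φ.symm)
      (localMap f (e.transHomeomorph (flattening c hc)) φ 0) := by
    rw [hF0]; exact hφ.isIsometryAt hφ'
  exact ⟨_, H.change_coord I (hchange.mono fun _ h => h.1) (hchange.mono fun _ h => h.2)⟩

end

/-! ### Consequences for fronts near a swallowtail -/

/-- Off the axis a null vector would be a linear relation between h and F_v; on the axis X is null.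
-/
theorem FrameAt.injective_iff {G : Euc 3 → Matrix (Fin 3) (Fin 3) ℝ} {F N h : Euc 2 → Euc 3}
    {m : ℝ} {x : Euc 2} (H : FrameAt G F N h m x) :
    (∃ w ≠ 0, fderiv ℝ F x w = 0) ↔ x 1 = 0 := by
  constructor
  · rintro ⟨w, hw, h0⟩
    by_contra hx
    rw [H.fderiv_eq] at h0
    have h1 : w 0 * x 1 = 0 := by
      have h2 : gram G (F x) ((w 0 * x 1) • h x + (w 1 - m * x 0 * w 0) • pderiv 1 F x)
          (pderiv 1 F x) = (w 0 * x 1) ^ 2 * gram G (F x) (h x) (pderiv 1 F x) := by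
        have hs := posDef_symm H.posDef.self_of_nhds
        simp only [gram, gInner_add_left, gInner_add_right, gInner_smul_left, gInner_smul_right,
          gInner_comm hs (pderiv 1 F x) (h x)]
        ring
      rw [h0] at h2
      simp only [gram, gInner_zero_left, zero_mul] at h2
      have h3 := mul_eq_zero.1 (h2.symm.trans (by ring))
      exact pow_eq_zero_iff (two_ne_zero) |>.1 (h3.resolve_right H.indep)
    have hw0 : w 0 = 0 := (mul_eq_zero.1 h1).resolve_right hx
    rw [h1, hw0, zero_smul, zero_add, mul_zero, sub_zero] at h0
    refine hw (eq_zero_of_coord hw0 ((smul_eq_zero.1 h0).resolve_right fun hA => H.indep ?_))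
    simp [gram, hA, gInner_zero_right]
  · intro hx
    refine ⟨nullDir m x, fun h0 => ?_, ?_⟩
    · have := congrArg (fun v : Euc 2 => v 0) h0
      simp [nullDir] at this
    · rw [H.fderiv_eq, hx]
      simp [nullDir]

section

variable {S : Type*} [TopologicalSpace S] [ChartedSpace (Euc 2) S]
  {M : Type*} [TopologicalSpace M] [ChartedSpace (Euc 3) M] [IsManifold (𝓡 3) ∞ M]
  {g : RMetric M} {f : S → M} {ν : ∀ x, TangentSpace (𝓡 3) (f x)} {p : S} {m d b k : ℝ}
  {e e' : OpenPartialHomeomorph S (Euc 2)} {φ φ' : OpenPartialHomeomorph M (Euc 3)}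

namespace IsSwallowtailChart

theorem isSingularPt_iff (K : IsSwallowtailChart g f ν p e m d b k)
    (hf : ContMDiff (𝓡 2) (𝓡 3) ∞ f) : ∀ᶠ x in 𝓝 p, IsSingularPt f x ↔ e x 1 = 0 := by
  obtain ⟨φ, hφ⟩ : ∃ φ, IsCoordAt φ (f p) :=
    ⟨chartAt (Euc 3) (f p), IsManifold.chart_mem_maximalAtlas _, mem_chart_source _ _⟩
  obtain ⟨h, H, -⟩ := K.frame φ hφ
  have h1 := H.frameAt.eventually
  rw [← K.base, K.coord.eventually_iff] at h1
  filter_upwards [h1, eventually_isCoordAt hf K.coord hφ] with x h2 h3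
  rw [_root_.isSingularPt_iff hf h3.1 h3.2, h2.injective_iff]

theorem isAdapted (K : IsSwallowtailChart g f ν p e m d b k)
    (hf : ContMDiff (𝓡 2) (𝓡 3) ∞ f) : IsAdapted g f p e := by
  obtain ⟨φ, hφ⟩ : ∃ φ, IsCoordAt φ (f p) :=
    ⟨chartAt (Euc 3) (f p), IsManifold.chart_mem_maximalAtlas _, mem_chart_source _ _⟩
  obtain ⟨h, H, -⟩ := K.frame φ hφ
  refine ⟨K.coord, K.base, ?_, K.isSingularPt_iff hf, ?_⟩
  · rw [mfderiv_coordVec_eq_zero_iff hf K.coord hφ, K.base, pderiv, H.fderiv_zero]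
    simp [basisVec]
  · rw [tangentNorm_coordVec hf K.coord hφ, K.base, gNorm, H.norm_one, Real.sqrt_one]

theorem pos (K : IsSwallowtailChart g f ν p e m d b k) : 0 < d ∧ m ≠ 0 := by
  obtain ⟨h, H, h1, -⟩ := K.frame (chartAt (Euc 3) (f p))
    ⟨IsManifold.chart_mem_maximalAtlas _, mem_chart_source _ _⟩
  exact ⟨h1 ▸ H.frameAt.gram_pos, H.ne_zero⟩

/-- The change from the coordinates `e'` to a swallowtail chart. -/
theorem transition (K : IsSwallowtailChart g f ν p e m d b k) (he' : IsCoordAt e' p)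
    (h0 : e' p = 0) : (∀ᶠ z in 𝓝 (0 : Euc 2), ContDiffAt ℝ ∞ (e ∘ e'.symm) z) ∧
      (e ∘ e'.symm) 0 = 0 ∧ jacobian (e ∘ e'.symm) 0 ≠ 0 := by
  refine ⟨?_, ?_, ?_⟩
  · rw [← h0, he'.eventually_iff]
    filter_upwards [K.coord.eventually, he'.eventually] with x h h'
      using h.contDiffAt_transition h'
  · rw [Function.comp_apply, ← h0, e'.left_inv he'.2, K.base, h0]
  · rw [← h0]
    exact jacobian_ne_of_injective (K.coord.transition_injective he')

theorem localMap_eq (K : IsSwallowtailChart g f ν p e m d b k) (he' : IsCoordAt e' p)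
    (h0 : e' p = 0) : localMap f e' φ =ᶠ[𝓝 0] localMap f e φ ∘ (e ∘ e'.symm) := by
  rw [← h0]; exact localMap_transition K.coord he'

theorem localField_eq (K : IsSwallowtailChart g f ν p e m d b k) (he' : IsCoordAt e' p)
    (h0 : e' p = 0) : localField f ν e' φ =ᶠ[𝓝 0] localField f ν e φ ∘ (e ∘ e'.symm) := by
  rw [← h0]; exact localField_transition K.coord he'

/-- In both charts the singular set is the first axis, which is why the transition maps axis to
axis. -/
theorem isAdaptedChange (K : IsSwallowtailChart g f ν p e m d b k)
    (hf : ContMDiff (𝓡 2) (𝓡 3) ∞ f) (he' : IsAdapted g f p e') (hφ : IsCoordAt φ (f p)) :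
    IsAdaptedChange (localMap f e φ) (localMetric g φ) (e ∘ e'.symm) := by
  obtain ⟨hc, h0, hu, hsing, hv⟩ := he'
  obtain ⟨h1, h2, h3⟩ := K.transition hc h0
  have heq := K.localMap_eq (φ := φ) hc h0
  refine ⟨h1, h2, h3, ?_, ?_, ?_⟩
  · rw [← h0, hc.eventually_iff]
    filter_upwards [hsing, K.isSingularPt_iff hf, hc.eventually] with x h4 h5 h6 h7
    rw [Function.comp_apply, e'.left_inv h6.2]
    exact h5.1 (h4.2 h7)
  · rw [← (heq.pderiv 0).self_of_nhds]
    have := (mfderiv_coordVec_eq_zero_iff hf hc hφ 0).1 hu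
    rwa [h0] at this
  · rw [tangentNorm_coordVec hf hc hφ, h0, gNorm, Real.sqrt_eq_one] at hv
    rw [← (heq.pderiv 1).self_of_nhds]
    have h4 : localMap f e φ 0 = localMap f e' φ 0 := by
      rw [heq.self_of_nhds, Function.comp_apply, h2]
    rw [h4, hv]

theorem isLimitingNormalCurvature [IsManifold (𝓡 2) ∞ S]
    (K : IsSwallowtailChart g f ν p e m d b k)
    (hf : ContMDiff (𝓡 2) (𝓡 3) ∞ f) : IsLimitingNormalCurvature g f ν p k := by
  refine ⟨?_, fun e' φ he' hφ => ?_⟩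
  · obtain ⟨φ, hφ⟩ : ∃ φ, IsCoordAt φ (f p) :=
      ⟨chartAt (Euc 3) (f p), IsManifold.chart_mem_maximalAtlas _, mem_chart_source _ _⟩
    obtain ⟨h, H, -⟩ := K.frame φ hφ
    -- The chart `e` has f_u = 0 at p while admissible coordinates ask for f_v = 0, so the two
    -- coordinates are swapped.
    let ψ : Euc 2 ≃ₗᵢ[ℝ] Euc 2 := LinearIsometryEquiv.piLpCongrLeft 2 ℝ ℝ (Equiv.swap 0 1)
    have hc : IsCoordAt (e.transHomeomorph ψ.toHomeomorph) p :=
      K.coord.transHomeomorph _ ψ.toContinuousLinearEquiv.contDiff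
        ψ.symm.toContinuousLinearEquiv.contDiff
    have h0 : e.transHomeomorph ψ.toHomeomorph p = 0 := by
      change ψ (e p) = 0
      rw [K.base, map_zero]
    refine ⟨e.transHomeomorph ψ.toHomeomorph, hc, h0, ?_⟩
    rw [mfderiv_coordVec_eq_zero_iff hf hc hφ, h0]
    have h1 : HasFDerivAt (localMap f e φ) (fderiv ℝ (localMap f e φ) 0) (ψ.symm 0) := by
      rw [map_zero]
      exact (H.frameAt.smooth.self_of_nhds.differentiableAt (by simp)).hasFDerivAt
    have h2 : HasFDerivAt (localMap f (e.transHomeomorph ψ.toHomeomorph) φ)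
        ((fderiv ℝ (localMap f e φ) 0).comp
          (ψ.symm.toContinuousLinearEquiv : Euc 2 →L[ℝ] Euc 2)) 0 :=
      h1.comp (0 : Euc 2) ψ.symm.toContinuousLinearEquiv.hasFDerivAt
    rw [pderiv, h2.fderiv]
    change fderiv ℝ (localMap f e φ) 0 (ψ.symm (basisVec 1)) = 0
    rw [H.fderiv_zero]
    simp [ψ, basisVec]
  · obtain ⟨hc, h0, hv⟩ := he'
    obtain ⟨h, H, -, -, hk⟩ := K.frame φ hφ
    obtain ⟨h1, h2, h3⟩ := K.transition hc h0
    have heq := K.localMap_eq (φ := φ) hc h0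
    rw [mfderiv_coordVec_eq_zero_iff hf hc hφ, h0, (heq.pderiv 1).self_of_nhds] at hv
    rw [← hk, ← H.normalCurvature_comp h1 h2 h3 hv]
    simp only
    rw [covDeriv_congr heq (heq.pderiv 0), (heq.pderiv 0).self_of_nhds,
      (K.localField_eq (φ := φ) hc h0).self_of_nhds, heq.self_of_nhds]

/-- The sign factor is the one occurring in `isKHat`, so it cancels from K̂ = κ_ν κ_H. -/
theorem isKappaH (K : IsSwallowtailChart g f ν p e m d b k)
    (hf : ContMDiff (𝓡 2) (𝓡 3) ∞ f) (he' : IsAdapted g f p e') :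
    IsKappaH g f ν p e' (fderiv ℝ (e ∘ e'.symm) 0 (basisVec 1) 1 * (b / d)) := by
  intro φ hφ
  obtain ⟨h, H, hd, hb, -⟩ := K.frame φ hφ
  have h1 := (K.isAdaptedChange hf he' hφ).tendsto_meanCurvature H
  rw [hd, hb] at h1
  refine h1.congr' ?_
  filter_upwards [nhdsWithin_le_nhds (K.localMap_eq (φ := φ) he'.1 he'.2.1).eventuallyEq_nhds,
    nhdsWithin_le_nhds (K.localField_eq (φ := φ) he'.1 he'.2.1).eventuallyEq_nhds] with z h2 h3
  rw [meanCurvature_congr h2 h3]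

theorem isKHat (K : IsSwallowtailChart g f ν p e m d b k)
    (hf : ContMDiff (𝓡 2) (𝓡 3) ∞ f) (he' : IsAdapted g f p e') :
    IsKHat g f p e' (fderiv ℝ (e ∘ e'.symm) 0 (basisVec 1) 1 * (b * k / d)) := by
  intro φ hφ
  obtain ⟨h, H, hd, hb, hk⟩ := K.frame φ hφ
  have h1 := (K.isAdaptedChange hf he' hφ).tendsto_gaussCurvature H
  rw [hd, hb, hk] at h1
  refine h1.congr' ?_
  filter_upwards [nhdsWithin_le_nhds
    (K.localMap_eq (φ := φ) he'.1 he'.2.1).eventuallyEq_nhds.eventually_nhds] with z h2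
  rw [gaussCurvature_congr (h2.mono fun y hy => firstForm_congr hy)]

theorem sign_sq (K : IsSwallowtailChart g f ν p e m d b k)
    (hf : ContMDiff (𝓡 2) (𝓡 3) ∞ f) (he' : IsAdapted g f p e') :
    fderiv ℝ (e ∘ e'.symm) 0 (basisVec 1) 1 ^ 2 = 1 := by
  obtain ⟨h, H, -⟩ := K.frame (chartAt (Euc 3) (f p))
    ⟨IsManifold.chart_mem_maximalAtlas _, mem_chart_source _ _⟩
  exact (K.isAdaptedChange hf he' (φ := chartAt (Euc 3) (f p))
    ⟨IsManifold.chart_mem_maximalAtlas _, mem_chart_source _ _⟩).fderiv_one_snd_sq H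

end IsSwallowtailChart

end

/-! ### The singular curve near a swallowtail -/

section

variable {n : ℕ} {X : Type*} [TopologicalSpace X] [ChartedSpace (Euc n) X]
  {e : OpenPartialHomeomorph X (Euc n)} {γ : ℝ → X} {t : ℝ}

/-- The velocity of a curve, as a vector of the model space. -/
def curveDeriv (γ : ℝ → X) (t : ℝ) : Euc n := mfderiv 𝓘(ℝ, ℝ) (𝓡 n) γ t (1 : ℝ)

theorem IsCoordAt.contDiffAt_curve (he : IsCoordAt e (γ t))
    (hγ : ContMDiffAt 𝓘(ℝ, ℝ) (𝓡 n) ∞ γ t) : ContDiffAt ℝ ∞ (fun s => e (γ s)) t :=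
  contMDiffAt_iff_contDiffAt.1 (ContMDiffAt.comp t he.contMDiffAt hγ)

theorem IsCoordAt.deriv_curve (he : IsCoordAt e (γ t))
    (hγ : MDifferentiableAt 𝓘(ℝ, ℝ) (𝓡 n) γ t) :
    deriv (fun s => e (γ s)) t = chartDeriv e (γ t) (curveDeriv γ t) := by
  have h1 : fderiv ℝ (e ∘ γ) t = mfderiv 𝓘(ℝ, ℝ) (𝓡 n) (e ∘ γ) t := mfderiv_eq_fderiv.symm
  have h2 : mfderiv 𝓘(ℝ, ℝ) (𝓡 n) (e ∘ γ) t =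
      (mfderiv (𝓡 n) (𝓡 n) e (γ t)).comp (mfderiv 𝓘(ℝ, ℝ) (𝓡 n) γ t) :=
    mfderiv_comp _ (he.mdifferentiable.mdifferentiableAt he.2) hγ
  change fderiv ℝ (e ∘ γ) t 1 = _
  rw [h1, h2]
  rfl

end

theorem IsSingularCurve.tendsto {S M : Type*} [TopologicalSpace S] [ChartedSpace (Euc 2) S]
    [TopologicalSpace M] [ChartedSpace (Euc 3) M] {f : S → M} {p : S} {γ : ℝ → S}
    (hγ : IsSingularCurve f p γ) : Tendsto γ (𝓝 0) (𝓝 p) := by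
  have := hγ.smooth.self_of_nhds.continuousAt.tendsto
  rwa [hγ.base] at this

section

variable {S : Type*} [TopologicalSpace S] [ChartedSpace (Euc 2) S]
  {M : Type*} [TopologicalSpace M] [ChartedSpace (Euc 3) M] [IsManifold (𝓡 3) ∞ M]
  {g : RMetric M} {f : S → M} {ν : ∀ x, TangentSpace (𝓡 3) (f x)} {p : S} {m d b k : ℝ}
  {e e' : OpenPartialHomeomorph S (Euc 2)} {φ φ' : OpenPartialHomeomorph M (Euc 3)} {γ : ℝ → S}
  {κ : ℝ → ℝ}

namespace IsSwallowtailChart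

theorem isAxisCurve (K : IsSwallowtailChart g f ν p e m d b k)
    (hf : ContMDiff (𝓡 2) (𝓡 3) ∞ f) (hγ : IsSingularCurve f p γ) :
    IsAxisCurve fun t => e (γ t) := by
  have hcoord := hγ.tendsto.eventually K.coord.eventually
  refine ⟨?_, ?_, fun h0 => hγ.regular ?_, ?_⟩
  · filter_upwards [hγ.smooth, hcoord] with t h1 h2 using h2.contDiffAt_curve h1
  · rw [hγ.base, K.base]
  · have h1 := hcoord.self_of_nhds
    rw [h1.deriv_curve (hγ.smooth.self_of_nhds.mdifferentiableAt (by simp))] at h0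
    have h2 := congrArg (chartDerivSymm e (e (γ 0))) h0
    rw [h1.chartDerivSymm_chartDeriv, map_zero] at h2
    exact ContinuousLinearMap.ext_ring h2
  · filter_upwards [hγ.singular, hγ.tendsto.eventually (K.isSingularPt_iff hf)] with t h1 h2
      using h2.1 h1

/-- The curvatures may be computed in any source chart `e'`; passing to the swallowtail chart brings
the formulas on the axis into play. The parameter 0 is excluded since they require u ≠ 0. -/
theorem isAxisChange (K : IsSwallowtailChart g f ν p e m d b k)
    (hf : ContMDiff (𝓡 2) (𝓡 3) ∞ f) (hγ : IsSingularCurve f p γ) (he' : IsCoordAt e' p) :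
    ∀ᶠ t in 𝓝[≠] (0 : ℝ), IsAxisChange (localMap f e φ) (localMap f e' φ) (localField f ν e φ)
      (localField f ν e' φ) (e ∘ e'.symm) (fun s => e' (γ s)) t ∧
      (e ∘ e'.symm) (e' (γ t)) = e (γ t) := by
  have hA := K.isAxisCurve hf hγ
  have h := hγ.tendsto.eventually (K.coord.eventually.and he'.eventually)
  filter_upwards [nhdsWithin_le_nhds h.eventually_nhds, hA.eventually_fst_ne,
    nhdsWithin_le_nhds hA.axis.eventually_nhds, nhdsWithin_le_nhds hγ.smooth] with t h1 h2 h3 h4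
  have h5 := h1.self_of_nhds
  have heq : ∀ s, IsCoordAt e' (γ s) → (e ∘ e'.symm) (e' (γ s)) = e (γ s) := fun s hs => by
    rw [Function.comp_apply, e'.left_inv hs.2]
  refine ⟨⟨?_, h5.2.contDiffAt_curve h4,
    jacobian_ne_of_injective (h5.1.transition_injective h5.2), ?_, ?_,
    localMap_transition h5.1 h5.2, localField_transition h5.1 h5.2⟩, heq t h5.2⟩
  · rw [h5.2.eventually_iff]
    filter_upwards [h5.1.eventually, h5.2.eventually] with x h6 h7 using h6.contDiffAt_transition h7
  · filter_upwards [h1, h3] with s h6 h7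
    rw [heq s h6.2]
    exact h7
  · rw [heq t h5.2]
    exact h2

theorem tendsto_arclength (K : IsSwallowtailChart g f ν p e m d b k)
    (hf : ContMDiff (𝓡 2) (𝓡 3) ∞ f) (hγ : IsSingularCurve f p γ) :
    Tendsto (fun t => √|arclength g f γ t| / |e (γ t) 0|) (𝓝[≠] 0) (𝓝 √(|m| / 2)) := by
  obtain ⟨φ, hφ⟩ : ∃ φ, IsCoordAt φ (f p) :=
    ⟨chartAt (Euc 3) (f p), IsManifold.chart_mem_maximalAtlas _, mem_chart_source _ _⟩
  obtain ⟨h, H, -⟩ := K.frame φ hφ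
  refine (K.isAxisCurve hf hγ).tendsto_arclength H ?_
  have hco := hγ.tendsto.eventually (eventually_isCoordAt hf K.coord hφ)
  filter_upwards [hco.eventually_nhds, hγ.smooth] with t h1 h2
  have h3 : (localMap f e φ ∘ fun s => e (γ s)) =ᶠ[𝓝 t] fun s => φ ((f ∘ γ) s) :=
    h1.mono fun s hs => localMap_self hs.1
  have h5 := h1.self_of_nhds
  have h4 : IsCoordAt φ ((f ∘ γ) t) := h5.2
  rw [h3.deriv_eq, h4.deriv_curve ((hf.contMDiffAt.comp t h2).mdifferentiableAt (by simp)),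
    localMap_self h5.1, gNorm]
  change _ = √(gInner (localMetric g φ) (φ ((f ∘ γ) t)) _ _)
  rw [gInner_localMetric_chartDeriv h4]
  rfl

theorem tendsto_curve (K : IsSwallowtailChart g f ν p e m d b k)
    (hf : ContMDiff (𝓡 2) (𝓡 3) ∞ f) (hγ : IsSingularCurve f p γ) :
    Tendsto (fun t => e (γ t)) (𝓝[≠] 0) (𝓝 0) :=
  (K.isAxisCurve hf hγ).tendsto.mono_left nhdsWithin_le_nhds

theorem tendsto_singularCurvature (K : IsSwallowtailChart g f ν p e m d b k)
    (hf : ContMDiff (𝓡 2) (𝓡 3) ∞ f) (hγ : IsSingularCurve f p γ)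
    (hκ : IsSingularCurvatureAlong g f ν p γ κ) :
    Tendsto (fun t => 2 * √2 * (√|arclength g f γ t| * |κ t|)) (𝓝[≠] 0)
      (𝓝 (2 * √(d / |m|))) := by
  obtain ⟨e', φ, he', hφ, hκ⟩ := hκ
  obtain ⟨h, H, hd, -⟩ := K.frame φ hφ
  rw [← hd]
  have hx := K.tendsto_curve hf hγ
  refine H.tendsto_singularCurvature hx (K.isAxisCurve hf hγ).eventually_fst_ne
    (K.tendsto_arclength hf hγ) ?_
  filter_upwards [hκ, K.isAxisChange (φ := φ) hf hγ he', hx.eventually H.frameAt.eventually]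
    with t h1 h2 h3
  have h4 := h2.1.abs_singularCurvature (by rw [h2.2]; exact h3) H.ne_zero h1
  rwa [h2.2] at h4

theorem tendsto_cuspidalCurvature (K : IsSwallowtailChart g f ν p e m d b k)
    (hf : ContMDiff (𝓡 2) (𝓡 3) ∞ f) (hγ : IsSingularCurve f p γ)
    (hκ : IsCuspidalCurvatureAlong g f p γ κ) :
    Tendsto (fun t => √(2 * √2) / 2 * |(|arclength g f γ t| ^ (1 / 4 : ℝ) * κ t)|) (𝓝[≠] 0)
      (𝓝 (√(2 * √(d / |m|)) * |b / d|)) := by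
  obtain ⟨e', φ, he', hφ, hκ⟩ := hκ
  obtain ⟨h, H, hd, hb, -⟩ := K.frame φ hφ
  rw [← hd, ← hb]
  have hx := K.tendsto_curve hf hγ
  refine H.tendsto_cuspidalCurvature hx (K.isAxisCurve hf hγ).eventually_fst_ne
    (K.tendsto_arclength hf hγ) ?_
  filter_upwards [hκ, K.isAxisChange (φ := φ) hf hγ he', hx.eventually H.frameAt.eventually]
    with t h1 h2 h3
  have h4 := h2.1.abs_cuspidalCurvature (by rw [h2.2]; exact h3) H.ne_zero h1
  rwa [h2.2] at h4

/-- The singular curve given by the `u`-axis. -/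
theorem isSingularCurve_axis [IsManifold (𝓡 2) ∞ S] (K : IsSwallowtailChart g f ν p e m d b k)
    (hf : ContMDiff (𝓡 2) (𝓡 3) ∞ f) :
    IsSingularCurve f p fun t => e.symm (t • basisVec 0) := by
  have hline : ContDiff ℝ ∞ fun t : ℝ => t • (basisVec 0 : Euc 2) := contDiff_id.smul contDiff_const
  have ht : Tendsto (fun t : ℝ => t • (basisVec 0 : Euc 2)) (𝓝 0) (𝓝 (e p)) := by
    have := hline.continuous.tendsto 0
    rwa [zero_smul, ← K.base] at this
  have htarget := ht.eventually K.coord.eventually_target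
  have hγ0 : Tendsto (fun t : ℝ => e.symm (t • basisVec 0)) (𝓝 0) (𝓝 p) := by
    have := (e.continuousAt_symm (e.map_source K.coord.2)).tendsto.comp ht
    rwa [e.left_inv K.coord.2] at this
  have hsm : ∀ᶠ t in 𝓝 (0 : ℝ),
      ContMDiffAt 𝓘(ℝ, ℝ) (𝓡 2) ∞ (fun t => e.symm (t • basisVec 0)) t := by
    filter_upwards [htarget] with t h
    exact ContMDiffAt.comp (g := e.symm) t (contMDiffAt_symm_of_mem_maximalAtlas K.coord.1 h.1)
      hline.contMDiff.contMDiffAt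
  have hbase : e.symm ((0 : ℝ) • basisVec 0) = p := by
    rw [zero_smul, ← K.base, e.left_inv K.coord.2]
  refine ⟨hsm, hbase, fun h0 => ?_, ?_, fun T hT => ?_⟩
  · have h1 : IsCoordAt e ((fun t : ℝ => e.symm (t • basisVec 0)) 0) := by
      change IsCoordAt e (e.symm ((0 : ℝ) • basisVec 0))
      rw [hbase]; exact K.coord
    have h2 := h1.deriv_curve (hsm.self_of_nhds.mdifferentiableAt (by simp))
    have h3 : (fun s : ℝ => e (e.symm (s • basisVec 0))) =ᶠ[𝓝 0] fun s => s • basisVec 0 :=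
      htarget.mono fun s hs => e.right_inv hs.1
    have h5 : HasDerivAt (fun s : ℝ => s • (basisVec 0 : Euc 2)) ((1 : ℝ) • basisVec 0) 0 :=
      (hasDerivAt_id (0 : ℝ)).smul_const _
    rw [h3.deriv_eq, h5.deriv, one_smul, curveDeriv, h0] at h2
    have h4 := congrArg (fun v : Euc 2 => v 0) (h2.trans (map_zero _))
    simp [basisVec] at h4
  · filter_upwards [htarget, hγ0.eventually (K.isSingularPt_iff hf)] with t h1 h2
    rw [h2, e.right_inv h1.1]
    simp [basisVec]
  · have h1 : Tendsto (fun x => e x 0) (𝓝 p) (𝓝 0) := by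
      have h2 : Tendsto e (𝓝 p) (𝓝 0) := by
        have := e.continuousAt K.coord.2
        rwa [ContinuousAt, K.base] at this
      have h3 := ((contDiff_euc_coord (n := 2) 0).continuous.tendsto 0).comp h2
      exact h3
    filter_upwards [h1.eventually hT, K.isSingularPt_iff hf, K.coord.eventually] with x h2 h3 h4 h5
    refine ⟨e x 0, h2, ?_⟩
    have h6 : (e x 0) • (basisVec 0 : Euc 2) = e x := by
      conv_rhs => rw [euc_two_eq (e x), h3.1 h5, zero_smul, add_zero]
    simp only [h6, e.left_inv h4.2]

theorem exists_null (K : IsSwallowtailChart g f ν p e m d b k) (hφ : IsCoordAt φ (f p)) :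
    ∀ᶠ t in 𝓝[≠] (0 : ℝ), ∃ ε : ℝ,
      IsPositiveFrame (deriv (fun s : ℝ => e (e.symm (s • basisVec 0))) t)
        (ε • nullDir m (e (e.symm (t • basisVec 0)))) ∧
      ∀ᶠ s in 𝓝 t, fderiv ℝ (localMap f e φ) (e (e.symm (s • basisVec 0)))
        (ε • nullDir m (e (e.symm (s • basisVec 0)))) = 0 := by
  obtain ⟨h, H, -⟩ := K.frame φ hφ
  have ht : Tendsto (fun t : ℝ => t • (basisVec 0 : Euc 2)) (𝓝 0) (𝓝 0) := by
    have h1 : Continuous fun t : ℝ => t • (basisVec 0 : Euc 2) := by fun_prop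
    have := h1.tendsto 0
    rwa [zero_smul] at this
  have htarget : ∀ᶠ t in 𝓝 (0 : ℝ), t • basisVec 0 ∈ e.target := by
    refine ht.eventually ?_
    rw [← K.base]
    exact e.open_target.mem_nhds (e.map_source K.coord.2)
  filter_upwards [nhdsWithin_le_nhds htarget.eventually_nhds,
    nhdsWithin_le_nhds (ht.eventually H.frameAt.eventually).eventually_nhds,
    self_mem_nhdsWithin] with t h1 h2 h3
  have h4 : (fun s : ℝ => e (e.symm (s • basisVec 0))) =ᶠ[𝓝 t] fun s => s • basisVec 0 :=
    h1.mono fun s hs => e.right_inv hs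
  have h5 : HasDerivAt (fun s : ℝ => s • (basisVec 0 : Euc 2)) ((1 : ℝ) • basisVec 0) t :=
    (hasDerivAt_id t).smul_const _
  -- The frame (∂_u, ε(1, m t)) has determinant ε m t, so ε = m t makes it (m t)² > 0 on both sides
  -- of p.
  refine ⟨m * t, ?_, ?_⟩
  · rw [h4.deriv_eq, h5.deriv, e.right_inv h1.self_of_nhds]
    have h6 : m * t ≠ 0 := mul_ne_zero H.ne_zero h3
    simpa [IsPositiveFrame, nullDir, basisVec] using mul_self_pos.2 h6
  · filter_upwards [h1, h2] with s h6 h7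
    rw [e.right_inv h6, map_smul, h7.fderiv_eq]
    simp [nullDir, basisVec]

/-- Ensures that the limit defining τ_s is not vacuous. -/
theorem exists_isSingularCurvatureAlong (K : IsSwallowtailChart g f ν p e m d b k) :
    ∃ κ, IsSingularCurvatureAlong g f ν p (fun t => e.symm (t • basisVec 0)) κ := by
  obtain ⟨φ, hφ⟩ : ∃ φ, IsCoordAt φ (f p) :=
    ⟨chartAt (Euc 3) (f p), IsManifold.chart_mem_maximalAtlas _, mem_chart_source _ _⟩
  obtain ⟨κ, hκ⟩ := Filter.Eventually.choice ((K.exists_null hφ).mono fun t ⟨ε, h1, h2⟩ =>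
    (⟨_, _, h2.self_of_nhds, h1, rfl⟩ : ∃ k, IsSingularCurvatureAt (localMetric g φ)
      (localMap f e φ) (localField f ν e φ) (fun s : ℝ => e (e.symm (s • basisVec 0))) t k))
  exact ⟨κ, e, φ, K.coord, hφ, hκ⟩

theorem exists_isCuspidalCurvatureAlong (K : IsSwallowtailChart g f ν p e m d b k) :
    ∃ κ, IsCuspidalCurvatureAlong g f p (fun t => e.symm (t • basisVec 0)) κ := by
  obtain ⟨φ, hφ⟩ : ∃ φ, IsCoordAt φ (f p) :=
    ⟨chartAt (Euc 3) (f p), IsManifold.chart_mem_maximalAtlas _, mem_chart_source _ _⟩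
  obtain ⟨κ, hκ⟩ := Filter.Eventually.choice ((K.exists_null hφ).mono fun t ⟨ε, h1, h2⟩ =>
    (⟨_, fun z => ε • nullDir m z, Eventually.of_forall fun z =>
      (contDiff_nullDir.const_smul ε).contDiffAt, h2, h1, rfl⟩ :
      ∃ k, IsCuspidalCurvatureAt (localMetric g φ)
        (localMap f e φ) (fun s : ℝ => e (e.symm (s • basisVec 0))) t k))
  exact ⟨κ, e, φ, K.coord, hφ, hκ⟩

theorem isLimitingSingularCurvature [IsManifold (𝓡 2) ∞ S]
    (K : IsSwallowtailChart g f ν p e m d b k) (hf : ContMDiff (𝓡 2) (𝓡 3) ∞ f) :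
    IsLimitingSingularCurvature g f ν p (2 * √(d / |m|)) := by
  obtain ⟨κ, hκ⟩ := K.exists_isSingularCurvatureAlong
  exact ⟨⟨_, κ, K.isSingularCurve_axis hf, hκ⟩,
    fun γ κ hγ hκ => K.tendsto_singularCurvature hf hγ hκ⟩

theorem isLimitingCuspidalCurvature [IsManifold (𝓡 2) ∞ S]
    (K : IsSwallowtailChart g f ν p e m d b k) (hf : ContMDiff (𝓡 2) (𝓡 3) ∞ f) :
    IsLimitingCuspidalCurvature g f p (√(2 * √(d / |m|)) * |b / d|) := by
  obtain ⟨κ, hκ⟩ := K.exists_isCuspidalCurvatureAlong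
  exact ⟨⟨_, κ, K.isSingularCurve_axis hf, hκ⟩,
    fun γ κ hγ hκ => K.tendsto_cuspidalCurvature hf hγ hκ⟩

end IsSwallowtailChart

end

/-! ### Intrinsic invariants of a swallowtail -/

theorem IsKappaH.unique {S M : Type*} [TopologicalSpace S] [TopologicalSpace M]
    [ChartedSpace (Euc 3) M] [IsManifold (𝓡 3) ∞ M] {g : RMetric M} {f : S → M}
    {ν : ∀ x, TangentSpace (𝓡 3) (f x)} {p : S} {e : OpenPartialHomeomorph S (Euc 2)}
    {k k' : ℝ} (h : IsKappaH g f ν p e k) (h' : IsKappaH g f ν p e k') :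
    k = k' := by
  have hφ : IsCoordAt (chartAt (Euc 3) (f p)) (f p) :=
    ⟨IsManifold.chart_mem_maximalAtlas _, mem_chart_source _ _⟩
  have := neBot_nhdsWithin_snd
  exact tendsto_nhds_unique (h _ hφ) (h' _ hφ)

section

variable {S : Type*} [TopologicalSpace S] [ChartedSpace (Euc 2) S]
  {M : Type*} [TopologicalSpace M] [ChartedSpace (Euc 3) M] [IsManifold (𝓡 3) ∞ M]
  {g : RMetric M} {f : S → M} {ν : ∀ x, TangentSpace (𝓡 3) (f x)} {p : S} {m d b k : ℝ}
  {e e' : OpenPartialHomeomorph S (Euc 2)} {φ : OpenPartialHomeomorph M (Euc 3)}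
  {S' : Type*} [TopologicalSpace S'] [ChartedSpace (Euc 2) S']
  {M' : Type*} [TopologicalSpace M'] [ChartedSpace (Euc 3) M'] [IsManifold (𝓡 3) ∞ M']
  {g' : RMetric M'} {f' : S' → M'} {p' : S'} {Φ : S → S'}
  {e₁ : OpenPartialHomeomorph S' (Euc 2)} {φ' : OpenPartialHomeomorph M' (Euc 3)}

theorem IsSwallowtailChart.firstForm_limits (K : IsSwallowtailChart g f ν p e m d b k)
    (hf : ContMDiff (𝓡 2) (𝓡 3) ∞ f) (he' : IsAdapted g f p e') (hφ : IsCoordAt φ (f p)) :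
    ∃ J : ℝ, J ≠ 0 ∧ Tendsto (fun z : Euc 2 =>
        (firstForm (localMetric g φ) (localMap f e' φ) z).det / z 1 ^ 2)
        (𝓝[{x : Euc 2 | x 1 ≠ 0}] 0) (𝓝 (J ^ 2 * d)) ∧
      Tendsto (fun t : ℝ =>
        |firstForm (localMetric g φ) (localMap f e' φ) (t • basisVec 0) 0 1 / t|)
        (𝓝[≠] 0) (𝓝 (|m| * J ^ 2)) := by
  obtain ⟨h, H, hd, -⟩ := K.frame φ hφ
  have hA := K.isAdaptedChange hf he' hφ
  have heq := (K.localMap_eq (φ := φ) he'.1 he'.2.1).eventuallyEq_nhds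
  refine ⟨_, hA.jacobian_ne, ?_, ?_⟩
  · rw [← hd]
    refine (hA.tendsto_det_firstForm H).congr' ?_
    filter_upwards [nhdsWithin_le_nhds heq] with z hz
    rw [firstForm_congr hz]
  · refine (hA.tendsto_firstForm_div H).congr' ?_
    have ht : Tendsto (fun t : ℝ => t • (basisVec 0 : Euc 2)) (𝓝 0) (𝓝 0) := by
      have h1 : Continuous fun t : ℝ => t • (basisVec 0 : Euc 2) := by fun_prop
      have := h1.tendsto 0
      rwa [zero_smul] at this
    filter_upwards [nhdsWithin_le_nhds (ht.eventually heq)] with t hz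
    rw [firstForm_congr hz]

theorem IsSwallowtailChart.abs_sign (K : IsSwallowtailChart g f ν p e m d b k)
    (hf : ContMDiff (𝓡 2) (𝓡 3) ∞ f) (he' : IsAdapted g f p e') :
    |fderiv ℝ (e ∘ e'.symm) 0 (basisVec 1) 1| = 1 :=
  (sq_eq_sq₀ (abs_nonneg _) zero_le_one).1 (by rw [sq_abs, K.sign_sq hf he', one_pow])

/-- Coordinates of the target of a local diffeomorphism induce coordinates of the source. -/
theorem IsLocalDiffeomorphAt.exists_isCoordAt [IsManifold (𝓡 2) ∞ S]
    (hΦ : IsLocalDiffeomorphAt (𝓡 2) (𝓡 2) ∞ Φ p)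
    (he₁ : IsCoordAt e₁ (Φ p)) :
    ∃ e : OpenPartialHomeomorph S (Euc 2), IsCoordAt e p ∧ ∀ᶠ x in 𝓝 p, e x = e₁ (Φ x) := by
  obtain ⟨Ψ, hp, hΨ⟩ := hΦ
  refine ⟨Ψ.toOpenPartialHomeomorph.trans e₁,
    ⟨OpenPartialHomeomorph.mem_maximalAtlas_of_contMDiffOn _ ?_ ?_, ?_⟩, ?_⟩
  · exact (contMDiffOn_of_mem_maximalAtlas he₁.1).comp
      (Ψ.contMDiffOn_toFun.mono fun x hx => hx.1)
      fun x hx => hx.2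
  · exact Ψ.contMDiffOn_invFun.comp
      ((contMDiffOn_symm_of_mem_maximalAtlas he₁.1).mono
        fun x hx => hx.1)
      fun x hx => hx.2
  · rw [OpenPartialHomeomorph.trans_source]
    refine ⟨hp, ?_⟩
    change Ψ p ∈ e₁.source
    rw [← hΨ hp]
    exact he₁.2
  · filter_upwards [Ψ.open_source.mem_nhds hp] with x hx
    rw [hΨ hx]
    rfl

/-- Isometric maps have the same first fundamental form in corresponding coordinates. -/
theorem eventually_gInner_eq (hf : ContMDiff (𝓡 2) (𝓡 3) ∞ f) (hf' : ContMDiff (𝓡 2) (𝓡 3) ∞ f')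
    (hΦ : IsLocalDiffeomorphAt (𝓡 2) (𝓡 2) ∞ Φ p)
    (hiso : ∀ᶠ x in 𝓝 p, ∀ a b : TangentSpace (𝓡 2) x,
      firstFundamentalForm g' f' (Φ x) (mfderiv (𝓡 2) (𝓡 2) Φ x a) (mfderiv (𝓡 2) (𝓡 2) Φ x b)
        = firstFundamentalForm g f x a b)
    (he : IsCoordAt e p) (he₁ : IsCoordAt e₁ (Φ p)) (hee : ∀ᶠ x in 𝓝 p, e x = e₁ (Φ x))
    (hφ : IsCoordAt φ (f p)) (hφ' : IsCoordAt φ' (f' (Φ p))) :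
    ∀ᶠ z in 𝓝 (e p), ∀ a b,
      gInner (localMetric g φ) (localMap f e φ z) (fderiv ℝ (localMap f e φ) z a)
        (fderiv ℝ (localMap f e φ) z b) =
      gInner (localMetric g' φ') (localMap f' e₁ φ' z) (fderiv ℝ (localMap f' e₁ φ') z a)
        (fderiv ℝ (localMap f' e₁ φ') z b) := by
  have hΦc : ContinuousAt Φ p := hΦ.contMDiffAt.continuousAt
  have hΦd : ∀ᶠ x in 𝓝 p, MDifferentiableAt (𝓡 2) (𝓡 2) Φ x := by
    obtain ⟨Ψ, hp, hΨ⟩ := hΦ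
    filter_upwards [Ψ.open_source.mem_nhds hp] with x hx
    exact (Ψ.mdifferentiableAt (by simp) hx).congr_of_eventuallyEq
      (hΨ.eventuallyEq_of_mem (Ψ.open_source.mem_nhds hx))
  rw [he.eventually_iff]
  filter_upwards [eventually_isCoordAt hf he hφ,
    hΦc.eventually (eventually_isCoordAt hf' he₁ hφ'), hee.eventually_nhds, hΦd, hiso]
    with x h1 h2 h3 h4 h5 a b
  refine (gInner_fderiv_localMap hf h1.1 h1.2 a b).trans ((h5 _ _).symm.trans ?_)
  rw [h3.self_of_nhds, gInner_fderiv_localMap hf' h2.1 h2.2]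
  -- Since e = e₁ ∘ Φ near p, dΦ carries the coordinate vectors of `e` to those of `e₁`.
  have key : ∀ a : Euc 2, (mfderiv (𝓡 2) (𝓡 2) Φ x (chartDerivSymm e (e₁ (Φ x)) a) : Euc 2) =
      chartDerivSymm e₁ (e₁ (Φ x)) a := by
    intro a
    have h6 : mfderiv (𝓡 2) (𝓡 2) e x = mfderiv (𝓡 2) (𝓡 2) (e₁ ∘ Φ) x :=
      Filter.EventuallyEq.mfderiv_eq h3
    have h7 : mfderiv (𝓡 2) (𝓡 2) (e₁ ∘ Φ) x =
        (mfderiv (𝓡 2) (𝓡 2) e₁ (Φ x)).comp (mfderiv (𝓡 2) (𝓡 2) Φ x) :=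
      mfderiv_comp _ (h2.1.mdifferentiable.mdifferentiableAt h2.1.2) h4
    have h8 : ∀ v : Euc 2, chartDeriv e x v =
        chartDeriv e₁ (Φ x) (mfderiv (𝓡 2) (𝓡 2) Φ x v : Euc 2) :=
      fun v => DFunLike.congr_fun (h6.trans h7) v
    have h9 := h8 (chartDerivSymm e (e x) a)
    rw [h1.1.chartDeriv_chartDerivSymm, h3.self_of_nhds] at h9
    have h10 := congrArg (chartDerivSymm e₁ (e₁ (Φ x))) h9
    exact ((h2.1.chartDerivSymm_chartDeriv _).symm.trans h10.symm)
  exact congrArg₂ (fun a b : Euc 2 => firstFundamentalForm g' f' (Φ x) a b) (key a) (key b)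

/-- By positive definiteness the kernel of the differential is the null space of the first
fundamental form. Singular points, f_u = 0 and |f_v| = 1 are therefore all read off from that form.
-/
theorem IsAdapted.of_isometric (hf : ContMDiff (𝓡 2) (𝓡 3) ∞ f)
    (hf' : ContMDiff (𝓡 2) (𝓡 3) ∞ f') (hΦ : ContinuousAt Φ p)
    (hA : IsAdapted g' f' (Φ p) e₁) (he : IsCoordAt e p) (hee : ∀ᶠ x in 𝓝 p, e x = e₁ (Φ x))
    (hφ : IsCoordAt φ (f p)) (hφ' : IsCoordAt φ' (f' (Φ p)))
    (heq : ∀ᶠ z in 𝓝 (e p), ∀ a b,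
      gInner (localMetric g φ) (localMap f e φ z) (fderiv ℝ (localMap f e φ) z a)
        (fderiv ℝ (localMap f e φ) z b) =
      gInner (localMetric g' φ') (localMap f' e₁ φ' z) (fderiv ℝ (localMap f' e₁ φ') z a)
        (fderiv ℝ (localMap f' e₁ φ') z b)) : IsAdapted g f p e := by
  obtain ⟨he₁, h0, hu, hsing, hv⟩ := hA
  have h0' : e p = 0 := by rw [hee.self_of_nhds, h0]
  have hnull : ∀ᶠ x in 𝓝 p, ∀ w, fderiv ℝ (localMap f e φ) (e x) w = 0 ↔
      fderiv ℝ (localMap f' e₁ φ') (e₁ (Φ x)) w = 0 := by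
    rw [he.eventually_iff] at heq
    filter_upwards [heq, eventually_isCoordAt hf he hφ,
      hΦ.eventually (eventually_isCoordAt hf' he₁ hφ'), hee] with x h1 h2 h3 h4 w
    have h5 := h1 w w
    rw [h4] at h5 ⊢
    have hP : (localMetric g φ (localMap f e φ (e₁ (Φ x)))).PosDef := by
      rw [← h4, localMap_self h2.1]
      exact h2.2.isMetricAt.self_of_nhds.2
    have hP' : (localMetric g' φ' (localMap f' e₁ φ' (e₁ (Φ x)))).PosDef := by
      rw [localMap_self h3.1]
      exact h3.2.isMetricAt.self_of_nhds.2
    constructor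
    · intro h6
      by_contra h7
      rw [h6, gInner_zero_left] at h5
      exact (gInner_self_pos hP' h7).ne h5
    · intro h6
      by_contra h7
      rw [h6, gInner_zero_left] at h5
      exact (gInner_self_pos hP h7).ne' h5
  refine ⟨he, h0', ?_, ?_, ?_⟩
  · rw [mfderiv_coordVec_eq_zero_iff hf he hφ, pderiv, hnull.self_of_nhds]
    exact (mfderiv_coordVec_eq_zero_iff hf' he₁ hφ' 0).1 hu
  · filter_upwards [hΦ.eventually hsing, hnull, hee, eventually_isCoordAt hf he hφ,
      hΦ.eventually (eventually_isCoordAt hf' he₁ hφ')] with x h1 h2 h3 h4 h5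
    rw [h3, ← h1, isSingularPt_iff hf h4.1 h4.2, isSingularPt_iff hf' h5.1 h5.2]
    simp only [h2]
  · rw [tangentNorm_coordVec hf' he₁ hφ', h0] at hv
    rw [tangentNorm_coordVec hf he hφ, h0', ← hv, gNorm, gNorm]
    have h1 := heq.self_of_nhds (basisVec 1) (basisVec 1)
    rw [h0'] at h1
    exact congrArg Real.sqrt h1

theorem IsLimitingNormalCurvature.unique {k k' : ℝ} (h : IsLimitingNormalCurvature g f ν p k)
    (h' : IsLimitingNormalCurvature g f ν p k') : k = k' := by
  obtain ⟨⟨e, he⟩, h⟩ := h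
  have hφ : IsCoordAt (chartAt (Euc 3) (f p)) (f p) :=
    ⟨IsManifold.chart_mem_maximalAtlas _, mem_chart_source _ _⟩
  exact (h e _ he hφ).trans (h'.2 e _ he hφ).symm

theorem IsLimitingCuspidalCurvature.unique {τ τ' : ℝ} (h : IsLimitingCuspidalCurvature g f p τ)
    (h' : IsLimitingCuspidalCurvature g f p τ') : τ = τ' := by
  obtain ⟨⟨γ, κ, hγ, hκ⟩, h⟩ := h
  exact tendsto_nhds_unique (h γ κ hγ hκ) (h'.2 γ κ hγ hκ)

theorem Real.sign_mul_abs_self (x : ℝ) : Real.sign x * |x| = x := by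
  rcases lt_trichotomy x 0 with h | h | h
  · rw [Real.sign_of_neg h, abs_of_neg h]; ring
  · simp [h]
  · rw [Real.sign_of_pos h, abs_of_pos h, one_mul]

/-- Uniqueness of the limits identifies the numbers in the product with their frame expressions;
sgn(x)|x| = x absorbs the sign of κ_H, and |σ| = 1 removes σ. -/
theorem IsSignedProduct.abs_eq [IsManifold (𝓡 2) ∞ S] (hf : ContMDiff (𝓡 2) (𝓡 3) ∞ f) (hp : IsSwallowtail f p)
    {w : ℝ} (hw : IsSignedProduct g f p w) :
    ∃ (ν : ∀ x, TangentSpace (𝓡 3) (f x)) (e : OpenPartialHomeomorph S (Euc 2)) (m d b k : ℝ),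
      IsSwallowtailChart g f ν p e m d b k ∧ |w| = √(2 * √(d / |m|)) * |b * k / d| := by
  obtain ⟨U, ν, e', κH, κν, τc, hU, hpU, hν, he', hH, hκ, hτ, rfl⟩ := hw
  obtain ⟨e, m, h⟩ := exists_isSwallowtailChart (g := g) hf hp
  obtain ⟨d, b, k, K⟩ := h U ν hU hpU hν
  refine ⟨ν, e, m, d, b, k, K, ?_⟩
  rw [hκ.unique (K.isLimitingNormalCurvature hf), hτ.unique (K.isLimitingCuspidalCurvature hf),
    hH.unique (K.isKappaH hf he')]
  have hσ : |fderiv ℝ (e ∘ e'.symm) 0 (basisVec 1) 1| = 1 := K.abs_sign hf he'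
  set σ := fderiv ℝ (e ∘ e'.symm) 0 (basisVec 1) 1
  have h1 : |b / d| = |σ * (b / d)| := by rw [abs_mul, hσ, one_mul]
  have h2 : Real.sign (σ * (b / d)) * k * (√(2 * √(d / |m|)) * |b / d|) =
      √(2 * √(d / |m|)) * (σ * (b * k / d)) := by
    rw [h1]
    linear_combination (k * √(2 * √(d / |m|))) * Real.sign_mul_abs_self (σ * (b / d))
  rw [h2, abs_mul, abs_mul σ, hσ, one_mul, abs_of_nonneg (Real.sqrt_nonneg _)]

end

end

/-! ### Assembly of the identities and of the intrinsicness. -/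

theorem proposition3 {S : Type*} [TopologicalSpace S] [ChartedSpace (Euc 2) S]
    [IsManifold (𝓡 2) ∞ S] {M : Type*} [TopologicalSpace M] [ChartedSpace (Euc 3) M]
    [IsManifold (𝓡 3) ∞ M] (g : RMetric M) (f : S → M) (hf : IsFront g f)
    (p : S) (hp : IsSwallowtail f p) :
    -- the identities, for every choice of the unit normal field and of adapted coordinates
    (∃ e, IsAdapted g f p e) ∧
    (∀ (U : Set S) (ν : ∀ x, TangentSpace (𝓡 3) (f x)),
      IsOpen U → p ∈ U → IsUnitNormalOn g f ν U →
      ∃ κν τs τc : ℝ, IsLimitingNormalCurvature g f ν p κν ∧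
        IsLimitingSingularCurvature g f ν p τs ∧ IsLimitingCuspidalCurvature g f p τc ∧
        ∀ e, IsAdapted g f p e → ∃ κH Khat : ℝ, IsKappaH g f ν p e κH ∧ IsKHat g f p e Khat ∧
          τc = √|τs| * |κH| ∧
          √|τs| * Khat = √|τs| * κν * κH ∧
          √|τs| * κν * κH = Real.sign κH * κν * τc) ∧
    -- the absolute value of the right hand side is determined by the first fundamental form
    (∀ {S' : Type*} [TopologicalSpace S'] [ChartedSpace (Euc 2) S'] [IsManifold (𝓡 2) ∞ S']
      {M' : Type*} [TopologicalSpace M'] [ChartedSpace (Euc 3) M'] [IsManifold (𝓡 3) ∞ M']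
      (g' : RMetric M') (f' : S' → M') (p' : S') (Φ : S → S'),
      IsFront g' f' → IsSwallowtail f' p' →
      IsLocalDiffeomorphAt (𝓡 2) (𝓡 2) ∞ Φ p → Φ p = p' →
      (∀ᶠ x in 𝓝 p, ∀ a b : TangentSpace (𝓡 2) x,
        firstFundamentalForm g' f' (Φ x) (mfderiv (𝓡 2) (𝓡 2) Φ x a) (mfderiv (𝓡 2) (𝓡 2) Φ x b)
          = firstFundamentalForm g f x a b) →
      ∀ w w' : ℝ, IsSignedProduct g f p w → IsSignedProduct g' f' p' w' → |w| = |w'|) := by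
  obtain ⟨hsm, hfront⟩ := hf
  refine ⟨?_, fun U ν hU hpU hν => ?_, ?_⟩
  · obtain ⟨U, hU, hpU, ν, hν, -⟩ := hfront p
    obtain ⟨e, m, h⟩ := exists_isSwallowtailChart (g := g) hsm hp
    obtain ⟨d, b, k, K⟩ := h U ν hU hpU hν
    exact ⟨e, K.isAdapted hsm⟩
  · obtain ⟨e, m, h⟩ := exists_isSwallowtailChart (g := g) hsm hp
    obtain ⟨d, b, k, K⟩ := h U ν hU hpU hν
    refine ⟨k, _, _, K.isLimitingNormalCurvature hsm, K.isLimitingSingularCurvature hsm,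
      K.isLimitingCuspidalCurvature hsm, fun e' he' => ⟨_, _, K.isKappaH hsm he',
      K.isKHat hsm he', ?_, ?_, ?_⟩⟩
    all_goals
      have hσ : |fderiv ℝ (e ∘ e'.symm) 0 (basisVec 1) 1| = 1 := K.abs_sign hsm he'
      rw [abs_of_nonneg (by positivity : 0 ≤ 2 * √(d / |m|))]
    · rw [abs_mul, hσ, one_mul]
    · ring
    · have h1 : |b / d| = |fderiv ℝ (e ∘ e'.symm) 0 (basisVec 1) 1 * (b / d)| := by
        rw [abs_mul, hσ, one_mul]
      rw [h1]
      -- sgn(κ_H)|κ_H| = κ_H also holds for κ_H = 0, so no case distinction is needed.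
      linear_combination -(k * √(2 * √(d / |m|))) *
        Real.sign_mul_abs_self (fderiv ℝ (e ∘ e'.symm) 0 (basisVec 1) 1 * (b / d))
  · intro S' _ _ _ M' _ _ _ g' f' p' Φ hf' hp' hΦ hΦp hiso w w' hw hw'
    subst hΦp
    have hsm' := hf'.1
    obtain ⟨ν, e₀, m, d, b, k, K, hw⟩ := hw.abs_eq hsm hp
    obtain ⟨ν', e₁, m', d', b', k', K', hw'⟩ := hw'.abs_eq hsm' hp'
    -- In the chart e₁ pulled back by Φ the two maps have the same first form matrix. The pulled
    -- back chart is adapted to f but need not be a swallowtail chart of f, hence the Jacobian `J`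
    -- below.
    obtain ⟨e, he, hee⟩ := hΦ.exists_isCoordAt K'.coord
    have hφ : IsCoordAt (chartAt (Euc 3) (f p)) (f p) :=
      ⟨IsManifold.chart_mem_maximalAtlas _, mem_chart_source _ _⟩
    have hφ' : IsCoordAt (chartAt (Euc 3) (f' (Φ p))) (f' (Φ p)) :=
      ⟨IsManifold.chart_mem_maximalAtlas _, mem_chart_source _ _⟩
    have heq := eventually_gInner_eq hsm hsm' hΦ hiso he K'.coord hee hφ hφ'
    have hA' := K'.isAdapted hsm'
    have hA := IsAdapted.of_isometric hsm hsm' hΦ.contMDiffAt.continuousAt hA' he hee hφ hφ' heq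
    rw [hA.2.1] at heq
    have hform : ∀ᶠ z in 𝓝 (0 : Euc 2),
        firstForm (localMetric g (chartAt (Euc 3) (f p))) (localMap f e (chartAt (Euc 3) (f p))) z =
        firstForm (localMetric g' (chartAt (Euc 3) (f' (Φ p))))
          (localMap f' e₁ (chartAt (Euc 3) (f' (Φ p)))) z := by
      filter_upwards [heq] with z hz
      ext i j
      exact hz (basisVec i) (basisVec j)
    obtain ⟨J, hJ, hdet, hdiv⟩ := K.firstForm_limits hsm hA hφ
    obtain ⟨J', hJ', hdet', hdiv'⟩ := K'.firstForm_limits hsm' hA' hφ'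
    have := neBot_nhdsWithin_snd
    have e1 : J ^ 2 * d = J' ^ 2 * d' := by
      refine tendsto_nhds_unique hdet (hdet'.congr' ?_)
      filter_upwards [nhdsWithin_le_nhds hform] with z hz
      rw [hz]
    have e2 : |m| * J ^ 2 = |m'| * J' ^ 2 := by
      refine tendsto_nhds_unique hdiv (hdiv'.congr' ?_)
      have ht : Tendsto (fun t : ℝ => t • (basisVec 0 : Euc 2)) (𝓝 0) (𝓝 0) := by
        have h1 : Continuous fun t : ℝ => t • (basisVec 0 : Euc 2) := by fun_prop
        have := h1.tendsto 0
        rwa [zero_smul] at this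
      filter_upwards [nhdsWithin_le_nhds (ht.eventually hform)] with t hz
      rw [hz]
    -- The quotient of the two limits, in which the squared Jacobians cancel.
    have e3 : d / |m| = d' / |m'| := by
      have h1 : 0 < |m| := abs_pos.2 K.pos.2
      have h2 : 0 < |m'| := abs_pos.2 K'.pos.2
      rw [div_eq_div_iff h1.ne' h2.ne']
      refine mul_left_cancel₀ (mul_ne_zero (pow_ne_zero 2 hJ) (pow_ne_zero 2 hJ')) ?_
      linear_combination (J' ^ 2 * |m'|) * e1 - (J' ^ 2 * d') * e2
    -- The Gaussian curvature is computed from the first form alone, so both values of K̂ are limits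
    -- of the same function.
    have e4 := tendsto_nhds_unique (K.isKHat hsm hA _ hφ)
      ((K'.isKHat hsm' hA' _ hφ').congr' (by
        filter_upwards [nhdsWithin_le_nhds hform.eventually_nhds] with z hz
        rw [gaussCurvature_congr (hz.mono fun y hy => hy.symm)]))
    have hσ := K.sign_sq hsm hA
    have hσ' := K'.sign_sq hsm' hA'
    -- Squaring removes the signs of the two transitions.
    have e5 : |b * k / d| = |b' * k' / d'| := by
      rw [← sq_eq_sq_iff_abs_eq_abs]
      have h1 := congrArg (fun x : ℝ => x ^ 2) e4
      simp only [mul_pow] at h1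
      rwa [hσ, hσ', one_mul, one_mul] at h1
    rw [hw, hw', e3, e5]
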